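/- **Conventions.** A CAT(0) cube complex is a cube complex (cubes glued along faces, two cubes being disjoint or meeting in a common face) that is simply connected and all of whose vertex links are flag; it need not be locally finite. $X^{(0)}$ denotes its vertex set, with the $\ell_1$-metric $d(\cdot,\cdot)$, i.e. the path metric of the 1-skeleton; geodesics between vertices are shortest edge paths, and $X$ is $\delta$-hyperbolic if geodesic triangles are $\delta$-slim. $\mathrm{Aut}(X)$ is the group of cubical automorphisms. More generally, let $\Gamma$ be a connected graph with vertex set $V$ and path metric $d$. *Globally stable cylinders.* Let $\theta,R\ge 0$, $k\in\mathbb N$. A map $C:V\times V\to 2^{V}$ is a choice of $\theta$-cylinders if $[x,y]\subseteq C(x,y)\subseteq N_\theta([x,y])$ for all $x,y\in V$ and every geodesic $[x,y]$. It is inversion invariant if $C(x,y)=C(y,x)$ for all $x,y$. It is $(k,R)$-stable if for all $x,y,z\in V$ there are $k$ balls $B_1,\dots,B_k$ of radius $R$ such that $$(C(x,y)\cap B(x,\rho))\setminus\bigcup_{i=1}^k B_i=(C(x,z)\cap B(x,\rho))\setminus\bigcup_{i=1}^k B_i,\qquad \rho=\tfrac12\big(d(x,y)+d(x,z)-d(y,z)\big).$$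 $C$ is globally stable if it is inversion invariant and $(k,R)$-stable for some $k,R$. *The sets $I_D(x,y)$.* Each hyperplane $\hat h$ of a CAT(0) cube complex $X$ bounds two complementary halfspaces $h,h^*$ (considered here through the vertices they contain). A pencil is a strictly nested sequence of halfspaces $h_1<\dots<h_n$, or the corresponding sequence of hyperplanes; a grid of size $m$ is a pair of pencils $\hat h_1,\dots,\hat h_m$ and $\hat k_1,\dots,\hat k_m$ such that every $\hat h_i$ crosses every $\hat k_j$. For $x,y\in X^{(0)}$ and $D\in\mathbb N$, a halfspace $h$ is $D$-peripheral to $(x,y)$ if $x,y\in h^*$ and there is no pencil of more than $D$ halfspaces $k$ with $x\notin k\ni y$ all of whose hyperplanes cross $\hat h$. Let $I_D(x,y)$ be the intersection of $h^*$ over all halfspaces $h$ that are $D$-peripheral to $(x,y)$. *Groups.* A group is hyperbolic if it has a hyperbolic Cayley graph with respect to some finite generating set, and cubulated if it acts properly and cocompactly by automorphisms on a CAT(0) cube complex. A group $G$ admits globally stable cylinders if it acts properly and cocompactly on some connected hyperbolic graph $\Gamma$ that has, for some $\theta \ge 0$, a globally stable choice $C$ of $\theta$-cylinders which is $G$-invariant,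 i.e. $C(gx,gy)=g\,C(x,y)$ for all vertices $x,y$ and all $g\in G$. **Theorem.** (1) For every $\delta$ and $d$ there are $\theta,R\ge0$ and $k\in\mathbb N$, depending only on $\delta$ and $d$, such that the following holds for every $\delta$-hyperbolic CAT(0) cube complex $X$ of dimension at most $d$. There is a largest $D$ such that $X$ contains a grid of size $D$, and for this $D$ the map $C(x,y)=I_D(x,y)$ is a choice of $\theta$-cylinders on $X^{(0)}$ which is inversion invariant, $(k,R)$-stable, and $\mathrm{Aut}(X)$-invariant: $C(gx,gy)=g\,C(x,y)$ for all $x,y\in X^{(0)}$ and $g\in\mathrm{Aut}(X)$. In particular $X$ admits $\mathrm{Aut}(X)$-invariant globally stable cylinders. (2) Every hyperbolic cubulated group admits globally stable cylinders. -/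

import Mathlib

/-! ### Hyperbolic graphs and globally stable cylinders

A connected graph is regarded as a discrete geodesic space: its points are the vertices, its
distance is the path metric `SimpleGraph.dist`, and its geodesics are the shortest edge paths. -/

namespace SimpleGraph

variable {V : Type*} (Γ : SimpleGraph V)

/-- A walk is geodesic if its length is the distance between its endpoints. -/
def IsGeodesicWalk {x y : V} (p : Γ.Walk x y) : Prop := p.length = Γ.dist x y

/-- Geodesic triangles are `δ`-slim: each side lies in the `δ`-neighbourhood of the union of the
two other sides. -/
def IsSlim (δ : ℝ) : Prop :=
  ∀ (x y z : V) (p : Γ.Walk x y) (q : Γ.Walk y z) (r : Γ.Walk x z),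
    Γ.IsGeodesicWalk p → Γ.IsGeodesicWalk q → Γ.IsGeodesicWalk r →
    ∀ v ∈ p.support, ∃ w, (w ∈ q.support ∨ w ∈ r.support) ∧ (Γ.dist v w : ℝ) ≤ δ

/-- A connected graph is hyperbolic if it is `δ`-hyperbolic (slim triangles) for some `δ`. -/
def IsHyperbolicGraph : Prop := Γ.Connected ∧ ∃ δ : ℝ, Γ.IsSlim δ

/-- The closed ball. -/
def vertexBall (x : V) (r : ℝ) : Set V := {w | (Γ.dist x w : ℝ) ≤ r}

/-- The Gromov product `(y.z)_x`. -/
noncomputable def gromovProduct (x y z : V) : ℝ :=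
  ((Γ.dist x y : ℝ) + Γ.dist x z - Γ.dist y z) / 2

/-- `C` is a choice of `θ`-cylinders: `[x,y] ⊆ C(x,y) ⊆ N_θ([x,y])` for every geodesic `[x,y]`. -/
def IsCylinders (θ : ℝ) (C : V → V → Set V) : Prop :=
  ∀ (x y : V) (p : Γ.Walk x y), Γ.IsGeodesicWalk p →
    (∀ v ∈ p.support, v ∈ C x y) ∧
    ∀ w ∈ C x y, ∃ v ∈ p.support, (Γ.dist w v : ℝ) ≤ θ

/-- `(k,R)`-stability: for all `x, y, z`, inside the ball about `x` whose radius is the Gromov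
product `(y.z)_x`, the sets `C(x,y)` and `C(x,z)` agree off `k` balls of radius `R`. -/
def IsStable (k : ℕ) (R : ℝ) (C : V → V → Set V) : Prop :=
  ∀ x y z : V, ∃ b : Fin k → V,
    (C x y ∩ Γ.vertexBall x (Γ.gromovProduct x y z)) \ ⋃ i, Γ.vertexBall (b i) R =
    (C x z ∩ Γ.vertexBall x (Γ.gromovProduct x y z)) \ ⋃ i, Γ.vertexBall (b i) R

/-- `C` is a globally stable choice of `θ`-cylinders, with stability constants `k` and `R`. -/
structure IsGloballyStable (θ : ℝ) (k : ℕ) (R : ℝ) (C : V → V → Set V) : Prop where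
  cylinders : Γ.IsCylinders θ C
  inversion : ∀ x y : V, C x y = C y x
  stable : Γ.IsStable k R C

end SimpleGraph

/-! ### Cube complexes -/

/-- The faces of the cube `{0,1}^n` (by their vertex sets): fix the coordinates in a set `S`. -/
def IsCubeFace {n : ℕ} (A : Set (Fin n → Bool)) : Prop :=
  ∃ (S : Set (Fin n)) (a : Fin n → Bool), A = {x | ∀ i ∈ S, x i = a i}

/-- `e` identifies the cube `{0,1}^n` with a cube of the family `cubes`: the members of `cubes`
contained in the image of `e` are exactly the images of the faces of `{0,1}^n`. -/
def IsCubeChart {V : Type*} (cubes : Set (Set V)) {n : ℕ} (e : (Fin n → Bool) → V) : Prop :=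
  Function.Injective e ∧
    ∀ F ⊆ Set.range e, (F ∈ cubes ↔ ∃ A, IsCubeFace A ∧ F = e '' A)

/-- A cube complex with vertex set `V`, given by the vertex sets of its cubes: a collection of
cubes, closed under passing to faces, in which two cubes are disjoint or meet in a common face. -/
structure CubeComplex (V : Type*) where
  cubes : Set (Set V)
  singleton_mem : ∀ v : V, {v} ∈ cubes
  exists_chart : ∀ Q ∈ cubes, ∃ (n : ℕ) (e : (Fin n → Bool) → V),
    IsCubeChart cubes e ∧ Set.range e = Q
  inter_mem : ∀ P ∈ cubes, ∀ Q ∈ cubes, (P ∩ Q).Nonempty → P ∩ Q ∈ cubes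

namespace CubeComplex

variable {V : Type*} (X : CubeComplex V)

/-- The dimension of `X` is at most `d`. -/
def DimLE (d : ℕ) : Prop :=
  ∀ (n : ℕ) (e : (Fin n → Bool) → V), IsCubeChart X.cubes e → n ≤ d

/-- The 1-skeleton. Its path metric is the `ℓ₁`-metric on the vertices of `X`. -/
def skeleton : SimpleGraph V where
  Adj x y := x ≠ y ∧ {x, y} ∈ X.cubes
  symm := ⟨fun x y h => ⟨h.1.symm, by rw [Set.pair_comm]; exact h.2⟩⟩
  loopless := ⟨fun _ h => h.1 rfl⟩

/-- `a, b, c, d` are the vertices of a square of `X`, in cyclic order. -/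
structure IsSquare (a b c d : V) : Prop where
  ab : X.skeleton.Adj a b
  bc : X.skeleton.Adj b c
  cd : X.skeleton.Adj c d
  da : X.skeleton.Adj d a
  ac : a ≠ c
  bd : b ≠ d
  mem : {a, b, c, d} ∈ X.cubes

/-- Homotopy of edge paths, rel endpoints: generated by inserting or deleting backtracks and by
pushing across squares. -/
inductive EdgeHomotopic : {x y : V} → X.skeleton.Walk x y → X.skeleton.Walk x y → Prop
  | refl {x y : V} (p : X.skeleton.Walk x y) : EdgeHomotopic p p
  | symm {x y : V} {p q : X.skeleton.Walk x y} : EdgeHomotopic p q → EdgeHomotopic q p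
  | trans {x y : V} {p q r : X.skeleton.Walk x y} :
      EdgeHomotopic p q → EdgeHomotopic q r → EdgeHomotopic p r
  | append {x y z : V} {p p' : X.skeleton.Walk x y} {q q' : X.skeleton.Walk y z} :
      EdgeHomotopic p p' → EdgeHomotopic q q' → EdgeHomotopic (p.append q) (p'.append q')
  | backtrack {x y : V} (h : X.skeleton.Adj x y) :
      EdgeHomotopic (.cons h (.cons h.symm .nil)) .nil
  | square {a b c d : V} (h : X.IsSquare a b c d) :
      EdgeHomotopic (.cons h.ab (.cons h.bc .nil)) (.cons h.da.symm (.cons h.cd.symm .nil))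

/-- `X` is simply connected: it is connected and every edge loop is null-homotopic. -/
def SimplyConnected : Prop :=
  X.skeleton.Connected ∧
    ∀ (x : V) (p : X.skeleton.Walk x x), X.EdgeHomotopic p .nil

/-- `S` spans a simplex in the link of `v`: it is the set of neighbours of `v` in some cube. -/
def IsLinkSimplex (v : V) (S : Set V) : Prop :=
  ∃ Q ∈ X.cubes, v ∈ Q ∧ S = {w ∈ Q | X.skeleton.Adj v w}

/-- The link of every vertex is a flag complex: finitely many vertices of the link which are
pairwise joined by edges of the link span a simplex. -/
def FlagLinks : Prop :=
  ∀ (v : V) (S : Set V), S.Finite → (∀ a ∈ S, X.skeleton.Adj v a) →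
    (∀ a ∈ S, ∀ b ∈ S, a ≠ b → X.IsLinkSimplex v {a, b}) → X.IsLinkSimplex v S

/-- CAT(0) cube complexes: simply connected, with flag links. -/
def IsCAT0 : Prop := X.SimplyConnected ∧ X.FlagLinks

/-- The group of automorphisms of `X`: bijections of the vertices that preserve the cubes. -/
def Aut : Subgroup (Equiv.Perm V) where
  carrier := {g | ∀ Q : Set V, g '' Q ∈ X.cubes ↔ Q ∈ X.cubes}
  one_mem' := by intro Q; simp
  mul_mem' := by
    intro a b ha hb Q
    rw [Equiv.Perm.coe_mul, Set.image_comp, ha, hb]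
  inv_mem' := by
    intro a ha Q
    rw [← ha, ← Set.image_comp, ← Equiv.Perm.coe_mul, mul_inv_cancel]
    simp

/-! ### Hyperplanes and halfspaces -/

/-- Two edges are opposite edges of a square. -/
def ElemParallel (e f : Sym2 V) : Prop :=
  ∃ a b c d : V, X.IsSquare a b c d ∧ e = s(a, b) ∧ f = s(d, c)

/-- Hyperplanes, each given by the set of edges that it crosses (a parallelism class of edges). -/
def IsHyperplane (H : Set (Sym2 V)) : Prop :=
  ∃ e ∈ X.skeleton.edgeSet, H = {f | Relation.EqvGen X.ElemParallel e f}

/-- A halfspace: a hyperplane with a component of its complement, the latter given by the vertices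
it contains. The complementary halfspace has the complementary vertex set. -/
structure Halfspace where
  hyperplane : Set (Sym2 V)
  isHyperplane : X.IsHyperplane hyperplane
  carrier : Set V
  isComponent : ∃ c : (X.skeleton.deleteEdges hyperplane).ConnectedComponent, carrier = c.supp

/-- Two hyperplanes intersect (are transverse): they cross in some square. -/
def Transverse (H K : Set (Sym2 V)) : Prop :=
  ∃ a b c d : V, X.IsSquare a b c d ∧ s(a, b) ∈ H ∧ s(b, c) ∈ K

variable {X}

/-- A pencil: a strictly nested sequence `k₁ < ... < kₙ` of halfspaces. -/
def IsPencil {n : ℕ} (k : Fin n → X.Halfspace) : Prop :=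
  ∀ i j, i < j → (k i).carrier ⊂ (k j).carrier

/-- The intersection number `i(h, K)`: the maximal size, possibly infinite, of a pencil of
hyperplanes bounding halfspaces in `K` that all intersect the hyperplane of `h`. -/
noncomputable def interNumber (h : X.Halfspace) (K : Set X.Halfspace) : ℕ∞ :=
  ⨆ (n : ℕ) (_ : ∃ k : Fin n → X.Halfspace, IsPencil k ∧ (∀ i, k i ∈ K) ∧
    ∀ i, X.Transverse h.hyperplane (k i).hyperplane), (n : ℕ∞)

variable (X)

/-- The halfspaces separating `x` from `y`. -/
def separating (x y : V) : Set X.Halfspace := {k | x ∉ k.carrier ∧ y ∈ k.carrier}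

/-- The peripheral halfspaces: those whose complement contains `x` and `y`. -/
def peripheral (x y : V) : Set X.Halfspace := {h | x ∈ h.carrierᶜ ∧ y ∈ h.carrierᶜ}

/-- The `D`-peripheral halfspaces. -/
def peripheralD (D : ℕ) (x y : V) : Set X.Halfspace :=
  {h ∈ X.peripheral x y | interNumber h (X.separating x y) ≤ (D : ℕ∞)}

/-- `I_D(x,y)`: the intersection of the complements of the `D`-peripheral halfspaces. -/
def intervalD (D : ℕ) (x y : V) : Set V := ⋂ h ∈ X.peripheralD D x y, h.carrierᶜ

/-- `X` contains a grid of size `m`: two pencils of `m` hyperplanes, each hyperplane of the first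
intersecting each hyperplane of the second. -/
def HasGrid (m : ℕ) : Prop :=
  ∃ h k : Fin m → X.Halfspace, IsPencil h ∧ IsPencil k ∧
    ∀ i j, X.Transverse (h i).hyperplane (k j).hyperplane

end CubeComplex

/-! ### Groups -/

/-- Hyperbolic groups: the Cayley graph of some finite generating set is hyperbolic. -/
def IsHyperbolicGroup (G : Type*) [Group G] : Prop :=
  ∃ S : Set G, S.Finite ∧ Subgroup.closure S = ⊤ ∧
    (SimpleGraph.mulCayley S).IsHyperbolicGraph

universe u v

/-- Cubulated groups: `G` acts properly and cocompactly, by automorphisms, on a CAT(0) cube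
complex. Cocompactness says that there are finitely many orbits of cubes. -/
def IsCubulated (G : Type u) [Group G] : Prop :=
  ∃ (V : Type v) (X : CubeComplex V) (ρ : G →* X.Aut), X.IsCAT0 ∧
    (∀ (x : V) (r : ℕ), {g : G | X.skeleton.dist x ((ρ g : Equiv.Perm V) x) ≤ r}.Finite) ∧
    ∃ K : Set (Set V), K.Finite ∧
      ∀ Q ∈ X.cubes, ∃ P ∈ K, ∃ g : G, Q = (ρ g : Equiv.Perm V) '' P

/-- `G` admits globally stable cylinders: it acts properly and cocompactly on a hyperbolic graph
which admits `G`-invariant globally stable cylinders. -/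
def AdmitsGloballyStableCylinders (G : Type u) [Group G] : Prop :=
  ∃ (V : Type v) (Γ : SimpleGraph V) (ρ : G →* (Γ ≃g Γ)), Γ.IsHyperbolicGraph ∧
    (∀ (x : V) (r : ℕ), {g : G | Γ.dist x (ρ g x) ≤ r}.Finite) ∧
    (∃ K : Set V, K.Finite ∧ ∀ x : V, ∃ y ∈ K, ∃ g : G, x = ρ g y) ∧
    (∃ K : Set (Sym2 V), K.Finite ∧
      ∀ e ∈ Γ.edgeSet, ∃ f ∈ K, ∃ g : G, e = f.map (ρ g)) ∧
    ∃ (θ : ℝ) (k : ℕ) (R : ℝ) (C : V → V → Set V), 0 ≤ θ ∧ 0 ≤ R ∧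
      Γ.IsGloballyStable θ k R C ∧
      ∀ (g : G) (x y : V), C (ρ g x) (ρ g y) = ρ g '' C x y

/-!
Let `X` be a CAT(0) cube complex. Pushing edge paths across squares is analysed with a Levi type
lemma, `SquareEquiv.levi`, which is the place where the flag condition enters, in the form that
three squares pairwise sharing an edge at a vertex are faces of a 3-cube. It makes reduced edge
paths unique up to pushing across squares: edge paths act on classes of reduced paths, homotopic
paths act alike, and `X` is simply connected. Applied to geodesics this is the quadrangle
condition `IsCAT0.exists_isSquare`. Hence the halfspaces of `X` are the sets `nearSet a b` of the
vertices closer to one end of an edge `a, b` than to the other, the distance of two vertices is the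
number of halfspaces separating them, and medians exist. From there on everything is expressed by
the family `𝓗` of vertex sets of halfspaces (`IsMedianSystem`), in which two hyperplanes are
transverse if and only if all four sectors that they define are nonempty (`Crosses`).

Hyperbolicity amounts to a bound on the shorter side of rectangles, `HasThinRectangles`. Slimness
gives such a bound `n` (`IsSlim.hasThinRectangles`), and conversely (`HasThinRectangles.isSlim`).
The bound applies to grids, so there is a largest grid size `D ≤ n`; and it applies to the
rectangles found inside the cubes spanned by families of pairwise crossing halfspaces, so by
Mirsky's theorem a set of more than `B = (2n + 1)n` halfspaces separating the same two vertices
contains a pencil of size `D + 1`. This is `IsThin`. No bound on the dimension is needed, since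
`HasThinRectangles` contains one.

The set `I_D(x, y)` becomes `pencilHull`. If a point `w` of it were cut off from `x` and `y` by more
than `B` halfspaces, then some pencil of size `D + 1` would do so, and the pencil crossing its
smallest member, which exists by definition of the hull, would cross all of it: a grid that is too
large. So `w` is close to the median of `x, y, w`, whence to each geodesic from `x` to `y`.

For stability, let `m` be the median of `x, y, z`. A point `w` in the hull of `x, y`, not beyond `m`
and not in the hull of `x, z`, is either close to `m` or accompanied by a halfspace `h` and a pencil
`f` crossing it with `z` outside the smallest member `f 0` (`IsStabilityDefect`). Two points with
the same `f 0` are close to each other (`IsStabilityDefect.dist_le_of_eq`), and among the points far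
from `m` there are at most `B` possibilities for `f 0` (`ncard_smallest_le`), in both cases because
otherwise a grid of size `D + 1` would arise. So boundedly many balls suffice.

For a hyperbolic cubulated group, the vertices of the complex map quasi-isometrically to the Cayley
graph. A large square in the complex would map to a quadrilateral both halves of whose boundary
stay logarithmically close to every point of a geodesic joining opposite corners, by repeated
bisection; as the two halves of the boundary of a square are far apart except near these corners,
rectangles are thin (`exists_hasThinRectangles`). So the 1-skeleton is hyperbolic, and the hulls in
the complex are the cylinders sought.
-/

/-! ### Squares of a cube complex -/

namespace CubeComplex

section Squares

variable {V : Type*} {X : CubeComplex V}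

theorem exists_ncard_eq_two_pow {Q : Set V} (hQ : Q ∈ X.cubes) : ∃ n, Q.ncard = 2 ^ n := by
  obtain ⟨n, e, he, rfl⟩ := X.exists_chart Q hQ
  refine ⟨n, ?_⟩
  rw [← Set.image_univ, Set.ncard_image_of_injective _ he.1, Set.ncard_univ]
  simp

namespace IsSquare

variable {a b c d d' : V}

theorem rotate (h : X.IsSquare a b c d) : X.IsSquare b c d a :=
  ⟨h.bc, h.cd, h.da, h.ab, h.bd, h.ac.symm, by
    have := h.mem
    rwa [show ({b, c, d, a} : Set V) = {a, b, c, d} by ext; simp; tauto]⟩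

theorem reflect (h : X.IsSquare a b c d) : X.IsSquare a d c b :=
  ⟨h.da.symm, h.cd.symm, h.bc.symm, h.ab.symm, h.ac, h.bd.symm, by
    have := h.mem
    rwa [show ({a, d, c, b} : Set V) = {a, b, c, d} by ext; simp; tauto]⟩

/-- A square is determined by three of its vertices: two squares sharing exactly three vertices
would intersect in a cube with three vertices. -/
theorem unique (h : X.IsSquare a b c d) (h' : X.IsSquare a b c d') : d = d' := by
  by_contra hne
  have hi := X.inter_mem _ h.mem _ h'.mem ⟨a, by simp, by simp⟩
  have hda := h.da.1
  have hdc := h.cd.1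
  have hdb := h.bd
  have hEq : ({a, b, c, d} ∩ {a, b, c, d'} : Set V) = {a, b, c} := by
    ext x
    simp only [Set.mem_inter_iff, Set.mem_insert_iff, Set.mem_singleton_iff]
    constructor
    · rintro ⟨h1, h2⟩
      rcases h1 with h1 | h1 | h1 | h1
      · exact Or.inl h1
      · exact Or.inr (Or.inl h1)
      · exact Or.inr (Or.inr h1)
      · subst h1
        rcases h2 with h2 | h2 | h2 | h2
        · exact Or.inl h2
        · exact Or.inr (Or.inl h2)
        · exact Or.inr (Or.inr h2)
        · exact absurd h2 hne
    · rintro (h1 | h1 | h1) <;> simp [h1]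
  rw [hEq] at hi
  obtain ⟨n, hn⟩ := exists_ncard_eq_two_pow hi
  have h3 : ({a, b, c} : Set V).ncard = 3 := by
    rw [Set.ncard_eq_three]
    exact ⟨a, b, c, h.ab.1, h.ac, h.bc.1, rfl⟩
  rw [h3] at hn
  rcases n with _ | n
  · simp at hn
  · rw [pow_succ] at hn; omega

end IsSquare

/-- The vertex of the cube adjacent to `a` in direction `i`. -/
def flipAt {n : ℕ} (i : Fin n) (a : Fin n → Bool) : Fin n → Bool := Function.update a i (!a i)

theorem flipAt_ne {n : ℕ} (i : Fin n) (a : Fin n → Bool) : flipAt i a ≠ a := by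
  intro h
  have := congrFun h i
  simp [flipAt] at this

theorem flipAt_comm {n : ℕ} {i j : Fin n} (h : i ≠ j) (a : Fin n → Bool) :
    flipAt i (flipAt j a) = flipAt j (flipAt i a) := by
  simp only [flipAt, Function.update_of_ne h, Function.update_of_ne h.symm]
  exact Function.update_comm h.symm _ _ _

theorem flipAt_injective {n : ℕ} {i j : Fin n} {a : Fin n → Bool} (h : flipAt i a = flipAt j a) :
    i = j := by
  by_contra hne
  have := congrFun h i
  simp [flipAt, Function.update_of_ne hne] at this

namespace IsCubeChart

variable {n : ℕ} {e : (Fin n → Bool) → V}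

theorem adj_flipAt (he : IsCubeChart X.cubes e) (a : Fin n → Bool) (i : Fin n) :
    X.skeleton.Adj (e a) (e (flipAt i a)) := by
  refine ⟨fun h => flipAt_ne i a (he.1 h).symm, ?_⟩
  refine (he.2 _ ?_).2 ⟨{x | ∀ k ∈ ({i} : Set (Fin n))ᶜ, x k = a k}, ⟨_, _, rfl⟩, ?_⟩
  · rintro x (rfl | rfl) <;> exact ⟨_, rfl⟩
  · rw [← Set.image_pair]
    congr 1
    ext x
    simp only [Set.mem_insert_iff, Set.mem_singleton_iff, Set.mem_compl_iff, Set.mem_ofPred_eq]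
    constructor
    · rintro (rfl | rfl) k hk
      · rfl
      · simp [flipAt, Function.update_of_ne hk]
    · intro h
      by_cases hi : x i = a i
      · left
        funext k
        by_cases hk : k = i
        · rw [hk, hi]
        · exact h k hk
      · right
        funext k
        by_cases hk : k = i
        · subst hk
          simp only [flipAt, Function.update_self]
          revert hi
          cases x k <;> cases a k <;> simp
        · simp [flipAt, Function.update_of_ne hk, h k hk]

theorem isSquare (he : IsCubeChart X.cubes e) (a : Fin n → Bool) {i j : Fin n} (hij : i ≠ j) :
    X.IsSquare (e a) (e (flipAt i a)) (e (flipAt j (flipAt i a))) (e (flipAt j a)) := by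
  have hne : flipAt j (flipAt i a) ≠ a := by
    intro h
    have := congrFun h i
    simp [flipAt, Function.update_of_ne hij] at this
  refine ⟨adj_flipAt he _ _, adj_flipAt he _ _, ?_, (adj_flipAt he _ _).symm, ?_, ?_, ?_⟩
  · rw [← flipAt_comm hij]
    exact (adj_flipAt he _ _).symm
  · exact fun h => hne (he.1 h).symm
  · exact fun h => hij (flipAt_injective (he.1 h))
  · refine (he.2 _ ?_).2 ⟨{x | ∀ k ∈ ({i, j} : Set (Fin n))ᶜ, x k = a k}, ⟨_, _, rfl⟩, ?_⟩
    · rintro x (rfl | rfl | rfl | rfl) <;> exact ⟨_, rfl⟩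
    · have : ({e a, e (flipAt i a), e (flipAt j (flipAt i a)), e (flipAt j a)} : Set V) =
          e '' {a, flipAt i a, flipAt j (flipAt i a), flipAt j a} := by
        simp only [Set.image_insert_eq, Set.image_singleton]
      rw [this]
      congr 1
      ext x
      simp only [Set.mem_insert_iff, Set.mem_singleton_iff, Set.mem_compl_iff, Set.mem_ofPred_eq,
        not_or]
      constructor
      · rintro (rfl | rfl | rfl | rfl) k ⟨hk, hk'⟩
        · rfl
        · simp [flipAt, Function.update_of_ne hk]
        · simp [flipAt, Function.update_of_ne hk, Function.update_of_ne hk']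
        · simp [flipAt, Function.update_of_ne hk']
      · intro h
        have key : ∀ y : Fin n → Bool, y i = x i → y j = x j →
            (∀ k, k ≠ i → k ≠ j → y k = a k) → x = y := by
          intro y hi hj hk
          funext k
          by_cases hki : k = i
          · rw [hki, hi]
          by_cases hkj : k = j
          · rw [hkj, hj]
          rw [hk k hki hkj, h k ⟨hki, hkj⟩]
        by_cases hi : x i = a i <;> by_cases hj : x j = a j
        · exact Or.inl (key _ hi.symm hj.symm fun _ _ _ => rfl)
        · refine Or.inr (Or.inr (Or.inr (key _ ?_ ?_ ?_)))
          · simp [flipAt, Function.update_of_ne hij, hi]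
          · simp only [flipAt, Function.update_self]
            revert hj
            cases x j <;> cases a j <;> simp
          · intro k _ hk; simp [flipAt, Function.update_of_ne hk]
        · refine Or.inr (Or.inl (key _ ?_ ?_ ?_))
          · simp only [flipAt, Function.update_self]
            revert hi
            cases x i <;> cases a i <;> simp
          · simp [flipAt, Function.update_of_ne hij.symm, hj]
          · intro k hk _; simp [flipAt, Function.update_of_ne hk]
        · refine Or.inr (Or.inr (Or.inl (key _ ?_ ?_ ?_)))
          · simp only [flipAt, Function.update_self, Function.update_of_ne hij]
            revert hi
            cases x i <;> cases a i <;> simp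
          · simp only [flipAt, Function.update_self, Function.update_of_ne hij.symm]
            revert hj
            cases x j <;> cases a j <;> simp
          · intro k hk hk'
            simp [flipAt, Function.update_of_ne hk, Function.update_of_ne hk']

theorem exists_eq_flipAt (he : IsCubeChart X.cubes e) {a : Fin n → Bool} {w : V}
    (hw : w ∈ Set.range e) (hadj : X.skeleton.Adj (e a) w) : ∃ i, w = e (flipAt i a) := by
  obtain ⟨b, rfl⟩ := hw
  have hab : a ≠ b := fun h => hadj.1 (congrArg e h)
  obtain ⟨A, ⟨S, a', rfl⟩, hA⟩ := (he.2 {e a, e b} (by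
    rintro x (rfl | rfl) <;> exact ⟨_, rfl⟩)).1 hadj.2
  rw [← Set.image_pair] at hA
  have hA' := he.1.image_injective hA
  have ha : ∀ i ∈ S, a i = a' i := by
    have : a ∈ ({a, b} : Set _) := by simp
    rwa [hA'] at this
  have hb : ∀ i ∈ S, b i = a' i := by
    have : b ∈ ({a, b} : Set _) := by simp
    rwa [hA'] at this
  obtain ⟨i, hi⟩ := Function.ne_iff.1 hab
  have hiS : i ∉ S := fun h => hi ((ha i h).trans (hb i h).symm)
  refine ⟨i, ?_⟩
  have : flipAt i a ∈ ({a, b} : Set _) := by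
    rw [hA']
    intro k hk
    have hki : k ≠ i := fun h => hiS (h ▸ hk)
    simp [flipAt, Function.update_of_ne hki, ha k hk]
  rcases this with h | h
  · exact absurd h (flipAt_ne i a)
  · rw [h]

end IsCubeChart

/-! ### The 1-skeleton is bipartite -/

/-- Backtracks have length two, and the two ways around a square have equal length. -/
theorem EdgeHomotopic.length_mod_two {x y : V} {p q : X.skeleton.Walk x y}
    (h : X.EdgeHomotopic p q) : p.length % 2 = q.length % 2 := by
  induction h with
  | refl => rfl
  | symm _ ih => exact ih.symm
  | trans _ _ ih₁ ih₂ => exact ih₁.trans ih₂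
  | append _ _ ih₁ ih₂ => simp only [SimpleGraph.Walk.length_append]; omega
  | backtrack => simp
  | square => simp

/-- Adjacent vertices lie at different distances from any third vertex, since edge loops have
even length. -/
theorem SimplyConnected.dist_eq_add_one_or (hX : X.SimplyConnected) (v : V) {x y : V}
    (h : X.skeleton.Adj x y) : X.skeleton.dist v y = X.skeleton.dist v x + 1 ∨
      X.skeleton.dist v x = X.skeleton.dist v y + 1 := by
  obtain ⟨p, hp⟩ := hX.1.exists_walk_length_eq_dist v x
  obtain ⟨q, hq⟩ := hX.1.exists_walk_length_eq_dist v y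
  have h1 := (hX.2 v ((p.append (.cons h .nil)).append q.reverse)).length_mod_two
  simp only [SimpleGraph.Walk.length_append, SimpleGraph.Walk.length_reverse,
    SimpleGraph.Walk.length_cons, SimpleGraph.Walk.length_nil] at h1
  have h2 := hX.1.dist_triangle (u := v) (v := x) (w := y)
  have h3 := hX.1.dist_triangle (u := v) (v := y) (w := x)
  rw [SimpleGraph.dist_eq_one_iff_adj.2 h] at h2
  rw [SimpleGraph.dist_eq_one_iff_adj.2 h.symm] at h3
  omega

theorem IsSquare.not_adj (hX : X.SimplyConnected) {a b c d : V} (h : X.IsSquare a b c d) :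
    ¬ X.skeleton.Adj a c := by
  intro hac
  have h1 := SimpleGraph.dist_eq_one_iff_adj.2 hac
  have h2 := SimpleGraph.dist_eq_one_iff_adj.2 h.ab
  have := hX.dist_eq_add_one_or a h.bc
  omega

theorem IsSquare.isLinkSimplex (hX : X.SimplyConnected) {a b c d : V} (h : X.IsSquare a b c d) :
    X.IsLinkSimplex a {b, d} := by
  refine ⟨_, h.mem, by simp, ?_⟩
  ext w
  simp only [Set.mem_insert_iff, Set.mem_singleton_iff, Set.mem_ofPred_eq]
  constructor
  · rintro (rfl | rfl)
    · exact ⟨by simp, h.ab⟩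
    · exact ⟨by simp, h.da.symm⟩
  · rintro ⟨rfl | rfl | rfl | rfl, hw⟩
    · exact absurd hw (X.skeleton.loopless.irrefl _)
    · simp
    · exact absurd hw (h.not_adj hX)
    · simp

/-- The flag condition for triangles: three squares around a vertex `u`, pairwise sharing an edge at
`u`, are faces of a 3-cube; `o` is the vertex opposite to `u`. -/
theorem IsCAT0.exists_cube (hX : X.IsCAT0) {u a b c ab ac bc : V} (h₁ : X.IsSquare u a ab b)
    (h₂ : X.IsSquare u a ac c) (h₃ : X.IsSquare u b bc c) :
    ∃ o, X.IsSquare a ab o ac ∧ X.IsSquare b ab o bc ∧ X.IsSquare c ac o bc := by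
  obtain ⟨Q, hQ, huQ, hS⟩ := hX.2 u {a, b, c} (by simp) (by
      rintro x (rfl | rfl | rfl)
      exacts [h₁.ab, h₁.da.symm, h₂.da.symm]) (by
    rintro x (rfl | rfl | rfl) y (rfl | rfl | rfl) hxy
    · exact absurd rfl hxy
    · exact h₁.isLinkSimplex hX.1
    · exact h₂.isLinkSimplex hX.1
    · exact h₁.reflect.isLinkSimplex hX.1
    · exact absurd rfl hxy
    · exact h₃.isLinkSimplex hX.1
    · exact h₂.reflect.isLinkSimplex hX.1
    · exact h₃.reflect.isLinkSimplex hX.1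
    · exact absurd rfl hxy)
  obtain ⟨n, e, he, rfl⟩ := X.exists_chart Q hQ
  obtain ⟨x, rfl⟩ := huQ
  have key : ∀ w ∈ ({a, b, c} : Set V), ∃ i, w = e (flipAt i x) := by
    intro w hw
    rw [hS] at hw
    exact IsCubeChart.exists_eq_flipAt he hw.1 hw.2
  obtain ⟨i, rfl⟩ := key a (by simp)
  obtain ⟨j, rfl⟩ := key b (by simp)
  obtain ⟨l, rfl⟩ := key c (by simp)
  have hij : i ≠ j := fun h => h₁.bd (by rw [h])
  have hil : i ≠ l := fun h => h₂.bd (by rw [h])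
  have hjl : j ≠ l := fun h => h₃.bd (by rw [h])
  have e₁ : ab = e (flipAt j (flipAt i x)) :=
    h₁.rotate.rotate.rotate.unique (IsCubeChart.isSquare he x hij).rotate.rotate.rotate
  have e₂ : ac = e (flipAt l (flipAt i x)) :=
    h₂.rotate.rotate.rotate.unique (IsCubeChart.isSquare he x hil).rotate.rotate.rotate
  have e₃ : bc = e (flipAt l (flipAt j x)) :=
    h₃.rotate.rotate.rotate.unique (IsCubeChart.isSquare he x hjl).rotate.rotate.rotate
  subst e₁ e₂ e₃
  refine ⟨e (flipAt l (flipAt j (flipAt i x))), IsCubeChart.isSquare he _ hjl, ?_, ?_⟩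
  · have := IsCubeChart.isSquare he (flipAt j x) hil
    rwa [flipAt_comm hij] at this
  · have := IsCubeChart.isSquare he (flipAt l x) hij
    rwa [flipAt_comm hil, flipAt_comm hjl, flipAt_comm hjl] at this

end Squares

end CubeComplex
/-! ### Edge paths up to pushing across squares -/

namespace CubeComplex

section Paths

variable {V : Type*} {X : CubeComplex V}

variable (X) in
/-- The congruence on lists of vertices (edge paths) generated by pushing across squares. Unlike
homotopy it preserves the length of a path. The lists need not be edge paths, which avoids side
conditions; `isChain_iff` says that the congruence respects those that are. -/
inductive SquareEquiv : List V → List V → Prop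
  | refl (l : List V) : SquareEquiv l l
  | symm {l l' : List V} : SquareEquiv l l' → SquareEquiv l' l
  | trans {l l' l'' : List V} : SquareEquiv l l' → SquareEquiv l' l'' → SquareEquiv l l''
  | cons (a : V) {l l' : List V} : SquareEquiv l l' → SquareEquiv (a :: l) (a :: l')
  | square {a b c d : V} (h : X.IsSquare a b c d) (l : List V) :
      SquareEquiv (a :: b :: c :: l) (a :: d :: c :: l)

namespace SquareEquiv

variable {l l' : List V}

theorem length_eq (h : X.SquareEquiv l l') : l.length = l'.length := by
  induction h with
  | refl => rfl
  | symm _ ih => exact ih.symm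
  | trans _ _ ih₁ ih₂ => exact ih₁.trans ih₂
  | cons _ _ ih => simp [ih]
  | square => simp

theorem head?_eq (h : X.SquareEquiv l l') : l.head? = l'.head? := by
  induction h with
  | refl => rfl
  | symm _ ih => exact ih.symm
  | trans _ _ ih₁ ih₂ => exact ih₁.trans ih₂
  | cons _ _ ih => simp
  | square => simp

theorem getLast?_eq (h : X.SquareEquiv l l') : l.getLast? = l'.getLast? := by
  induction h with
  | refl => rfl
  | symm _ ih => exact ih.symm
  | trans _ _ ih₁ ih₂ => exact ih₁.trans ih₂
  | cons _ _ ih => rw [List.getLast?_cons, List.getLast?_cons, ih]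
  | square h l => simp [List.getLast?_cons]

theorem isChain_iff (h : X.SquareEquiv l l') :
    l.IsChain X.skeleton.Adj ↔ l'.IsChain X.skeleton.Adj := by
  induction h with
  | refl => rfl
  | symm _ ih => exact ih.symm
  | trans _ _ ih₁ ih₂ => exact ih₁.trans ih₂
  | cons a h ih => rw [List.isChain_cons, List.isChain_cons, ih, h.head?_eq]
  | square h l =>
    simp only [List.isChain_cons_cons, h.ab, h.bc, h.da.symm, h.cd.symm, true_and]

theorem exists_cons_of_cons {v : V} {p : List V} (h : X.SquareEquiv (v :: p) l) :
    ∃ q, l = v :: q := by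
  have := h.head?_eq
  cases l with
  | nil => simp at this
  | cons a q => simp at this; exact ⟨q, by rw [this]⟩

/-- If two paths from `v` are equivalent, then either they have the same first edge and equivalent
remainders, or their first edges span a square and both paths can be pushed so as to pass through
the opposite vertex of that square. That this relation is transitive is where 3-cubes enter. -/
theorem levi (hX : X.IsCAT0) {v u w : V} {p q : List V}
    (h : X.SquareEquiv (v :: u :: p) (v :: w :: q)) :
    (u = w ∧ X.SquareEquiv (u :: p) (w :: q)) ∨ ∃ t s, X.IsSquare v u t w ∧
      X.SquareEquiv (u :: p) (u :: t :: s) ∧ X.SquareEquiv (w :: q) (w :: t :: s) := by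
  -- induction on the length and, within it, on the derivation of the equivalence
  suffices H : ∀ n : ℕ, ∀ l l' : List V, X.SquareEquiv l l' → ∀ v u p w q, p.length = n →
      l = v :: u :: p → l' = v :: w :: q →
      ((u = w ∧ X.SquareEquiv (u :: p) (w :: q)) ∨ ∃ t s, X.IsSquare v u t w ∧
      X.SquareEquiv (u :: p) (u :: t :: s) ∧ X.SquareEquiv (w :: q) (w :: t :: s)) from
    H _ _ _ h v u p w q rfl rfl rfl
  intro n
  induction n using Nat.strong_induction_on with
  | _ n IH =>
  intro l l' h
  induction h with
  | refl l =>
    rintro v u p w q - rfl h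
    simp only [List.cons.injEq, true_and] at h
    obtain ⟨rfl, rfl⟩ := h
    exact Or.inl ⟨rfl, .refl _⟩
  | @symm l₁ l₂ h ih =>
    rintro v u p w q hp rfl rfl
    have hl := h.length_eq
    simp only [List.length_cons] at hl
    rcases ih v w q u p (by omega) rfl rfl with ⟨rfl, h⟩ | ⟨t, s, h1, h2, h3⟩
    · exact Or.inl ⟨rfl, h.symm⟩
    · exact Or.inr ⟨t, s, h1.reflect, h3, h2⟩
  | @trans l₁ l₂ l₃ h₁ h₂ ih₁ ih₂ =>
    rintro v u p w q hp rfl rfl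
    obtain ⟨l₂, rfl⟩ := h₁.exists_cons_of_cons
    have hl := h₁.length_eq
    simp only [List.length_cons] at hl
    obtain _ | ⟨x, r⟩ := l₂
    · simp at hl
    simp only [List.length_cons] at hl
    rcases ih₁ v u p x r hp rfl rfl with ⟨rfl, k⟩ | ⟨t₀, s₀, k₁, k₂, k₃⟩
    · rcases ih₂ v u r w q (by omega) rfl rfl with ⟨rfl, k'⟩ | ⟨t, s, h1, h2, h3⟩
      · exact Or.inl ⟨rfl, k.trans k'⟩
      · exact Or.inr ⟨t, s, h1, k.trans h2, h3⟩
    · rcases ih₂ v x r w q (by omega) rfl rfl with ⟨rfl, k'⟩ | ⟨t₁, s₁, m₁, m₂, m₃⟩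
      · exact Or.inr ⟨t₀, s₀, k₁, k₂, k'.symm.trans k₃⟩
      · have hs := k₃.length_eq
        simp only [List.length_cons] at hs
        rcases IH s₀.length (by omega) _ _ (k₃.symm.trans m₂) x t₀ s₀ t₁ s₁ rfl rfl rfl with
          ⟨rfl, k⟩ | ⟨s, r', c₁, c₂, c₃⟩
        · -- both squares contain `v`, `x` and `t₀`, so they coincide
          have huw : u = w := k₁.rotate.rotate.unique m₁.reflect.rotate.rotate
          subst huw
          exact Or.inl ⟨rfl, k₂.trans ((SquareEquiv.cons _ k).trans m₃.symm)⟩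
        · -- three squares at `x`; push across the 3-cube that they span
          obtain ⟨o, o₁, o₂, o₃⟩ := hX.exists_cube k₁.reflect.rotate.reflect m₁.rotate.reflect c₁
          refine Or.inr ⟨o, s :: r', o₁, ?_, ?_⟩
          · exact (k₂.trans (.cons _ c₂)).trans (SquareEquiv.square o₂.rotate _).symm
          · exact (m₃.trans (.cons _ c₃)).trans (SquareEquiv.square o₃.rotate _).symm
  | cons a h _ =>
    rintro v u p w q - h1 h2
    simp only [List.cons.injEq] at h1 h2
    obtain ⟨rfl, rfl⟩ := h1
    obtain ⟨-, rfl⟩ := h2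
    have := h.head?_eq
    simp only [List.head?_cons, Option.some.injEq] at this
    exact Or.inl ⟨this, h⟩
  | square h l =>
    rintro v u p w q - h1 h2
    simp only [List.cons.injEq] at h1 h2
    obtain ⟨rfl, rfl, rfl⟩ := h1
    obtain ⟨-, rfl, rfl⟩ := h2
    exact Or.inr ⟨_, l, h, .refl _, .refl _⟩

end SquareEquiv

/-! ### Reduced paths -/

variable (X) in
/-- A path is reduced if pushing it across squares never produces a backtrack. -/
def IsReduced (l : List V) : Prop :=
  ∀ l' a b l₁ l₂, X.SquareEquiv l l' → l' ≠ l₁ ++ a :: b :: a :: l₂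

namespace IsReduced

variable {l l' : List V}

theorem of_equiv (h : X.IsReduced l) (e : X.SquareEquiv l l') : X.IsReduced l' :=
  fun _ _ _ _ _ e' => h _ _ _ _ _ (e.trans e')

theorem tail {a : V} (h : X.IsReduced (a :: l)) : X.IsReduced l := by
  rintro l' b c l₁ l₂ e rfl
  exact h _ b c (a :: l₁) l₂ (.cons a e) rfl

theorem not_backtrack {a b : V} {p : List V} (h : X.IsReduced l) :
    ¬ X.SquareEquiv l (a :: b :: a :: p) := fun e => h _ a b [] p e rfl

/-- If a reduced path `v :: p` ceases to be reduced on prepending `z`, then it can be pushed so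
that its first edge goes to `z`. -/
theorem exists_equiv_of_not_cons (hX : X.IsCAT0) {v z : V} {p : List V}
    (h : X.IsReduced (v :: p)) (h' : ¬ X.IsReduced (z :: v :: p)) :
    ∃ q, X.SquareEquiv (v :: p) (v :: z :: q) := by
  induction hn : p.length using Nat.strong_induction_on generalizing v z p with
  | _ n IH =>
  simp only [IsReduced, not_forall, not_not] at h'
  obtain ⟨_, a, b, l₁, l₂, e, rfl⟩ := h'
  obtain _ | ⟨z', l₁⟩ := l₁
  · have := e.head?_eq
    simp only [List.nil_append, List.head?_cons, Option.some.injEq] at this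
    subst this
    rcases e.levi hX with ⟨rfl, e⟩ | ⟨t, s, sq, e₁, e₂⟩
    · exact ⟨l₂, e⟩
    · -- the backtrack `b, z` pairs with `b, t`, producing a backtrack `v, t, v` in `v :: p`
      rcases e₂.levi hX with ⟨rfl, -⟩ | ⟨r, s', sq', e₃, e₄⟩
      · exact absurd rfl sq.ac
      · have : r = v := sq'.rotate.rotate.rotate.unique
            sq.rotate.rotate
        subst this
        exact absurd (e₁.trans (.cons _ e₄)) h.not_backtrack
  · have := e.head?_eq
    simp only [List.cons_append, List.head?_cons, Option.some.injEq] at this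
    subst this
    have hr : ∃ w q, l₁ ++ a :: b :: a :: l₂ = w :: q := by cases l₁ <;> simp
    obtain ⟨w, q, hr⟩ := hr
    rw [List.cons_append, hr] at e
    rcases e.levi hX with ⟨rfl, e⟩ | ⟨t, s, sq, e₁, e₂⟩
    · exact absurd hr.symm (h _ _ _ _ _ e)
    · have hl := e₁.length_eq
      simp only [List.length_cons] at hl
      obtain ⟨q', e'⟩ := IH s.length (by omega) (h.of_equiv e₁).tail (z := w) (by
        intro hred
        exact hred _ _ _ _ _ e₂.symm hr.symm) rfl
      exact ⟨w :: q', (e₁.trans (.cons _ e')).trans (.square sq.rotate _)⟩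

end IsReduced

/-! ### The action of edge paths on reduced paths -/

open Classical in
variable (X) in
/-- Prepend the edge from `z` to the head of a reduced path, and reduce the result. On
`SquareEquiv`-classes of reduced paths these maps define an action of the edge paths, which by
`act_act_of_isSquare` factors through homotopy. -/
noncomputable def act (z : V) : List V → List V
  | [] => [z]
  | v :: p => if h : ∃ q, X.SquareEquiv (v :: p) (v :: z :: q) then z :: h.choose else z :: v :: p

variable {a b o v z : V} {p q : List V}

theorem act_pos (hX : X.IsCAT0) (h : X.SquareEquiv (v :: p) (v :: z :: q)) :
    X.SquareEquiv (X.act z (v :: p)) (z :: q) := by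
  have h' : ∃ q, X.SquareEquiv (v :: p) (v :: z :: q) := ⟨q, h⟩
  simp only [act, dif_pos h']
  rcases (h'.choose_spec.symm.trans h).levi hX with ⟨-, e⟩ | ⟨t, s, sq, -⟩
  · exact e
  · exact absurd rfl sq.bd

theorem act_neg (h : ¬ ∃ q, X.SquareEquiv (v :: p) (v :: z :: q)) :
    X.act z (v :: p) = z :: v :: p := by
  simp only [act, dif_neg h]

theorem exists_act_eq_cons (z : V) (l : List V) : ∃ q, X.act z l = z :: q := by
  cases l with
  | nil => exact ⟨_, rfl⟩
  | cons v p => simp only [act]; split_ifs <;> exact ⟨_, rfl⟩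

theorem isReduced_act (hX : X.IsCAT0) (h : X.IsReduced (v :: p)) :
    X.IsReduced (X.act z (v :: p)) := by
  by_cases h' : ∃ q, X.SquareEquiv (v :: p) (v :: z :: q)
  · obtain ⟨q, hq⟩ := h'
    exact (h.of_equiv hq).tail.of_equiv (act_pos hX hq).symm
  · rw [act_neg h']
    by_contra hn
    exact h' (h.exists_equiv_of_not_cons hX hn)

theorem act_congr (hX : X.IsCAT0) (h : X.SquareEquiv (v :: p) (v :: q)) :
    X.SquareEquiv (X.act z (v :: p)) (X.act z (v :: q)) := by
  by_cases h' : ∃ r, X.SquareEquiv (v :: q) (v :: z :: r)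
  · obtain ⟨r, hr⟩ := h'
    exact (act_pos hX (h.trans hr)).trans (act_pos hX hr).symm
  · have h'' : ¬ ∃ r, X.SquareEquiv (v :: p) (v :: z :: r) :=
      fun ⟨r, hr⟩ => h' ⟨r, h.symm.trans hr⟩
    rw [act_neg h', act_neg h'']
    exact .cons _ h

theorem act_congr' (hX : X.IsCAT0) {l l' : List V} (h : X.SquareEquiv l l') :
    X.SquareEquiv (X.act z l) (X.act z l') := by
  cases l with
  | nil =>
    have := h.length_eq
    cases l' with
    | nil => exact .refl _
    | cons => simp at this
  | cons v p =>
    obtain ⟨q, rfl⟩ := h.exists_cons_of_cons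
    exact act_congr hX h

theorem act_act_backtrack (hX : X.IsCAT0) (h : X.IsReduced (v :: p)) :
    X.SquareEquiv (X.act v (X.act z (v :: p))) (v :: p) := by
  by_cases h' : ∃ q, X.SquareEquiv (v :: p) (v :: z :: q)
  · obtain ⟨q, hq⟩ := h'
    refine (act_congr' hX (act_pos hX hq)).trans ?_
    rw [act_neg]
    · exact hq.symm
    · rintro ⟨r, hr⟩
      exact h.not_backtrack (hq.trans (.cons _ hr))
  · rw [act_neg h']
    exact act_pos hX (.refl _)

theorem act_act_of_isSquare (hX : X.IsCAT0) (sq : X.IsSquare v a o b) :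
    X.SquareEquiv (X.act o (X.act a (v :: p))) (X.act o (X.act b (v :: p))) := by
  -- if only one of the two neighbours is the second vertex of a representative
  have aux : ∀ {a b : V} {q : List V}, X.IsSquare v a o b →
      X.SquareEquiv (v :: p) (v :: a :: q) → (¬ ∃ q, X.SquareEquiv (v :: p) (v :: b :: q)) →
      X.SquareEquiv (X.act o (X.act a (v :: p))) (X.act o (X.act b (v :: p))) := by
    intro a b q sq ha hb
    refine (act_congr' hX (act_pos hX ha)).trans ?_
    rw [act_neg, act_neg hb]
    · exact (act_pos hX ((SquareEquiv.cons b ha).trans (.square sq.rotate.rotate.rotate _))).symm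
    · rintro ⟨r, hr⟩
      exact hb ⟨_, (ha.trans (.cons _ hr)).trans (.square sq _)⟩
  by_cases ha : ∃ q, X.SquareEquiv (v :: p) (v :: a :: q) <;>
    by_cases hb : ∃ q, X.SquareEquiv (v :: p) (v :: b :: q)
  · obtain ⟨q, ha⟩ := ha
    obtain ⟨r, hb⟩ := hb
    refine (act_congr' hX (act_pos hX ha)).trans (.trans ?_ (act_congr' hX (act_pos hX hb)).symm)
    rcases (ha.symm.trans hb).levi hX with ⟨h, -⟩ | ⟨t, s, sq', h₁, h₂⟩
    · exact absurd h sq.bd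
    · have : t = o := sq'.rotate.rotate.rotate.unique sq.rotate.rotate.rotate
      subst this
      exact (act_pos hX h₁).trans (act_pos hX h₂).symm
  · obtain ⟨q, ha⟩ := ha
    exact aux sq ha hb
  · obtain ⟨q, hb⟩ := hb
    exact (aux sq.reflect hb ha).symm
  · rw [act_neg ha, act_neg hb]
    have aux' : ∀ {a b : V}, X.IsSquare v a o b →
        (¬ ∃ q, X.SquareEquiv (v :: p) (v :: b :: q)) →
        ¬ ∃ q, X.SquareEquiv (a :: v :: p) (a :: o :: q) := by
      rintro a b sq hb ⟨q, hq⟩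
      rcases hq.levi hX with ⟨h, -⟩ | ⟨t, s, sq', h₁, -⟩
      · exact sq.ac h
      · have : t = b := sq'.rotate.rotate.rotate.unique
          sq.rotate.rotate.reflect
        subst this
        exact hb ⟨_, h₁⟩
    rw [act_neg (aux' sq hb), act_neg (aux' sq.reflect ha)]
    exact .square sq.rotate.rotate.reflect _

variable (X) in
/-- The action of edge paths on reduced paths, see `act`. -/
noncomputable def actWalk : {x y : V} → X.skeleton.Walk x y → List V → List V
  | _, _, .nil, l => l
  | x, _, .cons _ p, l => X.act x (actWalk p l)

theorem actWalk_append {x y w : V} (p : X.skeleton.Walk x y) (q : X.skeleton.Walk y w)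
    (l : List V) : X.actWalk (p.append q) l = X.actWalk p (X.actWalk q l) := by
  induction p with
  | nil => rfl
  | cons h p ih => simp [actWalk, ih]

theorem actWalk_congr (hX : X.IsCAT0) {x y : V} (p : X.skeleton.Walk x y) {l l' : List V}
    (h : X.SquareEquiv l l') : X.SquareEquiv (X.actWalk p l) (X.actWalk p l') := by
  induction p with
  | nil => exact h
  | cons _ p ih => exact act_congr' hX ih

theorem isReduced_actWalk (hX : X.IsCAT0) {x y : V} (p : X.skeleton.Walk x y)
    (h : X.IsReduced (y :: q)) : X.IsReduced (X.actWalk p (y :: q)) ∧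
      ∃ r, X.actWalk p (y :: q) = x :: r := by
  induction p with
  | nil => exact ⟨h, q, rfl⟩
  | cons _ p ih =>
    obtain ⟨h₁, r, h₂⟩ := ih h
    simp only [actWalk]
    refine ⟨?_, exists_act_eq_cons _ _⟩
    rw [h₂] at h₁ ⊢
    exact isReduced_act hX h₁

theorem EdgeHomotopic.actWalk_equiv (hX : X.IsCAT0) {x y : V} {p q : X.skeleton.Walk x y}
    (h : X.EdgeHomotopic p q) {l : List V} (hl : X.IsReduced (y :: l)) :
    X.SquareEquiv (X.actWalk p (y :: l)) (X.actWalk q (y :: l)) := by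
  induction h generalizing l with
  | refl => exact .refl _
  | symm _ ih => exact (ih hl).symm
  | trans _ _ ih₁ ih₂ => exact (ih₁ hl).trans (ih₂ hl)
  | @append x y w p p' q q' _ _ ih₁ ih₂ =>
    rw [actWalk_append, actWalk_append]
    obtain ⟨h₁, r, h₂⟩ := isReduced_actWalk hX q' hl
    refine (actWalk_congr hX p (ih₂ hl)).trans ?_
    rw [h₂] at h₁ ⊢
    exact ih₁ h₁
  | backtrack h => exact act_act_backtrack hX hl
  | square h => exact act_act_of_isSquare hX h.rotate.rotate.reflect

theorem actWalk_support {x y : V} (p : X.skeleton.Walk x y) (h : X.IsReduced p.support) :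
    X.actWalk p [y] = p.support := by
  induction p with
  | nil => rfl
  | @cons u v w _ p ih =>
    rw [SimpleGraph.Walk.support_cons] at h ⊢
    have h' := ih h.tail
    simp only [actWalk, h']
    obtain ⟨q, hq⟩ : ∃ q, p.support = v :: q := ⟨_, p.cons_tail_support.symm⟩
    rw [hq] at h ⊢
    refine act_neg ?_
    rintro ⟨r, hr⟩
    exact h.not_backtrack (.cons _ hr)

theorem isReduced_singleton (x : V) : X.IsReduced [x] := by
  rintro l' a b l₁ l₂ e rfl
  have := e.length_eq
  simp only [List.length_append, List.length_cons, List.length_nil] at this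
  omega

/-- Reduced paths with the same endpoints agree up to pushing across squares. -/
theorem squareEquiv_of_isReduced (hX : X.IsCAT0) {x y : V} {p q : X.skeleton.Walk x y}
    (hp : X.IsReduced p.support) (hq : X.IsReduced q.support) :
    X.SquareEquiv p.support q.support := by
  have hpq : X.EdgeHomotopic p q := by
    have h₁ : X.EdgeHomotopic (p.append (q.reverse.append q)) (p.append .nil) :=
      .append (.refl _) (hX.1.2 _ _)
    have h₂ : X.EdgeHomotopic ((p.append q.reverse).append q) (SimpleGraph.Walk.nil.append q) :=
      .append (hX.1.2 _ _) (.refl _)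
    rw [SimpleGraph.Walk.append_assoc] at h₁
    rw [SimpleGraph.Walk.append_nil] at h₁
    exact h₁.symm.trans h₂
  have := hpq.actWalk_equiv hX (isReduced_singleton (X := X) y)
  rwa [actWalk_support p hp, actWalk_support q hq] at this

/-! ### The quadrangle condition -/

theorem dist_lt_length_of_isChain {x y : V} {l : List V} (h : l.IsChain X.skeleton.Adj)
    (hx : l.head? = some x) (hy : l.getLast? = some y) : X.skeleton.dist x y < l.length := by
  have hne : l ≠ [] := by rintro rfl; simp at hx
  rw [List.getLast?_eq_getLast_of_ne_nil hne] at hy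
  rw [List.head?_eq_some_head hne] at hx
  have := SimpleGraph.dist_le (SimpleGraph.Walk.ofSupport l hne h)
  rw [SimpleGraph.Walk.length_ofSupport, Option.some.inj hx, Option.some.inj hy] at this
  have := List.length_pos_iff.2 hne
  omega

/-- Deleting a backtrack would shorten the path. -/
theorem isReduced_support_of_isGeodesicWalk {x y : V} {p : X.skeleton.Walk x y}
    (hp : X.skeleton.IsGeodesicWalk p) : X.IsReduced p.support := by
  rintro l' a b l₁ l₂ e rfl
  have hc := e.isChain_iff.1 p.isChain_adj_support
  have hh := e.head?_eq
  have hl := e.getLast?_eq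
  have hlen := e.length_eq
  rw [← p.cons_tail_support, List.head?_cons] at hh
  rw [List.getLast?_eq_getLast_of_ne_nil p.support_ne_nil, p.getLast_support] at hl
  rw [SimpleGraph.Walk.length_support, hp] at hlen
  have hc' : (l₁ ++ a :: l₂).IsChain X.skeleton.Adj := by
    rw [List.isChain_split] at hc ⊢
    exact ⟨hc.1, hc.2.of_cons.of_cons⟩
  have := dist_lt_length_of_isChain (x := x) (y := y) hc' (by
    rw [hh]; cases l₁ <;> simp) (by
    rw [hl]; simp [List.getLast?_append, List.getLast?_cons])
  simp only [List.length_append, List.length_cons] at hlen this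
  omega

/-- The quadrangle condition: if `x` and `y` are neighbours of `z` that are closer to `v` than `z`,
then `z, x, y` lie on a square whose fourth vertex is closer still. -/
theorem IsCAT0.exists_isSquare (hX : X.IsCAT0) {v z x y : V} (hxy : x ≠ y)
    (hx : X.skeleton.Adj z x) (hy : X.skeleton.Adj z y)
    (hdx : X.skeleton.dist z v = X.skeleton.dist x v + 1)
    (hdy : X.skeleton.dist z v = X.skeleton.dist y v + 1) :
    ∃ t, X.IsSquare z x t y ∧ X.skeleton.dist x v = X.skeleton.dist t v + 1 := by
  obtain ⟨p, hp⟩ := hX.1.1.exists_walk_length_eq_dist x v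
  obtain ⟨q, hq⟩ := hX.1.1.exists_walk_length_eq_dist y v
  have h₁ : X.skeleton.IsGeodesicWalk (.cons hx p) := by
    simp only [SimpleGraph.IsGeodesicWalk, SimpleGraph.Walk.length_cons]; omega
  have h₂ : X.skeleton.IsGeodesicWalk (.cons hy q) := by
    simp only [SimpleGraph.IsGeodesicWalk, SimpleGraph.Walk.length_cons]; omega
  have e := squareEquiv_of_isReduced hX (isReduced_support_of_isGeodesicWalk h₁)
    (isReduced_support_of_isGeodesicWalk h₂)
  simp only [SimpleGraph.Walk.support_cons] at e
  obtain ⟨p', hp'⟩ : ∃ r, p.support = x :: r := ⟨_, p.cons_tail_support.symm⟩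
  obtain ⟨q', hq'⟩ : ∃ r, q.support = y :: r := ⟨_, q.cons_tail_support.symm⟩
  rw [hp', hq'] at e
  rcases e.levi hX with ⟨h, -⟩ | ⟨t, s, sq, e₁, -⟩
  · exact absurd h hxy
  · refine ⟨t, sq, ?_⟩
    rw [← hp'] at e₁
    have hc := e₁.isChain_iff.1 p.isChain_adj_support
    have hl := e₁.getLast?_eq
    have hlen := e₁.length_eq
    rw [SimpleGraph.Walk.length_support] at hlen
    simp only [List.length_cons] at hlen
    have hpl : p.support.getLast? = some v := by
      rw [List.getLast?_eq_getLast_of_ne_nil p.support_ne_nil, p.getLast_support]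
    rw [hpl, List.getLast?_cons_cons] at hl
    have := dist_lt_length_of_isChain (x := t) hc.of_cons rfl hl.symm
    simp only [List.length_cons] at this
    have := hX.1.1.dist_triangle (u := x) (v := t) (w := v)
    rw [SimpleGraph.dist_eq_one_iff_adj.2 sq.bc] at this
    omega

end Paths
end CubeComplex
/-! ### Graphs with a family of halfspaces that measures distances -/

/-- The members of `𝓗` that contain `y` but not `x`. -/
def sepSets {V : Type*} (𝓗 : Set (Set V)) (x y : V) : Set (Set V) := {h ∈ 𝓗 | x ∉ h ∧ y ∈ h}

/-- All four sectors determined by `h` and `k` are nonempty. -/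
def Crosses {V : Type*} (h k : Set V) : Prop :=
  (∃ v, v ∈ h ∧ v ∈ k) ∧ (∃ v, v ∈ h ∧ v ∉ k) ∧ (∃ v, v ∉ h ∧ v ∈ k) ∧ ∃ v, v ∉ h ∧ v ∉ k

namespace Crosses

variable {V : Type*} {h k : Set V}

theorem symm (H : Crosses h k) : Crosses k h := by
  obtain ⟨⟨a, ha⟩, ⟨b, hb⟩, ⟨c, hc⟩, ⟨d, hd⟩⟩ := H
  exact ⟨⟨a, ha.symm⟩, ⟨c, hc.symm⟩, ⟨b, hb.symm⟩, ⟨d, hd.symm⟩⟩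

theorem compl_left (H : Crosses h k) : Crosses hᶜ k := by
  obtain ⟨⟨a, ha⟩, ⟨b, hb⟩, ⟨c, hc⟩, ⟨d, hd⟩⟩ := H
  exact ⟨⟨c, hc⟩, ⟨d, hd⟩, ⟨a, by simpa using ha⟩, ⟨b, by simpa using hb⟩⟩

theorem compl_right (H : Crosses h k) : Crosses h kᶜ := H.symm.compl_left.symm

end Crosses

/-- A connected graph together with a family of vertex sets, the halfspaces, closed under
complements, such that the distance between two vertices is the number of halfspaces containing
the second but not the first. -/
structure IsHalfspaceSystem {V : Type*} (G : SimpleGraph V) (𝓗 : Set (Set V)) : Prop where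
  connected : G.Connected
  compl_mem : ∀ h ∈ 𝓗, hᶜ ∈ 𝓗
  finite_sepSets : ∀ x y, (sepSets 𝓗 x y).Finite
  dist_eq : ∀ x y, G.dist x y = (sepSets 𝓗 x y).ncard

/-- `m` is a median of `x, y, z`: each halfspace containing two of these vertices contains `m`. -/
def IsMedian {V : Type*} (𝓗 : Set (Set V)) (x y z m : V) : Prop :=
  ∀ h ∈ 𝓗, (x ∈ h → y ∈ h → m ∈ h) ∧ (x ∈ h → z ∈ h → m ∈ h) ∧ (y ∈ h → z ∈ h → m ∈ h)

/-- A halfspace system in which medians exist. -/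
structure IsMedianSystem {V : Type*} (G : SimpleGraph V) (𝓗 : Set (Set V)) : Prop extends
    IsHalfspaceSystem G 𝓗 where
  exists_isMedian : ∀ x y z, ∃ m, IsMedian 𝓗 x y z m

namespace IsHalfspaceSystem

variable {V : Type*} {G : SimpleGraph V} {𝓗 : Set (Set V)} {x y m : V} {h : Set V}

/-- Halfspaces are convex. -/
theorem mem_of_dist_add (S : IsHalfspaceSystem G 𝓗) (hm : G.dist x m + G.dist m y = G.dist x y)
    (hh : h ∈ 𝓗) (hx : x ∈ h) (hy : y ∈ h) : m ∈ h := by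
  by_contra hmh
  have hsub : insert h (sepSets 𝓗 x y) ⊆ sepSets 𝓗 x m ∪ sepSets 𝓗 m y := by
    rintro k (rfl | ⟨hk, hkx, hky⟩)
    · exact Or.inr ⟨hh, hmh, hy⟩
    · by_cases hkm : m ∈ k
      · exact Or.inl ⟨hk, hkx, hkm⟩
      · exact Or.inr ⟨hk, hkm, hky⟩
  have h₁ := Set.ncard_le_ncard hsub ((S.finite_sepSets x m).union (S.finite_sepSets m y))
  rw [Set.ncard_insert_of_notMem (fun hk => hk.2.1 hx) (S.finite_sepSets x y)] at h₁
  have h₂ := Set.ncard_union_le (sepSets 𝓗 x m) (sepSets 𝓗 m y)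
  rw [← S.dist_eq, ← S.dist_eq] at h₂
  rw [← S.dist_eq] at h₁
  omega

theorem notMem_of_dist_add (S : IsHalfspaceSystem G 𝓗)
    (hm : G.dist x m + G.dist m y = G.dist x y) (hh : h ∈ 𝓗) (hx : x ∉ h) (hy : y ∉ h) :
    m ∉ h :=
  S.mem_of_dist_add hm (S.compl_mem h hh) hx hy

/-- Conversely, a vertex contained in every halfspace which contains `x` and `y` lies on a geodesic
between them. -/
theorem dist_add_of_forall_mem (S : IsHalfspaceSystem G 𝓗)
    (hm : ∀ h ∈ 𝓗, x ∈ h → y ∈ h → m ∈ h) : G.dist x m + G.dist m y = G.dist x y := by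
  have hm' : ∀ h ∈ 𝓗, x ∉ h → y ∉ h → m ∉ h := fun h hh hx hy => hm _ (S.compl_mem h hh) hx hy
  rw [S.dist_eq, S.dist_eq, S.dist_eq, ← Set.ncard_union_eq _ (S.finite_sepSets _ _)
    (S.finite_sepSets _ _)]
  · congr 1
    ext k
    constructor
    · rintro (⟨hk, h₁, h₂⟩ | ⟨hk, h₁, h₂⟩)
      · exact ⟨hk, h₁, by_contra fun h₃ => hm' k hk h₁ h₃ h₂⟩
      · exact ⟨hk, fun h₃ => h₁ (hm k hk h₃ h₂), h₂⟩
    · rintro ⟨hk, h₁, h₂⟩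
      by_cases hkm : m ∈ k
      · exact Or.inl ⟨hk, h₁, hkm⟩
      · exact Or.inr ⟨hk, hkm, h₂⟩
  · exact Set.disjoint_left.2 fun k h₁ h₂ => h₂.2.1 h₁.2.2

end IsHalfspaceSystem

theorem SimpleGraph.Connected.exists_adj_dist_eq {V : Type*} {G : SimpleGraph V}
    (hG : G.Connected) {x y : V} (h : x ≠ y) : ∃ x', G.Adj x x' ∧ G.dist x y = G.dist x' y + 1 := by
  obtain ⟨p, hp⟩ := hG.exists_walk_length_eq_dist x y
  cases p with
  | nil => exact absurd rfl h
  | @cons _ x' _ ha p =>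
    refine ⟨x', ha, ?_⟩
    have h₁ := SimpleGraph.dist_le p
    have h₂ := hG.dist_triangle (u := x) (v := x') (w := y)
    rw [SimpleGraph.dist_eq_one_iff_adj.2 ha] at h₂
    rw [SimpleGraph.Walk.length_cons] at hp
    omega

/-- A halfspace cutting the convex set `k` is left along an edge contained in `k`. -/
theorem IsHalfspaceSystem.exists_edge {V : Type*} {x y : V} {G : SimpleGraph V}
    {𝓗 : Set (Set V)} (S : IsHalfspaceSystem G 𝓗) {h k : Set V} (hk : k ∈ 𝓗) (hx : x ∈ h)
    (hy : y ∉ h) (hxk : x ∈ k) (hyk : y ∈ k) :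
    ∃ p q, G.Adj p q ∧ p ∈ h ∧ q ∉ h ∧ p ∈ k ∧ q ∈ k := by
  induction hn : G.dist x y generalizing x with
  | zero =>
    rw [S.connected.dist_eq_zero_iff] at hn
    subst hn
    exact absurd hx hy
  | succ n ih =>
    have hne : x ≠ y := by rintro rfl; exact hy hx
    obtain ⟨x', hxx', hd⟩ := S.connected.exists_adj_dist_eq hne
    have h1 := SimpleGraph.dist_eq_one_iff_adj.2 hxx'
    have hx'k : x' ∈ k := S.mem_of_dist_add (by omega) hk hxk hyk
    by_cases hx' : x' ∈ h
    · exact ih hx' hx'k (by omega)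
    · exact ⟨x, x', hxx', hx, hx', hxk, hx'k⟩

/-! ### The halfspaces of a CAT(0) cube complex -/

namespace CubeComplex

section Halfspaces

variable {V : Type*} {X : CubeComplex V} {a b c d p q x y z : V} {S : Set V}

variable (X) in
/-- The vertices closer to `a` than to `b`. -/
def nearSet (a b : V) : Set V := {v | X.skeleton.dist v a < X.skeleton.dist v b}

theorem left_mem_nearSet (h : X.skeleton.Adj a b) : a ∈ X.nearSet a b := by
  simp only [nearSet, Set.mem_ofPred_eq, SimpleGraph.dist_self, SimpleGraph.dist_eq_one_iff_adj.2 h]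
  omega

theorem right_notMem_nearSet : b ∉ X.nearSet a b := by
  simp [nearSet]

theorem IsCAT0.dist_eq_of_mem_nearSet (hX : X.IsCAT0) (h : X.skeleton.Adj a b)
    (hx : x ∈ X.nearSet a b) : X.skeleton.dist x b = X.skeleton.dist x a + 1 := by
  have := hX.1.dist_eq_add_one_or x h
  simp only [nearSet, Set.mem_ofPred_eq] at hx
  omega

theorem IsCAT0.compl_nearSet (hX : X.IsCAT0) (h : X.skeleton.Adj a b) :
    (X.nearSet a b)ᶜ = X.nearSet b a := by
  ext v
  have := hX.1.dist_eq_add_one_or v h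
  simp only [nearSet, Set.mem_compl_iff, Set.mem_ofPred_eq]
  omega

theorem IsCAT0.notMem_nearSet (hX : X.IsCAT0) (h : X.skeleton.Adj a b) :
    x ∉ X.nearSet a b ↔ x ∈ X.nearSet b a := by
  rw [← hX.compl_nearSet h, Set.mem_compl_iff]

/-- Parallel edges bound the same halfspaces. -/
theorem IsCAT0.nearSet_eq_of_isSquare (hX : X.IsCAT0) (h : X.IsSquare a b c d) :
    X.nearSet a b = X.nearSet d c := by
  have aux : ∀ {a b c d : V}, X.IsSquare a b c d → X.nearSet a b ⊆ X.nearSet d c := by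
    intro a b c d h v hv
    by_contra hv'
    rw [hX.notMem_nearSet h.cd.symm] at hv'
    have h₁ := hX.dist_eq_of_mem_nearSet h.ab hv
    have h₂ := hX.dist_eq_of_mem_nearSet h.cd hv'
    have h₃ := hX.1.dist_eq_add_one_or v h.da
    have h₄ := hX.1.dist_eq_add_one_or v h.bc
    simp only [SimpleGraph.dist_comm (u := v)] at h₁ h₂ h₃ h₄
    obtain ⟨t, ht, ht'⟩ := hX.exists_isSquare (v := v) h.ac h.ab.symm h.bc (by omega) (by omega)
    have : t = d := ht.rotate.rotate.rotate.unique h.reflect.rotate.rotate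
    subst this
    omega
  exact (aux h).antisymm (aux h.reflect.rotate)

variable (X) in
/-- `S` is one of the two halfspaces bounded by the hyperplane dual to the edge `e`. -/
def IsSide (S : Set V) (e : Sym2 V) : Prop :=
  ∃ a b, X.skeleton.Adj a b ∧ e = s(a, b) ∧ S = X.nearSet a b

theorem isSide_mk : X.IsSide S s(a, b) ↔
    X.skeleton.Adj a b ∧ (S = X.nearSet a b ∨ S = X.nearSet b a) := by
  constructor
  · rintro ⟨p, q, h, he, rfl⟩
    rcases Sym2.eq_iff.1 he with ⟨rfl, rfl⟩ | ⟨rfl, rfl⟩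
    · exact ⟨h, Or.inl rfl⟩
    · exact ⟨h.symm, Or.inr rfl⟩
  · rintro ⟨h, rfl | rfl⟩
    · exact ⟨a, b, h, rfl, rfl⟩
    · exact ⟨b, a, h.symm, Sym2.eq_swap, rfl⟩

theorem IsCAT0.isSide_iff_of_eqvGen (hX : X.IsCAT0) {e f : Sym2 V}
    (h : Relation.EqvGen X.ElemParallel e f) : X.IsSide S e ↔ X.IsSide S f := by
  induction h with
  | rel e f h =>
    obtain ⟨a, b, c, d, h, rfl, rfl⟩ := h
    rw [isSide_mk, isSide_mk, hX.nearSet_eq_of_isSquare h,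
      hX.nearSet_eq_of_isSquare h.rotate.reflect]
    simp only [h.ab, h.cd.symm, true_and]
  | refl => rfl
  | symm _ _ _ ih => exact ih.symm
  | trans _ _ _ _ _ ih₁ ih₂ => exact ih₁.trans ih₂

/-- Any edge that leaves the halfspace of the edge `a, b` is parallel to it. -/
theorem IsCAT0.eqvGen_of_mem_nearSet (hX : X.IsCAT0) (hab : X.skeleton.Adj a b)
    (hpq : X.skeleton.Adj p q) (hp : p ∈ X.nearSet a b) (hq : q ∈ X.nearSet b a) :
    Relation.EqvGen X.ElemParallel s(a, b) s(p, q) := by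
  induction hn : X.skeleton.dist p a generalizing p q with
  | zero =>
    rw [hX.1.1.dist_eq_zero_iff] at hn
    subst hn
    have h₁ := hX.dist_eq_of_mem_nearSet hab.symm hq
    rw [SimpleGraph.dist_comm, SimpleGraph.dist_eq_one_iff_adj.2 hpq] at h₁
    have h₂ : X.skeleton.dist q b = 0 := by omega
    rw [hX.1.1.dist_eq_zero_iff] at h₂
    subst h₂
    exact .refl _
  | succ n ih =>
    have hne : p ≠ a := by rintro rfl; simp at hn
    obtain ⟨p', hpp', hp'⟩ := hX.1.1.exists_adj_dist_eq hne
    have h₁ := hX.dist_eq_of_mem_nearSet hab hp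
    have h₂ := hX.dist_eq_of_mem_nearSet hab.symm hq
    have h₃ := hX.1.dist_eq_add_one_or a hpq
    have h₄ := hX.1.dist_eq_add_one_or b hpq
    have h₅ := hX.1.dist_eq_add_one_or b hpp'
    have h₆ := hX.1.dist_eq_add_one_or p' hab
    simp only [SimpleGraph.dist_comm (v := a), SimpleGraph.dist_comm (v := b)] at *
    obtain ⟨t, ht, ht'⟩ := hX.exists_isSquare (v := b) (z := p) (x := p') (y := q)
      (by rintro rfl; omega) hpp' hpq
      (by simp only [SimpleGraph.dist_comm (v := b)]; omega)
      (by simp only [SimpleGraph.dist_comm (v := b)]; omega)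
    have h₇ := hX.1.dist_eq_add_one_or t hab
    have h₈ := hX.1.dist_eq_add_one_or a ht.cd
    simp only [SimpleGraph.dist_comm (v := a), SimpleGraph.dist_comm (v := b)] at *
    refine (ih (p := p') (q := t) ht.bc ?_ ?_ (by omega)).trans _ _ _
      (.symm _ _ (.rel _ _ ⟨p, q, t, p', ht.reflect, rfl, rfl⟩))
    · simp only [nearSet, Set.mem_ofPred_eq, SimpleGraph.dist_comm (u := p')]
      omega
    · simp only [nearSet, Set.mem_ofPred_eq, SimpleGraph.dist_comm (u := t)]
      omega

variable (X) in
/-- The hyperplane dual to the edge `a, b`. -/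
def dualHyperplane (a b : V) : Set (Sym2 V) := {f | Relation.EqvGen X.ElemParallel s(a, b) f}

/-- The hyperplane dual to `a, b` consists of the edges between its two halfspaces. -/
theorem IsCAT0.mem_dualHyperplane (hX : X.IsCAT0) (hab : X.skeleton.Adj a b) :
    s(p, q) ∈ X.dualHyperplane a b ↔
      X.skeleton.Adj p q ∧ (p ∈ X.nearSet a b ↔ q ∉ X.nearSet a b) := by
  constructor
  · intro h
    have h₁ : X.IsSide (X.nearSet a b) s(p, q) :=
      (hX.isSide_iff_of_eqvGen h).1 (isSide_mk.2 ⟨hab, Or.inl rfl⟩)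
    rw [isSide_mk] at h₁
    obtain ⟨hpq, h₁ | h₁⟩ := h₁
    · rw [h₁]
      simp [hpq, left_mem_nearSet hpq, right_notMem_nearSet]
    · rw [h₁]
      simp [hpq, left_mem_nearSet hpq.symm, right_notMem_nearSet]
  · rintro ⟨hpq, h⟩
    by_cases hp : p ∈ X.nearSet a b
    · exact hX.eqvGen_of_mem_nearSet hab hpq hp ((hX.notMem_nearSet hab).1 (h.1 hp))
    · have hq : q ∈ X.nearSet a b := by tauto
      rw [Sym2.eq_swap]
      exact hX.eqvGen_of_mem_nearSet hab hpq.symm hq ((hX.notMem_nearSet hab).1 hp)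

theorem dualHyperplane_comm (a b : V) : X.dualHyperplane a b = X.dualHyperplane b a := by
  simp only [dualHyperplane, Sym2.eq_swap]

theorem IsCAT0.reachable_deleteEdges_iff (hX : X.IsCAT0) (hab : X.skeleton.Adj a b)
    (hx : x ∈ X.nearSet a b) :
    (X.skeleton.deleteEdges (X.dualHyperplane a b)).Reachable y x ↔ y ∈ X.nearSet a b := by
  have key : ∀ w, w ∈ X.nearSet a b →
      (X.skeleton.deleteEdges (X.dualHyperplane a b)).Reachable w a := by
    intro w hw
    induction hn : X.skeleton.dist w a generalizing w with
    | zero =>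
      rw [hX.1.1.dist_eq_zero_iff] at hn
      rw [hn]
    | succ n ih =>
      have hne : w ≠ a := by rintro rfl; simp at hn
      obtain ⟨w', hww', hw'⟩ := hX.1.1.exists_adj_dist_eq hne
      have hmem : w' ∈ X.nearSet a b := by
        have h₁ := hX.dist_eq_of_mem_nearSet hab hw
        have h₂ := hX.1.dist_eq_add_one_or b hww'
        simp only [SimpleGraph.dist_comm (u := b)] at h₂
        simp only [nearSet, Set.mem_ofPred_eq]
        omega
      refine .trans (SimpleGraph.Adj.reachable ?_) (ih w' hmem (by omega))
      rw [SimpleGraph.deleteEdges_adj, hX.mem_dualHyperplane hab]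
      exact ⟨hww', fun h => h.2.1 hw hmem⟩
  constructor
  · rintro ⟨p⟩
    induction p with
    | nil => exact hx
    | cons h p ih =>
      rw [SimpleGraph.deleteEdges_adj, hX.mem_dualHyperplane hab] at h
      have := ih hx
      by_contra h'
      exact h.2 ⟨h.1, by tauto⟩
  · intro hy
    exact (key y hy).trans (key x hx).symm

/-- The halfspaces of a CAT(0) cube complex, as defined through components of the complement of
a hyperplane, are the sets `nearSet a b`. -/
theorem IsCAT0.exists_eq_nearSet (hX : X.IsCAT0) (h : X.Halfspace) :
    ∃ a b, X.skeleton.Adj a b ∧ h.carrier = X.nearSet a b ∧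
      h.hyperplane = X.dualHyperplane a b := by
  obtain ⟨H, ⟨e, he, hH⟩, S, ⟨c, hc⟩⟩ := h
  induction e using Sym2.ind with
  | _ a b =>
  rw [SimpleGraph.mem_edgeSet] at he
  have hH' : H = X.dualHyperplane a b := hH
  subst hH'
  induction c using SimpleGraph.ConnectedComponent.ind with
  | _ w =>
  have main : ∀ {a b : V}, X.skeleton.Adj a b → w ∈ X.nearSet a b →
      {v | (X.skeleton.deleteEdges (X.dualHyperplane a b)).Reachable v w} = X.nearSet a b := by
    intro a b he hw
    ext v
    exact hX.reachable_deleteEdges_iff he hw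
  have hS : S = {v | (X.skeleton.deleteEdges (X.dualHyperplane a b)).Reachable v w} := by
    rw [hc]
    ext v
    simp [SimpleGraph.ConnectedComponent.mem_supp_iff, SimpleGraph.ConnectedComponent.eq]
  by_cases hw : w ∈ X.nearSet a b
  · exact ⟨a, b, he, hS.trans (main he hw), rfl⟩
  · rw [hX.notMem_nearSet he] at hw
    refine ⟨b, a, he.symm, hS.trans ?_, dualHyperplane_comm a b⟩
    rw [dualHyperplane_comm, main he.symm hw]

theorem IsCAT0.exists_halfspace (hX : X.IsCAT0) (hab : X.skeleton.Adj a b) :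
    ∃ h : X.Halfspace, h.carrier = X.nearSet a b ∧ h.hyperplane = X.dualHyperplane a b := by
  refine ⟨⟨X.dualHyperplane a b, ⟨s(a, b), hab, rfl⟩, X.nearSet a b,
    SimpleGraph.connectedComponentMk _ a, ?_⟩, rfl, rfl⟩
  ext v
  rw [SimpleGraph.ConnectedComponent.mem_supp_iff, SimpleGraph.ConnectedComponent.eq,
    hX.reachable_deleteEdges_iff hab (left_mem_nearSet hab)]

variable (X) in
/-- The vertex sets of the halfspaces. -/
def halfspaceSets : Set (Set V) := Set.range (Halfspace.carrier (X := X))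

theorem IsCAT0.mem_halfspaceSets (hX : X.IsCAT0) :
    S ∈ X.halfspaceSets ↔ ∃ a b, X.skeleton.Adj a b ∧ S = X.nearSet a b := by
  constructor
  · rintro ⟨h, rfl⟩
    obtain ⟨a, b, h₁, h₂, -⟩ := hX.exists_eq_nearSet h
    exact ⟨a, b, h₁, h₂⟩
  · rintro ⟨a, b, h, rfl⟩
    obtain ⟨k, hk, -⟩ := hX.exists_halfspace h
    exact ⟨k, hk⟩

/-- A halfspace is determined by any edge leaving it. -/
theorem IsCAT0.eq_nearSet_of_adj (hX : X.IsCAT0) (hS : S ∈ X.halfspaceSets)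
    (hpq : X.skeleton.Adj p q) (hp : p ∈ S) (hq : q ∉ S) : S = X.nearSet p q := by
  obtain ⟨a, b, hab, rfl⟩ := hX.mem_halfspaceSets.1 hS
  have h₁ : s(p, q) ∈ X.dualHyperplane a b := (hX.mem_dualHyperplane hab).2 ⟨hpq, by tauto⟩
  have h₂ := (isSide_mk.1 ((hX.isSide_iff_of_eqvGen h₁).1 (isSide_mk.2 ⟨hab, Or.inl rfl⟩))).2
  rcases h₂ with h₂ | h₂
  · exact h₂
  · rw [h₂] at hp
    exact absurd hp right_notMem_nearSet

/-- The first edge of a geodesic crosses exactly one hyperplane. -/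
theorem IsCAT0.sepSets_eq_insert (hX : X.IsCAT0) {x' : V} (hx : X.skeleton.Adj x x')
    (hd : X.skeleton.dist x y = X.skeleton.dist x' y + 1) :
    sepSets X.halfspaceSets x y = insert (X.nearSet x' x) (sepSets X.halfspaceSets x' y) := by
  have hmem : X.nearSet x' x ∈ X.halfspaceSets := hX.mem_halfspaceSets.2 ⟨_, _, hx.symm, rfl⟩
  have hy : y ∈ X.nearSet x' x := by
    simp only [nearSet, Set.mem_ofPred_eq, SimpleGraph.dist_comm (u := y)]
    omega
  ext h
  constructor
  · rintro ⟨hh, h₁, h₂⟩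
    by_cases h₃ : x' ∈ h
    · exact Or.inl (hX.eq_nearSet_of_adj hh hx.symm h₃ h₁)
    · exact Or.inr ⟨hh, h₃, h₂⟩
  · rintro (rfl | ⟨hh, h₁, h₂⟩)
    · exact ⟨hmem, right_notMem_nearSet, hy⟩
    · refine ⟨hh, fun h₃ => ?_, h₂⟩
      rw [hX.eq_nearSet_of_adj hh hx h₃ h₁, ← hX.notMem_nearSet hx.symm] at h₂
      exact h₂ hy

theorem IsCAT0.finite_sepSets_and_dist_eq (hX : X.IsCAT0) (x y : V) :
    (sepSets X.halfspaceSets x y).Finite ∧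
      X.skeleton.dist x y = (sepSets X.halfspaceSets x y).ncard := by
  induction hn : X.skeleton.dist x y generalizing x with
  | zero =>
    rw [hX.1.1.dist_eq_zero_iff] at hn
    subst hn
    have : sepSets X.halfspaceSets x x = ∅ :=
      Set.eq_empty_of_forall_notMem fun h hh => hh.2.1 hh.2.2
    simp [this]
  | succ n ih =>
    have hne : x ≠ y := by rintro rfl; simp at hn
    obtain ⟨x', hxx', hd⟩ := hX.1.1.exists_adj_dist_eq hne
    obtain ⟨h₁, h₂⟩ := ih x' (by omega)
    rw [hX.sepSets_eq_insert hxx' hd, Set.ncard_insert_of_notMem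
      (fun h => h.2.1 (left_mem_nearSet hxx'.symm)) h₁]
    exact ⟨h₁.insert _, by omega⟩

theorem IsCAT0.isHalfspaceSystem (hX : X.IsCAT0) :
    IsHalfspaceSystem X.skeleton X.halfspaceSets where
  connected := hX.1.1
  compl_mem h hh := by
    obtain ⟨a, b, hab, rfl⟩ := hX.mem_halfspaceSets.1 hh
    exact hX.mem_halfspaceSets.2 ⟨b, a, hab.symm, hX.compl_nearSet hab⟩
  finite_sepSets x y := (hX.finite_sepSets_and_dist_eq x y).1
  dist_eq x y := (hX.finite_sepSets_and_dist_eq x y).2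

/-- If some halfspace contains `y` and `z` but not `x`, then there is one whose bounding
hyperplane is dual to an edge at `x`: choose the dual edge `a, b` as close to `x` as possible. -/
theorem IsCAT0.exists_adj_of_sepSets (hX : X.IsCAT0) (hS : S ∈ X.halfspaceSets) (hx : x ∉ S)
    (hy : y ∈ S) (hz : z ∈ S) :
    ∃ b, X.skeleton.Adj x b ∧ y ∈ X.nearSet b x ∧ z ∈ X.nearSet b x := by
  obtain ⟨b, a, hba, rfl⟩ := hX.mem_halfspaceSets.1 hS
  rw [hX.notMem_nearSet hba] at hx
  clear hS
  induction hn : X.skeleton.dist a x using Nat.strong_induction_on generalizing a b with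
  | _ n ih =>
  by_cases hax : a = x
  · subst hax
    exact ⟨b, hba.symm, hy, hz⟩
  obtain ⟨a', haa', hd⟩ := hX.1.1.exists_adj_dist_eq hax
  have hxb := hX.dist_eq_of_mem_nearSet hba.symm hx
  simp only [SimpleGraph.dist_comm (u := x)] at hxb
  -- a halfspace missing one of `y`, `z` would cross, giving a closer dual edge
  have key : ∀ w, w ∈ X.nearSet b a → w ∉ X.nearSet a a' → ∃ t, X.IsSquare a b t a' := by
    intro w hw hw'
    rw [hX.notMem_nearSet haa'] at hw'
    have h₁ := hX.dist_eq_of_mem_nearSet hba hw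
    have h₂ := hX.dist_eq_of_mem_nearSet haa'.symm hw'
    simp only [SimpleGraph.dist_comm (u := w)] at h₁ h₂
    obtain ⟨t, ht, -⟩ := hX.exists_isSquare (v := w) (z := a) (x := b) (y := a')
      (by rintro rfl; omega) hba.symm haa' h₁ h₂
    exact ⟨t, ht⟩
  have step : ∀ t, X.IsSquare a b t a' →
      ∃ b, X.skeleton.Adj x b ∧ y ∈ X.nearSet b x ∧ z ∈ X.nearSet b x := by
    intro t ht
    have e₁ := hX.nearSet_eq_of_isSquare ht
    have e₂ : X.nearSet b a = X.nearSet t a' :=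
      hX.nearSet_eq_of_isSquare ht.rotate.reflect
    rw [e₁] at hx
    rw [e₂] at hy hz
    exact ih _ (by omega) t a' ht.cd hx hy hz rfl
  by_cases h₁ : y ∈ X.nearSet a a'
  · by_cases h₂ : z ∈ X.nearSet a a'
    · refine ih _ (by omega) a a' haa' ?_ h₁ h₂ rfl
      simp only [nearSet, Set.mem_ofPred_eq, SimpleGraph.dist_comm (u := x)]
      omega
    · obtain ⟨t, ht⟩ := key z hz h₂
      exact step t ht
  · obtain ⟨t, ht⟩ := key y hy h₁
    exact step t ht

/-- Move `x` towards both `y` and `z` for as long as some halfspace contains `y` and `z` but not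
`x`. -/
theorem IsCAT0.exists_isMedian (hX : X.IsCAT0) (x y z : V) :
    ∃ m, IsMedian X.halfspaceSets x y z m := by
  have S := hX.isHalfspaceSystem
  induction hn : X.skeleton.dist x y using Nat.strong_induction_on generalizing x with
  | _ n ih =>
  by_cases h : ∃ h ∈ X.halfspaceSets, x ∉ h ∧ y ∈ h ∧ z ∈ h
  · obtain ⟨h, hh, h₁, h₂, h₃⟩ := h
    obtain ⟨b, hb, hy, hz⟩ := hX.exists_adj_of_sepSets hh h₁ h₂ h₃
    have hy' := hX.dist_eq_of_mem_nearSet hb.symm hy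
    have hz' := hX.dist_eq_of_mem_nearSet hb.symm hz
    simp only [SimpleGraph.dist_comm (u := y), SimpleGraph.dist_comm (u := z)] at hy' hz'
    have hb1 := SimpleGraph.dist_eq_one_iff_adj.2 hb
    obtain ⟨m, hm⟩ := ih _ (by omega) b rfl
    refine ⟨m, fun k hk => ⟨fun k₁ k₂ => (hm k hk).1 ?_ k₂, fun k₁ k₂ => (hm k hk).2.1 ?_ k₂,
      (hm k hk).2.2⟩⟩
    · exact S.mem_of_dist_add (by omega) hk k₁ k₂
    · exact S.mem_of_dist_add (by omega) hk k₁ k₂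
  · push Not at h
    exact ⟨x, fun k hk => ⟨fun h _ => h, fun h _ => h, fun h₁ h₂ =>
      by_contra fun h₃ => h k hk h₃ h₁ h₂⟩⟩

theorem IsCAT0.isMedianSystem (hX : X.IsCAT0) : IsMedianSystem X.skeleton X.halfspaceSets :=
  { hX.isHalfspaceSystem with exists_isMedian := hX.exists_isMedian }

/-! ### Transverse hyperplanes -/

theorem IsCAT0.crosses_of_isSquare (hX : X.IsCAT0) (h : X.IsSquare a b c d) :
    Crosses (X.nearSet a b) (X.nearSet b c) := by
  have hac : X.skeleton.dist a b < X.skeleton.dist a c := by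
    rw [SimpleGraph.dist_eq_one_iff_adj.2 h.ab]
    exact hX.1.1.one_lt_dist_of_ne_of_not_adj h.ac (h.not_adj hX.1)
  have e₁ := hX.nearSet_eq_of_isSquare h
  have e₂ := hX.nearSet_eq_of_isSquare h.rotate
  refine ⟨⟨a, left_mem_nearSet h.ab, hac⟩, ⟨d, ?_, ?_⟩, ⟨b, right_notMem_nearSet,
    left_mem_nearSet h.bc⟩, ⟨c, ?_, right_notMem_nearSet⟩⟩
  · rw [e₁]; exact left_mem_nearSet h.cd.symm
  · rw [e₂]; exact right_notMem_nearSet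
  · rw [e₁]; exact right_notMem_nearSet

/-- Two hyperplanes cross in a square if and only if all four sectors are nonempty. -/
theorem IsCAT0.transverse_iff (hX : X.IsCAT0) (h k : X.Halfspace) :
    X.Transverse h.hyperplane k.hyperplane ↔ Crosses h.carrier k.carrier := by
  have S := hX.isHalfspaceSystem
  have hh : h.carrier ∈ X.halfspaceSets := ⟨h, rfl⟩
  have hk : k.carrier ∈ X.halfspaceSets := ⟨k, rfl⟩
  obtain ⟨a, b, hab, h₁, h₂⟩ := hX.exists_eq_nearSet h
  obtain ⟨a', b', hab', k₁, k₂⟩ := hX.exists_eq_nearSet k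
  rw [h₁] at hh ⊢
  rw [k₁] at hk ⊢
  rw [h₂, k₂]
  constructor
  · rintro ⟨p, q, r, s, sq, m₁, m₂⟩
    have s₁ := (isSide_mk.1 ((hX.isSide_iff_of_eqvGen m₁).1 (isSide_mk.2 ⟨hab, Or.inl rfl⟩))).2
    have s₂ := (isSide_mk.1 ((hX.isSide_iff_of_eqvGen m₂).1 (isSide_mk.2 ⟨hab', Or.inl rfl⟩))).2
    have hc := hX.crosses_of_isSquare sq
    rcases s₁ with s₁ | s₁ <;> rcases s₂ with s₂ | s₂ <;> rw [s₁, s₂]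
    · exact hc
    · rw [← hX.compl_nearSet sq.bc]; exact hc.compl_right
    · rw [← hX.compl_nearSet sq.ab]; exact hc.compl_left
    · rw [← hX.compl_nearSet sq.ab, ← hX.compl_nearSet sq.bc]; exact hc.compl_left.compl_right
  · rintro ⟨⟨v₁, v₁h, v₁k⟩, ⟨v₂, v₂h, v₂k⟩, ⟨v₃, v₃h, v₃k⟩, ⟨v₄, v₄h, v₄k⟩⟩
    obtain ⟨p, q, hpq, hp, hq, hpk, hqk⟩ := S.exists_edge hk v₁h v₃h v₁k v₃k
    obtain ⟨r, s, hrs, hr, hs, hrk, hsk⟩ := S.exists_edge (S.compl_mem _ hk) v₂h v₄h v₂k v₄k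
    have e₁ : s(p, q) ∈ X.dualHyperplane a b := (hX.mem_dualHyperplane hab).2 ⟨hpq, by tauto⟩
    have e₂ : s(r, s) ∈ X.dualHyperplane a b := (hX.mem_dualHyperplane hab).2 ⟨hrs, by tauto⟩
    -- along the chain of parallel edges, the step leaving the second halfspace is a square
    have key : ∀ {e f : Sym2 V}, Relation.EqvGen X.ElemParallel e f →
        e ∈ X.dualHyperplane a b →
        ((∀ v ∈ e, v ∈ X.nearSet a' b') ↔ ∀ v ∈ f, v ∈ X.nearSet a' b') ∨
          X.Transverse (X.dualHyperplane a b) (X.dualHyperplane a' b') := by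
      intro e f hef
      induction hef with
      | rel e f hef =>
        obtain ⟨a, b, c, d, sq, rfl, rfl⟩ := hef
        intro he
        have hf := Relation.EqvGen.trans _ _ _ he (.rel _ _ ⟨a, b, c, d, sq, rfl, rfl⟩)
        by_cases hbc : s(b, c) ∈ X.dualHyperplane a' b'
        · exact Or.inr ⟨a, b, c, d, sq, he, hbc⟩
        by_cases had : s(a, d) ∈ X.dualHyperplane a' b'
        · refine Or.inr ⟨b, a, d, c, sq.rotate.reflect, ?_, had⟩
          rwa [Sym2.eq_swap]
        rw [hX.mem_dualHyperplane hab'] at hbc had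
        have hbc' := sq.bc
        have had' := sq.da.symm
        left
        simp only [Sym2.mem_iff, forall_eq_or_imp, forall_eq]
        tauto
      | refl => exact fun _ => Or.inl Iff.rfl
      | symm e f hef ih =>
        intro hf
        rcases ih (Relation.EqvGen.trans _ _ _ hf (.symm _ _ hef)) with h | h
        · exact Or.inl h.symm
        · exact Or.inr h
      | trans e f g hef _ ih₁ ih₂ =>
        intro he
        rcases ih₁ he with h | h
        · rcases ih₂ (Relation.EqvGen.trans _ _ _ he hef) with h' | h'
          · exact Or.inl (h.trans h')
          · exact Or.inr h'
        · exact Or.inr h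
    rcases key (.trans _ _ _ (.symm _ _ e₁) e₂) e₁ with h | h
    · simp only [Sym2.mem_iff, forall_eq_or_imp, forall_eq] at h
      exact absurd (h.1 ⟨hpk, hqk⟩).1 hrk
    · exact h

end Halfspaces

end CubeComplex
/-! ### Helly's theorem and Mirsky's theorem -/

/-- A finite subset of a partial order without chains of `D + 1` elements is the union of `D`
antichains (Mirsky), so has at most `N * D` elements if antichains have at most `N`. -/
theorem Finset.card_le_mul_of_no_strictMono {α : Type*} [PartialOrder α] {N : ℕ} (D : ℕ)
    {F : Finset α} (hN : ∀ A ⊆ F, (∀ a ∈ A, ∀ b ∈ A, ¬ a < b) → A.card ≤ N)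
    (hD : ¬ ∃ f : Fin (D + 1) → α, StrictMono f ∧ ∀ i, f i ∈ F) : F.card ≤ N * D := by
  classical
  induction D generalizing F with
  | zero =>
    rw [Nat.mul_zero, Nat.le_zero, Finset.card_eq_zero]
    refine Finset.eq_empty_of_forall_notMem fun a ha => hD ⟨fun _ => a, ?_, fun _ => ha⟩
    intro i j hij
    have := i.2
    have := j.2
    omega
  | succ D ih =>
    -- the minimal elements form an antichain, and chains of other elements extend downwards
    set A := F.filter fun a => ∀ b ∈ F, ¬ b < a with hA
    have h₁ : A.card ≤ N := hN A (Finset.filter_subset _ _) fun a ha b hb hab => by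
      rw [hA, Finset.mem_filter] at ha hb
      exact hb.2 a ha.1 hab
    have h₂ : (F \ A).card ≤ N * D := by
      refine ih (fun B hB => hN B (hB.trans Finset.sdiff_subset)) ?_
      rintro ⟨f, hf, hfF⟩
      have h0 := hfF 0
      rw [Finset.mem_sdiff, hA, Finset.mem_filter] at h0
      simp only [h0.1, true_and, not_forall, not_not] at h0
      obtain ⟨b, hb, hbf⟩ := h0
      refine hD ⟨Fin.cons b f, ?_, ?_⟩
      · refine Fin.strictMono_iff_lt_succ.2 fun i => ?_
        refine Fin.cases ?_ (fun j => ?_) i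
        · simpa using hbf
        · rw [Fin.cons_succ, ← Fin.succ_castSucc, Fin.cons_succ]
          exact hf (Fin.castSucc_lt_succ)
      · intro i
        refine Fin.cases ?_ (fun j => ?_) i
        · simpa using hb
        · simpa using (Finset.mem_sdiff.1 (hfF j)).1
    have h₃ := Finset.card_sdiff_add_card_eq_card
      (Finset.filter_subset (fun a => ∀ b ∈ F, ¬ b < a) F)
    rw [← hA] at h₃
    rw [Nat.mul_succ]
    omega

section Median

variable {V : Type*} {G : SimpleGraph V} {𝓗 : Set (Set V)}

/-- A set that contains every median of any two of its elements with a third vertex. -/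
def IsMedianClosed (𝓗 : Set (Set V)) (A : Set V) : Prop :=
  ∀ x y z m, x ∈ A → y ∈ A → IsMedian 𝓗 x y z m → m ∈ A

namespace IsMedian

variable {x y z m : V} {h : Set V}

theorem mem_of_mem₁₂ (hm : IsMedian 𝓗 x y z m) (hh : h ∈ 𝓗) (hx : x ∈ h) (hy : y ∈ h) : m ∈ h :=
  (hm h hh).1 hx hy

theorem perm₁₂ (hm : IsMedian 𝓗 x y z m) : IsMedian 𝓗 y x z m :=
  fun h hh => ⟨fun a b => (hm h hh).1 b a, (hm h hh).2.2, (hm h hh).2.1⟩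

theorem perm₂₃ (hm : IsMedian 𝓗 x y z m) : IsMedian 𝓗 x z y m :=
  fun h hh => ⟨(hm h hh).2.1, (hm h hh).1, fun a b => (hm h hh).2.2 b a⟩

end IsMedian

/-- Helly's theorem: finitely many pairwise intersecting median closed sets have a common vertex. -/
theorem IsMedianSystem.helly (S : IsMedianSystem G 𝓗) (l : List (Set V))
    (hl : ∀ A ∈ l, IsMedianClosed 𝓗 A) (hp : ∀ A ∈ l, ∀ B ∈ l, (A ∩ B).Nonempty) :
    ∃ v, ∀ A ∈ l, v ∈ A := by
  induction hn : l.length generalizing l with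
  | zero =>
    rw [List.length_eq_zero_iff] at hn
    subst hn
    obtain ⟨v⟩ := S.connected.nonempty
    exact ⟨v, by simp⟩
  | succ n ih =>
    obtain _ | ⟨A, l⟩ := l
    · simp at hn
    have hA := hl A List.mem_cons_self
    obtain ⟨v, hv⟩ := ih (l.map (A ∩ ·)) (by
        intro B hB
        obtain ⟨B, hB', rfl⟩ := List.mem_map.1 hB
        exact fun x y z m hx hy hm => ⟨hA x y z m hx.1 hy.1 hm,
          hl B (List.mem_cons_of_mem _ hB') x y z m hx.2 hy.2 hm⟩) (by
        intro B hB C hC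
        obtain ⟨B, hB', rfl⟩ := List.mem_map.1 hB
        obtain ⟨C, hC', rfl⟩ := List.mem_map.1 hC
        replace hB' := List.mem_cons_of_mem A hB'
        replace hC' := List.mem_cons_of_mem A hC'
        obtain ⟨x, hxA, hxB⟩ := hp A List.mem_cons_self B hB'
        obtain ⟨y, hyA, hyC⟩ := hp A List.mem_cons_self C hC'
        obtain ⟨z, hzB, hzC⟩ := hp B hB' C hC'
        obtain ⟨m, hm⟩ := S.exists_isMedian x y z
        have h₁ := hA x y z m hxA hyA hm
        exact ⟨m, ⟨h₁, hl B hB' x z y m hxB hzB hm.perm₂₃⟩, h₁,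
          hl C hC' y z x m hyC hzC hm.perm₁₂.perm₂₃⟩) (by simpa using hn)
    obtain _ | ⟨B, l⟩ := l
    · obtain ⟨v, hv, -⟩ := hp A List.mem_cons_self A List.mem_cons_self
      exact ⟨v, by simpa using hv⟩
    · refine ⟨v, fun C hC => ?_⟩
      rcases List.mem_cons.1 hC with rfl | hC
      · exact (hv _ (List.mem_map.2 ⟨B, List.mem_cons_self, rfl⟩)).1
      · exact (hv _ (List.mem_map.2 ⟨C, hC, rfl⟩)).2

theorem isMedianClosed_of_mem {h : Set V} (hh : h ∈ 𝓗) : IsMedianClosed 𝓗 h :=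
  fun _ _ _ _ hx hy hm => hm.mem_of_mem₁₂ hh hx hy

/-! ### Thin rectangles -/

/-- Opposite sides of rectangles are not both long: for any four vertices `p, q, s, t`, at most `n`
halfspaces separate `p, t` from `s, q`, or at most `n` separate `p, s` from `t, q`. -/
def HasThinRectangles (𝓗 : Set (Set V)) (n : ℕ) : Prop :=
  ∀ p q s t, (sepSets 𝓗 p s ∩ sepSets 𝓗 t q).ncard ≤ n ∨ (sepSets 𝓗 p t ∩ sepSets 𝓗 s q).ncard ≤ n

/-- The halfspaces that contain `c`, but neither `a` nor `b`. -/
def tripleSep (𝓗 : Set (Set V)) (a b c : V) : Set (Set V) :=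
  {h ∈ 𝓗 | a ∉ h ∧ b ∉ h ∧ c ∈ h}

/-- Two pencils of `m` halfspaces that all cross each other. -/
def HasGridSets (𝓗 : Set (Set V)) (m : ℕ) : Prop :=
  ∃ f g : Fin m → Set V, StrictMono f ∧ StrictMono g ∧ (∀ i, f i ∈ 𝓗) ∧ (∀ i, g i ∈ 𝓗) ∧
    ∀ i j, Crosses (f i) (g j)

namespace IsHalfspaceSystem

variable (S : IsHalfspaceSystem G 𝓗) {p q s t x y z m a b c : V}
include S

theorem finite_tripleSep : (tripleSep 𝓗 a b c).Finite :=
  (S.finite_sepSets a c).subset fun _ h => ⟨h.1, h.2.1, h.2.2.2⟩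

/-- Split the halfspaces separating `a` from `b` by the side on which `c` lies. -/
theorem dist_eq_tripleSep (a b c : V) :
    G.dist a b = (tripleSep 𝓗 a c b).ncard + (tripleSep 𝓗 b c a).ncard := by
  rw [S.dist_eq, ← Set.ncard_image_of_injective (tripleSep 𝓗 b c a) compl_injective,
    ← Set.ncard_union_eq ?_ S.finite_tripleSep (S.finite_tripleSep.image _)]
  · congr 1
    ext h
    constructor
    · rintro ⟨hh, h₁, h₂⟩
      by_cases h₃ : c ∈ h
      · exact Or.inr ⟨hᶜ, ⟨S.compl_mem h hh, by simpa, by simpa, by simpa⟩, compl_compl h⟩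
      · exact Or.inl ⟨hh, h₁, h₃, h₂⟩
    · rintro (⟨hh, h₁, h₂, h₃⟩ | ⟨k, ⟨hk, h₁, h₂, h₃⟩, rfl⟩)
      · exact ⟨hh, h₁, h₃⟩
      · exact ⟨S.compl_mem k hk, by simpa, by simpa⟩
  · rw [Set.disjoint_left]
    rintro _ ⟨-, -, h₁, -⟩ ⟨k, ⟨-, -, h₂, -⟩, rfl⟩
    exact h₁ h₂

theorem dist_eq_of_isMedian (hm : IsMedian 𝓗 a b c m) :
    G.dist m c = (tripleSep 𝓗 a b c).ncard := by
  rw [S.dist_eq]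
  congr 1
  ext h
  constructor
  · rintro ⟨hh, h₁, h₂⟩
    exact ⟨hh, fun h₃ => h₁ ((hm h hh).2.1 h₃ h₂), fun h₃ => h₁ ((hm h hh).2.2 h₃ h₂), h₂⟩
  · rintro ⟨hh, h₁, h₂, h₃⟩
    exact ⟨hh, (hm hᶜ (S.compl_mem h hh)).1 h₁ h₂, h₃⟩

/-- Geodesic bigons are thin: two points of an interval at the same distance from its origin are
opposite vertices of a square. -/
theorem dist_le_of_thin {n : ℕ} (hn : HasThinRectangles 𝓗 n)
    (hs : G.dist p s + G.dist s q = G.dist p q) (ht : G.dist p t + G.dist t q = G.dist p q)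
    (hst : G.dist p s = G.dist p t) : G.dist s t ≤ 2 * n := by
  have e₁ : sepSets 𝓗 p s ∩ sepSets 𝓗 t q = tripleSep 𝓗 p t s := by
    ext h
    constructor
    · rintro ⟨⟨hh, h₁, h₂⟩, -, h₃, h₄⟩
      exact ⟨hh, h₁, h₃, h₂⟩
    · rintro ⟨hh, h₁, h₂, h₃⟩
      exact ⟨⟨hh, h₁, h₃⟩, hh, h₂, by_contra fun h₄ => S.notMem_of_dist_add hs hh h₁ h₄ h₃⟩
  have e₂ : sepSets 𝓗 p t ∩ sepSets 𝓗 s q = tripleSep 𝓗 p s t := by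
    ext h
    constructor
    · rintro ⟨⟨hh, h₁, h₂⟩, -, h₃, h₄⟩
      exact ⟨hh, h₁, h₃, h₂⟩
    · rintro ⟨hh, h₁, h₂, h₃⟩
      exact ⟨⟨hh, h₁, h₃⟩, hh, h₂, by_contra fun h₄ => S.notMem_of_dist_add ht hh h₁ h₄ h₃⟩
  have h₁ := S.dist_eq_tripleSep p s t
  have h₂ := S.dist_eq_tripleSep p t s
  have h₃ := S.dist_eq_tripleSep s t p
  have c₁ : ∀ a b c, tripleSep 𝓗 a b c = tripleSep 𝓗 b a c := by
    intro a b c; ext h; simp only [tripleSep, Set.mem_ofPred_eq]; tauto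
  have := hn p q s t
  rw [e₁, e₂] at this
  rw [c₁ s t p] at h₁
  rw [c₁ s p t, c₁ t p s] at h₃
  omega

end IsHalfspaceSystem

theorem HasThinRectangles.grid_le (S : IsHalfspaceSystem G 𝓗) {n m : ℕ}
    (hn : HasThinRectangles 𝓗 n) (hm : HasGridSets 𝓗 m) : m ≤ n := by
  -- the extreme sectors of the grid contain the corners of a rectangle
  obtain ⟨f, g, hf, hg, hf𝓗, hg𝓗, hfg⟩ := hm
  obtain _ | m := m
  · omega
  obtain ⟨⟨q, hq, hq'⟩, -⟩ := hfg 0 0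
  obtain ⟨-, -, -, ⟨p, hp, hp'⟩⟩ := hfg (Fin.last m) (Fin.last m)
  obtain ⟨-, ⟨s, hs, hs'⟩, -⟩ := hfg 0 (Fin.last m)
  obtain ⟨-, -, ⟨t, ht, ht'⟩, -⟩ := hfg (Fin.last m) 0
  have f₁ : ∀ i, f 0 ⊆ f i := fun i => hf.monotone (Fin.zero_le i)
  have f₂ : ∀ i, f i ⊆ f (Fin.last m) := fun i => hf.monotone (Fin.le_last i)
  have g₁ : ∀ i, g 0 ⊆ g i := fun i => hg.monotone (Fin.zero_le i)
  have g₂ : ∀ i, g i ⊆ g (Fin.last m) := fun i => hg.monotone (Fin.le_last i)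
  have hF : Set.range f ⊆ sepSets 𝓗 p s ∩ sepSets 𝓗 t q := by
    rintro _ ⟨i, rfl⟩
    exact ⟨⟨hf𝓗 i, fun h => hp (f₂ i h), f₁ i hs⟩, hf𝓗 i, fun h => ht (f₂ i h), f₁ i hq⟩
  have hG : Set.range g ⊆ sepSets 𝓗 p t ∩ sepSets 𝓗 s q := by
    rintro _ ⟨i, rfl⟩
    exact ⟨⟨hg𝓗 i, fun h => hp' (g₂ i h), g₁ i ht'⟩, hg𝓗 i, fun h => hs' (g₂ i h), g₁ i hq'⟩
  have h₁ := Set.ncard_le_ncard hF ((S.finite_sepSets _ _).inter_of_left _)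
  have h₂ := Set.ncard_le_ncard hG ((S.finite_sepSets _ _).inter_of_left _)
  rw [Set.ncard_range_of_injective hf.injective, Nat.card_fin] at h₁
  rw [Set.ncard_range_of_injective hg.injective, Nat.card_fin] at h₂
  rcases hn p q s t with h | h <;> omega

/-- Halfspaces separating `x` from `y` that pairwise cross form a cube, whose vertices are provided
by Helly's theorem; half of them against the other half is a rectangle. -/
theorem HasThinRectangles.card_le_of_crosses (S : IsMedianSystem G 𝓗) {n : ℕ}
    (hn : HasThinRectangles 𝓗 n) {x y : V} {A : Finset (Set V)} (hA : ↑A ⊆ sepSets 𝓗 x y)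
    (hc : ∀ h ∈ A, ∀ k ∈ A, h ≠ k → Crosses h k) : A.card ≤ 2 * n + 1 := by
  classical
  by_contra hcard
  obtain ⟨A₁, hA₁, hc₁⟩ := Finset.exists_subset_card_eq (s := A) (n := n + 1) (by omega)
  have corner : ∀ A₁ ⊆ A, ∃ s, (∀ h ∈ A₁, s ∈ h) ∧ ∀ h ∈ A \ A₁, s ∉ h := by
    intro A₁ hA₁
    obtain ⟨s, hs⟩ := S.helly (A₁.toList ++ (A \ A₁).toList.map compl) (by
        intro B hB
        simp only [List.mem_append, Finset.mem_toList, List.mem_map] at hB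
        rcases hB with hB | ⟨B, hB, rfl⟩
        · exact isMedianClosed_of_mem (hA (hA₁ hB)).1
        · exact isMedianClosed_of_mem (S.compl_mem _ (hA (Finset.sdiff_subset hB)).1)) (by
        intro B hB C hC
        simp only [List.mem_append, Finset.mem_toList, List.mem_map] at hB hC
        rcases hB with hB | ⟨B, hB, rfl⟩ <;> rcases hC with hC | ⟨C, hC, rfl⟩
        · exact ⟨y, (hA (hA₁ hB)).2.2, (hA (hA₁ hC)).2.2⟩
        · rw [Finset.mem_sdiff] at hC
          obtain ⟨-, ⟨v, hv⟩, -⟩ := hc B (hA₁ hB) C hC.1 (by rintro rfl; exact hC.2 hB)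
          exact ⟨v, hv⟩
        · rw [Finset.mem_sdiff] at hB
          obtain ⟨-, -, ⟨v, hv⟩, -⟩ := hc B hB.1 C (hA₁ hC) (by rintro rfl; exact hB.2 hC)
          exact ⟨v, hv⟩
        · exact ⟨x, (hA (Finset.sdiff_subset hB)).2.1, (hA (Finset.sdiff_subset hC)).2.1⟩)
    refine ⟨s, fun h hh => hs h (by simp [hh]), fun h hh => hs hᶜ ?_⟩
    rw [List.mem_append, List.mem_map]
    exact Or.inr ⟨h, by simpa using hh, rfl⟩
  obtain ⟨s, hs₁, hs₂⟩ := corner A₁ hA₁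
  obtain ⟨t, ht₁, ht₂⟩ := corner (A \ A₁) Finset.sdiff_subset
  rw [Finset.sdiff_sdiff_eq_self hA₁] at ht₂
  have h₁ : (A₁ : Set (Set V)) ⊆ sepSets 𝓗 x s ∩ sepSets 𝓗 t y := fun h hh =>
    have := hA (hA₁ hh)
    ⟨⟨this.1, this.2.1, hs₁ h hh⟩, this.1, ht₂ h hh, this.2.2⟩
  have h₂ : ((A \ A₁ : Finset (Set V)) : Set (Set V)) ⊆ sepSets 𝓗 x t ∩ sepSets 𝓗 s y :=
    fun h hh =>
      have := hA (Finset.sdiff_subset hh)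
      ⟨⟨this.1, this.2.1, ht₁ h hh⟩, this.1, hs₂ h hh, this.2.2⟩
  have e₁ := Set.ncard_le_ncard h₁ ((S.finite_sepSets _ _).inter_of_left _)
  have e₂ := Set.ncard_le_ncard h₂ ((S.finite_sepSets _ _).inter_of_left _)
  rw [Set.ncard_coe_finset] at e₁ e₂
  rw [Finset.card_sdiff_of_subset hA₁] at e₂
  rcases hn x y s t with h | h <;> omega

/-- There is no grid of size `D + 1`, and a set of more than `B` halfspaces, all separating
the same two vertices, contains a pencil of size `D + 1`. -/
structure IsThin (𝓗 : Set (Set V)) (D B : ℕ) : Prop where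
  no_grid : ¬ HasGridSets 𝓗 (D + 1)
  ncard_le : ∀ x y, ∀ F ⊆ sepSets 𝓗 x y,
    (¬ ∃ f : Fin (D + 1) → Set V, StrictMono f ∧ ∀ i, f i ∈ F) → F.ncard ≤ B

theorem HasThinRectangles.isThin (S : IsMedianSystem G 𝓗) {n D B : ℕ}
    (hn : HasThinRectangles 𝓗 n) (hD : ¬ HasGridSets 𝓗 (D + 1)) (hB : (2 * n + 1) * D ≤ B) :
    IsThin 𝓗 D B where
  no_grid := hD
  ncard_le x y F hF hf := by
    have hfin : F.Finite := (S.finite_sepSets x y).subset hF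
    lift F to Finset (Set V) using hfin
    rw [Set.ncard_coe_finset]
    refine (Finset.card_le_mul_of_no_strictMono D (fun A hA hanti => ?_) hf).trans hB
    refine hn.card_le_of_crosses S ((Finset.coe_subset.2 hA).trans hF) fun h hh k hk hne => ?_
    have h₁ := hF (hA hh)
    have h₂ := hF (hA hk)
    -- halfspaces separating the same vertices are nested if they do not cross
    have aux : ∀ {h k : Set V}, h ∈ A → k ∈ A → h ≠ k → ∃ v, v ∈ h ∧ v ∉ k := by
      intro h k hh hk hne
      by_contra hcon
      push Not at hcon
      exact hanti h hh k hk (lt_of_le_of_ne hcon hne)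
    obtain ⟨v, hv, hv'⟩ := aux hh hk hne
    obtain ⟨w, hw, hw'⟩ := aux hk hh hne.symm
    exact ⟨⟨y, h₁.2.2, h₂.2.2⟩, ⟨v, hv, hv'⟩, ⟨w, hw', hw⟩, x, h₁.2.1, h₂.2.1⟩

namespace IsThin

variable {D B : ℕ} {x y x' y' : V}

theorem ncard_le_of_pencil_crosses (T : IsThin 𝓗 D B) {f : Fin (D + 1) → Set V}
    (hf : StrictMono f) (hf𝓗 : ∀ i, f i ∈ 𝓗) {F : Set (Set V)} (hF : F ⊆ sepSets 𝓗 x y)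
    (hc : ∀ i, ∀ k ∈ F, Crosses (f i) k) : F.ncard ≤ B :=
  T.ncard_le x y F hF fun ⟨g, hg, hgF⟩ =>
    T.no_grid ⟨f, g, hf, hg, hf𝓗, fun i => (hF (hgF i)).1, fun i j => hc i _ (hgF j)⟩

/-- Two families of halfspaces that cross each other cannot both be large: each would contain a
pencil, and the two pencils would form a grid. -/
theorem ncard_le_or_of_crosses (T : IsThin 𝓗 D B) {E F : Set (Set V)} (hE : E ⊆ sepSets 𝓗 x y)
    (hF : F ⊆ sepSets 𝓗 x' y') (hc : ∀ h ∈ E, ∀ k ∈ F, Crosses h k) :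
    E.ncard ≤ B ∨ F.ncard ≤ B := by
  by_cases hf : ∃ f : Fin (D + 1) → Set V, StrictMono f ∧ ∀ i, f i ∈ E
  · obtain ⟨f, hf, hfE⟩ := hf
    exact Or.inr (T.ncard_le_of_pencil_crosses hf (fun i => (hE (hfE i)).1) hF
      fun i => hc _ (hfE i))
  · exact Or.inl (T.ncard_le x y E hE hf)

end IsThin

end Median
/-! ### Slim triangles and thin rectangles -/

namespace SimpleGraph

variable {V : Type*} {G : SimpleGraph V} {x y v : V}

theorem IsGeodesicWalk.dist_add_dist (hG : G.Connected) {p : G.Walk x y} (hp : G.IsGeodesicWalk p)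
    (hv : v ∈ p.support) : G.dist x v + G.dist v y = G.dist x y := by
  obtain ⟨q, r, rfl⟩ := Walk.mem_support_iff_exists_append.1 hv
  rw [IsGeodesicWalk, Walk.length_append] at hp
  have h₁ := dist_le q
  have h₂ := dist_le r
  have h₃ := hG.dist_triangle (u := x) (v := v) (w := y)
  omega

theorem IsGeodesicWalk.exists_dist_eq (hG : G.Connected) {p : G.Walk x y}
    (hp : G.IsGeodesicWalk p) {i : ℕ} (hi : i ≤ G.dist x y) :
    ∃ v ∈ p.support, G.dist x v = i := by
  refine ⟨p.getVert i, p.getVert_mem_support i, ?_⟩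
  have h₁ := dist_le (p.take i)
  have h₂ := dist_le (p.drop i)
  rw [Walk.take_length] at h₁
  rw [Walk.drop_length] at h₂
  rw [IsGeodesicWalk] at hp
  have h₃ := hG.dist_triangle (u := x) (v := p.getVert i) (w := y)
  omega

theorem Connected.exists_isGeodesicWalk (hG : G.Connected) (x y : V) :
    ∃ p : G.Walk x y, G.IsGeodesicWalk p :=
  hG.exists_walk_length_eq_dist x y

theorem IsGeodesicWalk.append (hxy : G.dist x v + G.dist v y = G.dist x y) {p : G.Walk x v}
    {q : G.Walk v y} (hp : G.IsGeodesicWalk p) (hq : G.IsGeodesicWalk q) :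
    G.IsGeodesicWalk (p.append q) := by
  rw [IsGeodesicWalk, Walk.length_append, hp, hq, hxy]

end SimpleGraph

section Thin

variable {V : Type*} {G : SimpleGraph V} {𝓗 : Set (Set V)}

theorem IsMedian.notMem (S : IsHalfspaceSystem G 𝓗) {x y z m : V} (hm : IsMedian 𝓗 x y z m)
    {h : Set V} (hh : h ∈ 𝓗) :
    (x ∉ h → y ∉ h → m ∉ h) ∧ (x ∉ h → z ∉ h → m ∉ h) ∧ (y ∉ h → z ∉ h → m ∉ h) :=
  hm hᶜ (S.compl_mem h hh)

theorem IsMedian.dist_add_dist (S : IsHalfspaceSystem G 𝓗) {x y z m : V}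
    (hm : IsMedian 𝓗 x y z m) : G.dist x m + G.dist m y = G.dist x y :=
  S.dist_add_of_forall_mem fun _ hh hx hy => hm.mem_of_mem₁₂ hh hx hy

/-- In a slim bigon through two opposite corners of a rectangle, one of the other two corners is
close to the opposite side of the bigon, and is separated from it by a side of the rectangle. -/
theorem SimpleGraph.IsSlim.hasThinRectangles (S : IsMedianSystem G 𝓗) {δ : ℝ}
    (hδ : G.IsSlim δ) : HasThinRectangles 𝓗 ⌊δ⌋₊ := by
  intro p q s t
  obtain ⟨s', hs'⟩ := S.exists_isMedian p q s
  obtain ⟨t', ht'⟩ := S.exists_isMedian p q t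
  obtain ⟨g₁, hg₁⟩ := S.connected.exists_isGeodesicWalk p s'
  obtain ⟨g₂, hg₂⟩ := S.connected.exists_isGeodesicWalk s' q
  obtain ⟨g₃, hg₃⟩ := S.connected.exists_isGeodesicWalk p t'
  obtain ⟨g₄, hg₄⟩ := S.connected.exists_isGeodesicWalk t' q
  have hds := hs'.dist_add_dist S.toIsHalfspaceSystem
  have hdt := ht'.dist_add_dist S.toIsHalfspaceSystem
  have hnil : G.IsGeodesicWalk (Walk.nil : G.Walk q q) := by simp [IsGeodesicWalk]
  obtain ⟨w, hw, hd⟩ := hδ p q q _ _ _ (hg₁.append hds hg₂) hnil (hg₃.append hdt hg₄) s'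
    (by rw [Walk.mem_support_append_iff]; exact Or.inl g₁.end_mem_support)
  have hw' : w ∈ g₃.support ∨ w ∈ g₄.support := by
    rcases hw with hw | hw
    · rw [Walk.support_nil, List.mem_singleton] at hw
      subst hw
      exact Or.inr g₄.end_mem_support
    · rwa [Walk.mem_support_append_iff] at hw
  have hd' : G.dist s' w ≤ ⌊δ⌋₊ := Nat.le_floor hd
  have hcomm : G.dist w s' = G.dist s' w := dist_comm
  rcases hw' with hw | hw
  · left
    refine le_trans (Set.ncard_le_ncard ?_ (S.finite_sepSets w s')) (by
      rw [← S.dist_eq]; omega)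
    rintro h ⟨⟨hh, h₁, h₂⟩, -, h₃, h₄⟩
    refine ⟨hh, ?_, (hs' h hh).2.2 h₄ h₂⟩
    exact S.notMem_of_dist_add (hg₃.dist_add_dist S.connected hw) hh h₁
      ((ht'.notMem S.toIsHalfspaceSystem hh).2.1 h₁ h₃)
  · right
    refine le_trans (Set.ncard_le_ncard ?_ (S.finite_sepSets s' w)) (by
      rw [← S.dist_eq]; omega)
    rintro h ⟨⟨hh, h₁, h₂⟩, -, h₃, h₄⟩
    refine ⟨hh, (hs'.notMem S.toIsHalfspaceSystem hh).2.1 h₁ h₃, ?_⟩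
    exact S.mem_of_dist_add (hg₄.dist_add_dist S.connected hw) hh ((ht' h hh).2.2 h₄ h₂) h₄

theorem HasThinRectangles.isSlim (S : IsMedianSystem G 𝓗) {n : ℕ}
    (hn : HasThinRectangles 𝓗 n) : G.IsSlim (4 * n : ℕ) := by
  -- from a point of `[x, y]` on the side of `x` of the median, pass to `[x, m]`, then to `[x, z]`
  have key : ∀ {x y z m v : V} (r : G.Walk x z), G.IsGeodesicWalk r → IsMedian 𝓗 x y z m →
      G.dist x v + G.dist v y = G.dist x y → G.dist x v ≤ G.dist x m →
      ∃ w ∈ r.support, G.dist v w ≤ 4 * n := by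
    intro x y z m v r hr hm hv hvm
    obtain ⟨g, hg⟩ := S.connected.exists_isGeodesicWalk x m
    obtain ⟨v', hv', hd⟩ := hg.exists_dist_eq S.connected hvm
    have h₁ := hg.dist_add_dist S.connected hv'
    have h₂ := hm.dist_add_dist S.toIsHalfspaceSystem
    have h₃ := hm.perm₂₃.dist_add_dist S.toIsHalfspaceSystem
    have t₁ := S.connected.dist_triangle (u := v') (v := m) (w := y)
    have t₂ := S.connected.dist_triangle (u := v') (v := m) (w := z)
    have t₃ := S.connected.dist_triangle (u := x) (v := v') (w := y)
    have t₄ := S.connected.dist_triangle (u := x) (v := v') (w := z)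
    obtain ⟨w, hw, hdw⟩ := hr.exists_dist_eq S.connected (i := G.dist x v) (by omega)
    have b₁ := S.dist_le_of_thin hn hv (show G.dist x v' + G.dist v' y = G.dist x y by omega)
      hd.symm
    have b₂ := S.dist_le_of_thin hn (show G.dist x v' + G.dist v' z = G.dist x z by omega)
      (hr.dist_add_dist S.connected hw) (hd.trans hdw.symm)
    have := S.connected.dist_triangle (u := v) (v := v') (w := w)
    exact ⟨w, hw, by omega⟩
  intro x y z p q r hp hq hr v hv
  obtain ⟨m, hm⟩ := S.exists_isMedian x y z
  have hxv := hp.dist_add_dist S.connected hv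
  have hxm := hm.dist_add_dist S.toIsHalfspaceSystem
  by_cases hvm : G.dist x v ≤ G.dist x m
  · obtain ⟨w, hw, hd⟩ := key r hr hm hxv hvm
    exact ⟨w, Or.inr hw, by exact_mod_cast hd⟩
  · have c₁ : G.dist y v = G.dist v y := SimpleGraph.dist_comm
    have c₂ : G.dist y m = G.dist m y := SimpleGraph.dist_comm
    have c₃ : G.dist v x = G.dist x v := SimpleGraph.dist_comm
    have c₄ : G.dist y x = G.dist x y := SimpleGraph.dist_comm
    obtain ⟨w, hw, hd⟩ := key (y := x) (v := v) q hq hm.perm₁₂ (by omega) (by omega)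
    exact ⟨w, Or.inl hw, by exact_mod_cast hd⟩

/-! ### Cylinders -/

/-- The intersection of the complements of those halfspaces that miss `x` and `y` and are not
crossed by a pencil of `D + 1` halfspaces separating `x` from `y`. -/
def pencilHull (𝓗 : Set (Set V)) (D : ℕ) (x y : V) : Set V :=
  {w | ∀ h ∈ 𝓗, x ∉ h → y ∉ h → w ∈ h →
    ∃ f : Fin (D + 1) → Set V, StrictMono f ∧ ∀ i, f i ∈ sepSets 𝓗 x y ∧ Crosses h (f i)}

variable {D B : ℕ} {x y z m w w' : V}

/-- A pencil crossing the smallest halfspace of a pencil crosses all of it; so a pencil of `D + 1`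
halfspaces that cut off a point of the hull from `x` and `y` would produce a large grid. -/
theorem IsThin.ncard_tripleSep_le (T : IsThin 𝓗 D B) (hw : w ∈ pencilHull 𝓗 D x y) :
    (tripleSep 𝓗 x y w).ncard ≤ B := by
  refine T.ncard_le x w _ (fun h hh => ⟨hh.1, hh.2.1, hh.2.2.2⟩) ?_
  rintro ⟨f, hf, hfF⟩
  obtain ⟨g, hg, hgc⟩ := hw (f 0) (hfF 0).1 (hfF 0).2.1 (hfF 0).2.2.1 (hfF 0).2.2.2
  refine T.no_grid ⟨f, g, hf, hg, fun i => (hfF i).1, fun i => (hgc i).1.1, fun i j => ?_⟩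
  have hsub : f 0 ⊆ f i := hf.monotone (Fin.zero_le i)
  obtain ⟨⟨-, hx, hy⟩, ⟨a, ha, ha'⟩, ⟨b, hb, hb'⟩, -, -⟩ := hgc j
  exact ⟨⟨a, hsub ha, ha'⟩, ⟨b, hsub hb, hb'⟩, ⟨y, (hfF i).2.2.1, hy⟩, x, (hfF i).2.1, hx⟩

theorem IsThin.isCylinders (T : IsThin 𝓗 D B) (S : IsMedianSystem G 𝓗) {n : ℕ}
    (hn : HasThinRectangles 𝓗 n) : G.IsCylinders (B + 2 * n : ℕ) (pencilHull 𝓗 D) := by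
  intro x y p hp
  constructor
  · intro v hv h hh hx hy hvh
    exact absurd hvh (S.notMem_of_dist_add (hp.dist_add_dist S.connected hv) hh hx hy)
  · intro w hw
    obtain ⟨m, hm⟩ := S.exists_isMedian x y w
    have h₁ := S.dist_eq_of_isMedian hm
    have h₂ := T.ncard_tripleSep_le hw
    have h₃ := hm.dist_add_dist S.toIsHalfspaceSystem
    obtain ⟨v, hv, hd⟩ := hp.exists_dist_eq S.connected (i := G.dist x m) (by omega)
    have h₄ := S.dist_le_of_thin hn h₃ (hp.dist_add_dist S.connected hv) hd.symm
    have h₅ := S.connected.dist_triangle (u := w) (v := m) (w := v)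
    rw [SimpleGraph.dist_comm (u := w) (v := m)] at h₅
    exact ⟨v, hv, by exact_mod_cast (by omega : G.dist w v ≤ B + 2 * n)⟩

theorem pencilHull_comm (S : IsHalfspaceSystem G 𝓗) (D : ℕ) (x y : V) :
    pencilHull 𝓗 D x y = pencilHull 𝓗 D y x := by
  have aux : ∀ x y, pencilHull 𝓗 D x y ⊆ pencilHull 𝓗 D y x := by
    intro x y w hw h hh hy hx hwh
    obtain ⟨f, hf, hfc⟩ := hw h hh hx hy hwh
    refine ⟨fun i => (f i.rev)ᶜ, fun i j hij => ?_, fun i => ?_⟩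
    · exact compl_lt_compl_iff_lt.2 (hf (Fin.rev_lt_rev.2 hij))
    · obtain ⟨⟨h₁, h₂, h₃⟩, h₄⟩ := hfc i.rev
      exact ⟨⟨S.compl_mem _ h₁, by simpa, by simpa⟩, h₄.compl_right⟩
  exact (aux x y).antisymm (aux y x)

/-! ### Stability -/

/-- The halfspace `h` keeps `w` out of the hull of `x, z`, and misses `y`; it does not keep `w` out
of the hull of `x, y` because of the pencil `f`, whose smallest member misses `z`. -/
structure IsStabilityDefect (𝓗 : Set (Set V)) (D : ℕ) (x y z w : V) (h : Set V)
    (f : Fin (D + 1) → Set V) : Prop where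
  mem : h ∈ 𝓗
  left : x ∉ h
  mid : y ∉ h
  right : z ∉ h
  point : w ∈ h
  few : ¬ ∃ g : Fin (D + 1) → Set V, StrictMono g ∧ ∀ i, g i ∈ sepSets 𝓗 x z ∧ Crosses h (g i)
  strictMono : StrictMono f
  sep : ∀ i, f i ∈ sepSets 𝓗 x y
  crosses : ∀ i, Crosses h (f i)
  right_notMem : z ∉ f 0

theorem IsThin.ncard_crossing_le (T : IsThin 𝓗 D B) {h : Set V}
    (hf : ¬ ∃ g : Fin (D + 1) → Set V, StrictMono g ∧ ∀ i, g i ∈ sepSets 𝓗 x z ∧ Crosses h (g i)) :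
    {k ∈ sepSets 𝓗 x z | Crosses h k}.ncard ≤ B :=
  T.ncard_le x z _ (fun _ hk => hk.1) hf

/-- A halfspace separating `x, w` from `m` and not crossed by `h` crosses the pencil. -/
theorem IsStabilityDefect.crosses_of_not (S : IsMedianSystem G 𝓗)
    (hm : IsMedian 𝓗 x y z m) {h k : Set V} {f : Fin (D + 1) → Set V}
    (d : IsStabilityDefect 𝓗 D x y z w h f) (hk : k ∈ tripleSep 𝓗 x w m)
    (hhk : ¬ Crosses h k) : Crosses (f 0) k := by
  have hS := S.toIsHalfspaceSystem
  obtain ⟨hk, k₁, k₂, k₃⟩ := hk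
  have hmh : m ∉ h := (hm.notMem hS d.mem).1 d.left d.mid
  have hmf : m ∉ f 0 := (hm.notMem hS (d.sep 0).1).2.1 (d.sep 0).2.1 d.right_notMem
  have hyk : y ∈ k := by have := hm.notMem hS hk; tauto
  obtain ⟨⟨p, hp, hpf⟩, -⟩ := d.crosses 0
  by_cases hpk : p ∈ k
  · exact absurd ⟨⟨p, hp, hpk⟩, ⟨w, d.point, k₂⟩, ⟨m, hmh, k₃⟩, x, d.left, k₁⟩ hhk
  · exact ⟨⟨y, (d.sep 0).2.2, hyk⟩, ⟨p, hpf, hpk⟩, ⟨m, hmf, k₃⟩, x, (d.sep 0).2.1, k₁⟩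

section Stability

variable (T : IsThin 𝓗 D B) (S : IsMedianSystem G 𝓗) (hm : IsMedian 𝓗 x y z m)
include T S hm

/-- A point of the hull of `x, y` which is not farther from `x` than `m` is almost on a geodesic
between `x` and `m`. -/
theorem ncard_tripleSep_median_le (hw : w ∈ pencilHull 𝓗 D x y) (hd : G.dist x w ≤ G.dist x m) :
    (tripleSep 𝓗 x m w).ncard ≤ 2 * B := by
  have hS := S.toIsHalfspaceSystem
  have h₁ := T.ncard_tripleSep_le hw
  set Y : Set (Set V) := {h ∈ 𝓗 | x ∉ h ∧ m ∉ h ∧ w ∈ h ∧ y ∈ h} with hY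
  have hsub : tripleSep 𝓗 x m w ⊆ tripleSep 𝓗 x y w ∪ Y := by
    rintro h ⟨hh, h₁, h₂, h₃⟩
    by_cases hy : y ∈ h
    · exact Or.inr ⟨hh, h₁, h₂, h₃, hy⟩
    · exact Or.inl ⟨hh, h₁, hy, h₃⟩
  have hYfin : Y.Finite := (S.finite_sepSets x w).subset fun h hh => ⟨hh.1, hh.2.1, hh.2.2.2.1⟩
  have h₂ := (Set.ncard_le_ncard hsub (hS.finite_tripleSep.union hYfin)).trans
    (Set.ncard_union_le _ _)
  have h₃ := T.ncard_le_or_of_crosses (E := Y) (F := tripleSep 𝓗 x w m) (x := x) (y := w)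
    (x' := x) (y' := m) (fun h hh => ⟨hh.1, hh.2.1, hh.2.2.2.1⟩)
    (fun h hh => ⟨hh.1, hh.2.1, hh.2.2.2⟩) (by
      rintro h ⟨hh, h₁, h₂, h₃, h₄⟩ k ⟨hk, k₁, k₂, k₃⟩
      have hyk : y ∈ k := by
        by_contra hyk
        exact (hm.notMem hS hk).1 k₁ hyk k₃
      exact ⟨⟨y, h₄, hyk⟩, ⟨w, h₃, k₂⟩, ⟨m, h₂, k₃⟩, x, h₁, k₁⟩)
  have h₄ := hS.dist_eq_tripleSep x w m
  have h₅ := hS.dist_eq_tripleSep x m w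
  have h₆ : tripleSep 𝓗 w m x = tripleSep 𝓗 m w x := by
    ext h; simp only [tripleSep, Set.mem_ofPred_eq]; tauto
  rw [h₆] at h₄
  omega

/-- The distance from `m` to such a point is governed by the halfspaces that contain `m` only. -/
theorem dist_le_of_tripleSep (hw : w ∈ pencilHull 𝓗 D x y) (hd : G.dist x w ≤ G.dist x m) :
    G.dist w m ≤ (tripleSep 𝓗 x w m).ncard + 2 * B := by
  have h₁ := S.toIsHalfspaceSystem.dist_eq_tripleSep w m x
  have h₂ := ncard_tripleSep_median_le T S hm hw hd
  have h₃ : tripleSep 𝓗 w x m = tripleSep 𝓗 x w m := by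
    ext h; simp only [tripleSep, Set.mem_ofPred_eq]; tauto
  have h₄ : tripleSep 𝓗 m x w = tripleSep 𝓗 x m w := by
    ext h; simp only [tripleSep, Set.mem_ofPred_eq]; tauto
  rw [h₃, h₄] at h₁
  omega

/-- A point of `C(x, y)` but not of `C(x, z)` is close to the median, or gives a defect. -/
theorem exists_isStabilityDefect (hw' : w ∉ pencilHull 𝓗 D x z) (hw : w ∈ pencilHull 𝓗 D x y) :
    (tripleSep 𝓗 x w m).ncard ≤ B ∨ ∃ h f, IsStabilityDefect 𝓗 D x y z w h f := by
  have hS := S.toIsHalfspaceSystem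
  simp only [pencilHull, Set.mem_ofPred_eq, not_forall] at hw'
  obtain ⟨h, hh, hx, hz, hwh, hf⟩ := hw'
  have hmh : m ∉ h := (hm.notMem hS hh).2.1 hx hz
  by_cases hy : y ∈ h
  · left
    refine (Set.ncard_le_ncard ?_ ((S.finite_sepSets x z).subset fun k hk => hk.1)).trans
      (T.ncard_crossing_le hf)
    rintro k ⟨hk, k₁, k₂, k₃⟩
    have hn := hm.notMem hS hk
    have hyk : y ∈ k := by tauto
    have hzk : z ∈ k := by tauto
    exact ⟨⟨hk, k₁, hzk⟩, ⟨y, hy, hyk⟩, ⟨w, hwh, k₂⟩, ⟨m, hmh, k₃⟩, x, hx, k₁⟩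
  · right
    obtain ⟨f, hf', hfc⟩ := hw h hh hx hy hwh
    refine ⟨h, f, hh, hx, hy, hz, hwh, hf, hf', fun i => (hfc i).1, fun i => (hfc i).2, ?_⟩
    intro hz0
    exact hf ⟨f, hf', fun i => ⟨⟨(hfc i).1.1, (hfc i).1.2.1, hf'.monotone (Fin.zero_le i) hz0⟩,
      (hfc i).2⟩⟩

/-- The halfspaces separating `x, w` from `m` contain `z`, and `h` crosses few halfspaces separating
`x` from `z`. -/
theorem IsStabilityDefect.ncard_crossing_le {h : Set V} {f : Fin (D + 1) → Set V}
    (d : IsStabilityDefect 𝓗 D x y z w h f) :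
    {k ∈ tripleSep 𝓗 x w m | Crosses h k}.ncard ≤ B := by
  refine (Set.ncard_le_ncard ?_ ((S.finite_sepSets x z).subset fun k hk => hk.1)).trans
    (T.ncard_crossing_le d.few)
  rintro k ⟨⟨hk, k₁, k₂, k₃⟩, k₄⟩
  have hn := hm.notMem S.toIsHalfspaceSystem hk
  exact ⟨⟨hk, k₁, by tauto⟩, k₄⟩

/-- Two defects `w, w'` whose pencils have the same smallest member are close together: the
halfspaces between them that are not crossed by `h` or `h'` cross the whole pencil `f'`. -/
theorem IsStabilityDefect.ncard_le_of_eq {h h' : Set V} {f f' : Fin (D + 1) → Set V}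
    (d : IsStabilityDefect 𝓗 D x y z w h f) (d' : IsStabilityDefect 𝓗 D x y z w' h' f')
    (hff : f 0 = f' 0) :
    {k ∈ 𝓗 | x ∉ k ∧ m ∈ k ∧ w ∉ k ∧ w' ∈ k}.ncard ≤ 3 * B := by
  have hS := S.toIsHalfspaceSystem
  set M₁ := {k ∈ sepSets 𝓗 x z | Crosses h k} with hM₁
  set M₂ := {k ∈ sepSets 𝓗 x z | Crosses h' k} with hM₂
  set M₃ := {k ∈ 𝓗 | x ∉ k ∧ m ∈ k ∧ w ∉ k ∧ w' ∈ k ∧ ¬ Crosses h k ∧ ¬ Crosses h' k} with hM₃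
  have hsub : {k ∈ 𝓗 | x ∉ k ∧ m ∈ k ∧ w ∉ k ∧ w' ∈ k} ⊆ M₁ ∪ M₂ ∪ M₃ := by
    rintro k ⟨hk, k₁, k₂, k₃, k₄⟩
    have hn := hm.notMem hS hk
    have hzk : z ∈ k := by tauto
    by_cases c₁ : Crosses h k
    · exact Or.inl (Or.inl ⟨⟨hk, k₁, hzk⟩, c₁⟩)
    by_cases c₂ : Crosses h' k
    · exact Or.inl (Or.inr ⟨⟨hk, k₁, hzk⟩, c₂⟩)
    exact Or.inr ⟨hk, k₁, k₂, k₃, k₄, c₁, c₂⟩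
  have f₁ : M₁.Finite := (S.finite_sepSets x z).subset fun k hk => hk.1
  have f₂ : M₂.Finite := (S.finite_sepSets x z).subset fun k hk => hk.1
  have hM₃' : M₃ ⊆ sepSets 𝓗 x m := fun k hk => ⟨hk.1, hk.2.1, hk.2.2.1⟩
  have f₃ : M₃.Finite := (S.finite_sepSets x m).subset hM₃'
  have e₁ : M₁.ncard ≤ B := T.ncard_crossing_le d.few
  have e₂ : M₂.ncard ≤ B := T.ncard_crossing_le d'.few
  have e₃ : M₃.ncard ≤ B := by
    refine T.ncard_le_of_pencil_crosses d'.strictMono (fun i => (d'.sep i).1) hM₃' ?_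
    rintro i k ⟨hk, k₁, k₂, k₃, k₄, c₁, c₂⟩
    have c₀ := d.crosses_of_not S hm ⟨hk, k₁, k₃, k₂⟩ c₁
    rw [hff] at c₀
    obtain ⟨⟨p₁, p₁f, p₁k⟩, ⟨p₂, p₂f, p₂k⟩, -, -⟩ := c₀
    have hsub : f' 0 ⊆ f' i := d'.strictMono.monotone (Fin.zero_le i)
    have hxf := (d'.sep i).2.1
    refine ⟨⟨p₁, hsub p₁f, p₁k⟩, ⟨p₂, hsub p₂f, p₂k⟩, ?_, x, hxf, k₁⟩
    by_cases hmf : m ∈ f' i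
    · obtain ⟨-, ⟨p, hp, hpf⟩, -, -⟩ := d'.crosses i
      have hmh : m ∉ h' := (hm.notMem hS d'.mem).1 d'.left d'.mid
      by_cases hpk : p ∈ k
      · exact ⟨p, hpf, hpk⟩
      · exact absurd ⟨⟨w', d'.point, k₄⟩, ⟨p, hp, hpk⟩, ⟨m, hmh, k₂⟩, x, d'.left, k₁⟩ c₂
    · exact ⟨m, hmf, k₂⟩
  have := (Set.ncard_le_ncard hsub ((f₁.union f₂).union f₃)).trans (Set.ncard_union_le _ _)
  have := Set.ncard_union_le M₁ M₂
  omega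

theorem IsStabilityDefect.dist_le_of_eq {h h' : Set V} {f f' : Fin (D + 1) → Set V}
    (d : IsStabilityDefect 𝓗 D x y z w h f) (d' : IsStabilityDefect 𝓗 D x y z w' h' f')
    (hff : f 0 = f' 0) (hw : w ∈ pencilHull 𝓗 D x y) (hd : G.dist x w ≤ G.dist x m)
    (hw' : w' ∈ pencilHull 𝓗 D x y) (hd' : G.dist x w' ≤ G.dist x m) :
    G.dist w w' ≤ 10 * B := by
  have hS := S.toIsHalfspaceSystem
  have a₁ := ncard_tripleSep_median_le T S hm hw' hd'
  have a₂ := ncard_tripleSep_median_le T S hm hw hd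
  have a₃ := d.ncard_le_of_eq T S hm d' hff
  have a₄ := d'.ncard_le_of_eq T S hm d hff.symm
  set M := {k ∈ 𝓗 | x ∉ k ∧ m ∈ k ∧ w ∉ k ∧ w' ∈ k} with hM
  set M' := {k ∈ 𝓗 | x ∉ k ∧ m ∈ k ∧ w' ∉ k ∧ w ∈ k} with hM'
  have fM : M.Finite := (S.finite_sepSets x m).subset fun k hk => ⟨hk.1, hk.2.1, hk.2.2.1⟩
  have fM' : M'.Finite := (S.finite_sepSets x m).subset fun k hk => ⟨hk.1, hk.2.1, hk.2.2.1⟩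
  have fT : ∀ w, (tripleSep 𝓗 x m w).Finite := fun w => hS.finite_tripleSep
  have hsub : sepSets 𝓗 w w' ⊆ (tripleSep 𝓗 x m w' ∪ compl '' tripleSep 𝓗 x m w) ∪
      (M ∪ compl '' M') := by
    rintro k ⟨hk, k₁, k₂⟩
    have hk' := S.compl_mem k hk
    by_cases hx : x ∈ k <;> by_cases hmk : m ∈ k
    · exact Or.inl (Or.inr ⟨kᶜ, ⟨hk', by simpa, by simpa, by simpa⟩, compl_compl k⟩)
    · exact Or.inr (Or.inr ⟨kᶜ, ⟨hk', by simpa, by simpa, by simpa, by simpa⟩, compl_compl k⟩)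
    · exact Or.inr (Or.inl ⟨hk, hx, hmk, k₁, k₂⟩)
    · exact Or.inl (Or.inl ⟨hk, hx, hmk, k₂⟩)
  have b₁ := Set.ncard_le_ncard hsub (((fT w').union ((fT w).image _)).union
    (fM.union (fM'.image _)))
  have b₂ := Set.ncard_union_le (tripleSep 𝓗 x m w' ∪ compl '' tripleSep 𝓗 x m w) (M ∪ compl '' M')
  have b₃ := Set.ncard_union_le (tripleSep 𝓗 x m w') (compl '' tripleSep 𝓗 x m w)
  have b₄ := Set.ncard_union_le M (compl '' M')
  rw [Set.ncard_image_of_injective _ compl_injective] at b₃ b₄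
  rw [← S.dist_eq] at b₁
  omega

/-- The pencils of the defects far from the median have few different smallest members: a pencil of
`D + 1` such halfspaces would form a grid with the halfspaces that separate the nearest of the
corresponding points from the median. -/
theorem ncard_smallest_le {K : Set (Set V)}
    (hK : ∀ k ∈ K, ∃ w h f, IsStabilityDefect 𝓗 D x y z w h f ∧
      2 * B * (D + 1) + B < (tripleSep 𝓗 x w m).ncard ∧ f 0 = k) : K.ncard ≤ B := by
  have hS := S.toIsHalfspaceSystem
  refine T.ncard_le x y K ?_ ?_
  · intro k hk
    obtain ⟨w, h, f, d, -, rfl⟩ := hK k hk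
    exact d.sep 0
  rintro ⟨g, hg, hgK⟩
  choose w h f d hfar hfg using fun i => hK (g i) (hgK i)
  obtain ⟨i₀, hi₀⟩ := Finite.exists_min fun i => (tripleSep 𝓗 x (w i) m).ncard
  -- the halfspaces between the nearest point `w i₀` and `m`; most of them are in each `U i`
  set U : Fin (D + 1) → Set (Set V) := fun i => tripleSep 𝓗 x (w i) m with hU
  have fU : ∀ i, (U i).Finite := fun i => hS.finite_tripleSep
  have hUm : ∀ i, U i ⊆ sepSets 𝓗 x m := fun i k hk => ⟨hk.1, hk.2.1, hk.2.2.2⟩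
  have hdiff : ∀ i, (U i₀ \ U i).ncard ≤ B := by
    intro i
    have h₁ := Set.ncard_inter_add_ncard_sdiff_eq_ncard (U i₀) (U i) (fU i₀)
    have h₂ := Set.ncard_inter_add_ncard_sdiff_eq_ncard (U i) (U i₀) (fU i)
    rw [Set.inter_comm] at h₂
    have h₃ := hi₀ i
    have h₄ := T.ncard_le_or_of_crosses (E := U i₀ \ U i) (F := U i \ U i₀)
      (Set.sdiff_subset.trans (hUm i₀)) (Set.sdiff_subset.trans (hUm i)) (by
        rintro k ⟨⟨hk, k₁, k₂, k₃⟩, k₄⟩ l ⟨⟨hl, l₁, l₂, l₃⟩, l₄⟩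
        have hwk : w i ∈ k := by_contra fun hc => k₄ ⟨hk, k₁, hc, k₃⟩
        have hwl : w i₀ ∈ l := by_contra fun hc => l₄ ⟨hl, l₁, hc, l₃⟩
        exact ⟨⟨m, k₃, l₃⟩, ⟨w i, hwk, l₂⟩, ⟨w i₀, k₂, hwl⟩, x, k₁, l₁⟩)
    simp only [hU] at h₁ h₂ h₃ h₄ ⊢
    omega
  set W : Fin (D + 1) → Set (Set V) := fun i => {k ∈ U i | Crosses (h i) k} with hW
  have hWc : ∀ i, (W i).ncard ≤ B := fun i => (d i).ncard_crossing_le T S hm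
  -- those crossing the whole pencil `g` are few; the others lie outside some `U i` or cross some `h i`
  set F := {k ∈ U i₀ | ∀ i, Crosses (g i) k} with hF
  have hFc : F.ncard ≤ B := T.ncard_le_of_pencil_crosses hg
    (fun i => by rw [← hfg i]; exact ((d i).sep 0).1)
    (fun k hk => hUm i₀ hk.1) fun i k hk => hk.2 i
  have hsub : U i₀ ⊆ F ∪ ⋃ i ∈ (Finset.univ : Finset (Fin (D + 1))), ((U i₀ \ U i) ∪ W i) := by
    intro k hk
    by_cases hkF : k ∈ F
    · exact Or.inl hkF
    · right
      have : ∃ i, ¬ Crosses (g i) k := by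
        by_contra hcon
        push Not at hcon
        exact hkF ⟨hk, hcon⟩
      obtain ⟨i, hi⟩ := this
      refine Set.mem_biUnion (Finset.mem_univ i) ?_
      by_cases hki : k ∈ U i
      · refine Or.inr ⟨hki, ?_⟩
        by_contra hc
        exact hi (by rw [← hfg i]; exact (d i).crosses_of_not S hm hki hc)
      · exact Or.inl ⟨hk, hki⟩
  have hfin : (⋃ i ∈ (Finset.univ : Finset (Fin (D + 1))), ((U i₀ \ U i) ∪ W i)).Finite :=
    Set.Finite.biUnion (Finset.finite_toSet _) fun i _ =>
      ((fU i₀).sdiff).union ((fU i).subset fun k hk => hk.1)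
  have c₁ := (Set.ncard_le_ncard hsub (((fU i₀).subset fun k hk => hk.1).union hfin)).trans
    (Set.ncard_union_le _ _)
  have c₂ : (⋃ i ∈ (Finset.univ : Finset (Fin (D + 1))), ((U i₀ \ U i) ∪ W i)).ncard ≤
      (D + 1) * (2 * B) := by
    refine (Finset.set_ncard_biUnion_le _ _).trans ?_
    refine (Finset.sum_le_card_nsmul _ _ (2 * B) fun i _ => ?_).trans ?_
    · have := Set.ncard_union_le (U i₀ \ U i) (W i)
      have := hdiff i
      have := hWc i
      omega
    · simp
  have c₃ := hfar i₀
  have c₄ : (D + 1) * (2 * B) = 2 * B * (D + 1) := Nat.mul_comm _ _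
  change 2 * B * (D + 1) + B < (U i₀).ncard at c₃
  omega

/-- One half of the stability of hulls: the defects are covered by a ball about the median and
one ball for each possible smallest member of a pencil. -/
theorem exists_finset_cover :
    ∃ c : Finset V, c.card ≤ B + 1 ∧ ∀ w ∈ pencilHull 𝓗 D x y, w ∉ pencilHull 𝓗 D x z →
      G.dist x w ≤ G.dist x m → ∃ b ∈ c, G.dist b w ≤ 2 * B * (D + 1) + 10 * B := by
  classical
  set K : Set (Set V) := {k | ∃ w h f, w ∈ pencilHull 𝓗 D x y ∧ G.dist x w ≤ G.dist x m ∧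
    IsStabilityDefect 𝓗 D x y z w h f ∧
      2 * B * (D + 1) + B < (tripleSep 𝓗 x w m).ncard ∧ f 0 = k} with hK
  have hKc : K.ncard ≤ B := ncard_smallest_le T S hm fun k ⟨w, h, f, _, _, h₁⟩ => ⟨w, h, f, h₁⟩
  have hKf : K.Finite := (S.finite_sepSets x y).subset fun k ⟨w, h, f, _, _, d, _, e⟩ =>
    e ▸ d.sep 0
  have hch : ∀ k : K, ∃ w h f, w ∈ pencilHull 𝓗 D x y ∧ G.dist x w ≤ G.dist x m ∧
    IsStabilityDefect 𝓗 D x y z w h f ∧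
      2 * B * (D + 1) + B < (tripleSep 𝓗 x w m).ncard ∧ f 0 = k := fun k => k.2
  choose w₀ h₀ f₀ m₀ d₀ D₀ far₀ e₀ using hch
  have := hKf.fintype
  refine ⟨insert m (Finset.univ.image w₀), ?_, ?_⟩
  · refine (Finset.card_insert_le _ _).trans ?_
    have h₁ : (Finset.univ.image w₀).card ≤ K.ncard := by
      refine Finset.card_image_le.trans ?_
      rw [Finset.card_univ, ← Nat.card_eq_fintype_card]
      exact le_rfl
    omega
  · intro w hw hw' hd
    have hdm := dist_le_of_tripleSep T S hm hw hd
    have hmw : G.dist m w = G.dist w m := SimpleGraph.dist_comm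
    rcases exists_isStabilityDefect T S hm hw' hw with hle | ⟨h, f, d⟩
    · exact ⟨m, Finset.mem_insert_self _ _, by omega⟩
    by_cases hfar : 2 * B * (D + 1) + B < (tripleSep 𝓗 x w m).ncard
    · have hk : f 0 ∈ K := ⟨w, h, f, hw, hd, d, hfar, rfl⟩
      refine ⟨w₀ ⟨f 0, hk⟩, Finset.mem_insert_of_mem (Finset.mem_image_of_mem _
        (Finset.mem_univ _)), ?_⟩
      have := (D₀ ⟨f 0, hk⟩).dist_le_of_eq T S hm d (e₀ ⟨f 0, hk⟩) (m₀ _) (d₀ _) hw hd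
      omega
    · exact ⟨m, Finset.mem_insert_self _ _, by omega⟩

end Stability

theorem IsThin.isStable (T : IsThin 𝓗 D B) (S : IsMedianSystem G 𝓗) {R : ℕ}
    (hR : 2 * B * (D + 1) + 10 * B ≤ R) : G.IsStable (2 * (B + 1)) R (pencilHull 𝓗 D) := by
  classical
  intro x y z
  obtain ⟨m, hm⟩ := S.exists_isMedian x y z
  obtain ⟨c₁, hc₁, hcov₁⟩ := exists_finset_cover T S hm
  obtain ⟨c₂, hc₂, hcov₂⟩ := exists_finset_cover T S hm.perm₂₃
  have hcard : (c₁ ∪ c₂).card ≤ 2 * (B + 1) := (Finset.card_union_le _ _).trans (by omega)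
  -- an enumeration, with repetitions, of the centres
  obtain ⟨b, hb⟩ : ∃ b : Fin (2 * (B + 1)) → V, ∀ v ∈ c₁ ∪ c₂, ∃ i, b i = v := by
    refine ⟨fun i => if h : i.1 < (c₁ ∪ c₂).card then (c₁ ∪ c₂).equivFin.symm ⟨i, h⟩ else x,
      fun v hv => ⟨⟨(c₁ ∪ c₂).equivFin ⟨v, hv⟩, ?_⟩, ?_⟩⟩
    · exact lt_of_lt_of_le (Fin.is_lt _) hcard
    · simp
  -- the Gromov product is the distance from `x` to the median
  have hprod : ∀ w, w ∈ G.vertexBall x (G.gromovProduct x y z) → G.dist x w ≤ G.dist x m := by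
    intro w hw
    have h₁ := hm.dist_add_dist S.toIsHalfspaceSystem
    have h₂ := hm.perm₂₃.dist_add_dist S.toIsHalfspaceSystem
    have h₃ := hm.perm₁₂.perm₂₃.dist_add_dist S.toIsHalfspaceSystem
    rw [SimpleGraph.dist_comm (u := y) (v := m)] at h₃
    simp only [SimpleGraph.vertexBall, SimpleGraph.gromovProduct, Set.mem_ofPred_eq, ← h₁, ← h₂,
      ← h₃] at hw
    push_cast at hw
    exact_mod_cast (by linarith : (G.dist x w : ℝ) ≤ G.dist x m)
  have hball : ∀ v ∈ c₁ ∪ c₂, ∀ w, G.dist v w ≤ 2 * B * (D + 1) + 10 * B →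
      w ∈ ⋃ i, G.vertexBall (b i) R := by
    intro v hv w hvw
    obtain ⟨i, rfl⟩ := hb v hv
    refine Set.mem_iUnion.2 ⟨i, ?_⟩
    simp only [SimpleGraph.vertexBall, Set.mem_ofPred_eq]
    exact_mod_cast hvw.trans hR
  refine ⟨b, Set.Subset.antisymm ?_ ?_⟩
  · rintro w ⟨⟨hw, hwb⟩, hw'⟩
    refine ⟨⟨?_, hwb⟩, hw'⟩
    by_contra hwz
    obtain ⟨v, hv, hvw⟩ := hcov₁ w hw hwz (hprod w hwb)
    exact hw' (hball v (Finset.mem_union_left _ hv) w hvw)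
  · rintro w ⟨⟨hw, hwb⟩, hw'⟩
    refine ⟨⟨?_, hwb⟩, hw'⟩
    by_contra hwy
    obtain ⟨v, hv, hvw⟩ := hcov₂ w hw hwy (hprod w hwb)
    exact hw' (hball v (Finset.mem_union_right _ hv) w hvw)

end Thin
/-! ### Hyperbolic cube complexes -/

namespace CubeComplex

section Interval

variable {V : Type*} {X : CubeComplex V}

theorem IsCAT0.hasGrid_iff (hX : X.IsCAT0) (m : ℕ) :
    X.HasGrid m ↔ HasGridSets X.halfspaceSets m := by
  constructor
  · rintro ⟨h, k, hh, hk, hc⟩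
    exact ⟨fun i => (h i).carrier, fun i => (k i).carrier, fun i j hij => hh i j hij,
      fun i j hij => hk i j hij, fun i => ⟨h i, rfl⟩, fun i => ⟨k i, rfl⟩,
      fun i j => (hX.transverse_iff _ _).1 (hc i j)⟩
  · rintro ⟨f, g, hf, hg, hf', hg', hc⟩
    choose h hh using hf'
    choose k hk using hg'
    refine ⟨h, k, fun i j hij => ?_, fun i j hij => ?_, fun i j => ?_⟩
    · rw [hh, hh]; exact hf hij
    · rw [hk, hk]; exact hg hij
    · rw [hX.transverse_iff, hh, hk]; exact hc i j

theorem IsCAT0.interNumber_le_iff (hX : X.IsCAT0) (h : X.Halfspace) (x y : V) (D : ℕ) :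
    interNumber h (X.separating x y) ≤ (D : ℕ∞) ↔ ¬ ∃ f : Fin (D + 1) → Set V,
      StrictMono f ∧ ∀ i, f i ∈ sepSets X.halfspaceSets x y ∧ Crosses h.carrier (f i) := by
  rw [interNumber, iSup₂_le_iff]
  constructor
  · rintro H ⟨f, hf, hfc⟩
    choose k hk using fun i => (hfc i).1.1
    have := H (D + 1) ⟨k, fun i j hij => by rw [hk, hk]; exact hf hij, fun i => ?_, fun i => ?_⟩
    · rw [Nat.cast_le] at this
      omega
    · refine ⟨?_, ?_⟩
      · rw [hk]; exact (hfc i).1.2.1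
      · rw [hk]; exact (hfc i).1.2.2
    · rw [hX.transverse_iff, hk]; exact (hfc i).2
  · rintro H n ⟨k, hk, hks, hkt⟩
    rw [Nat.cast_le]
    by_contra hn
    refine H ⟨fun i => (k (Fin.castLE (by omega) i)).carrier, fun i j hij => ?_, fun i => ?_⟩
    · exact hk _ _ hij
    · exact ⟨⟨⟨_, rfl⟩, (hks _).1, (hks _).2⟩, (hX.transverse_iff _ _).1 (hkt _)⟩

theorem IsCAT0.intervalD_eq (hX : X.IsCAT0) (D : ℕ) :
    X.intervalD D = pencilHull X.halfspaceSets D := by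
  funext x y
  ext w
  simp only [intervalD, peripheralD, peripheral, Set.mem_iInter, Set.mem_ofPred_eq,
    Set.mem_compl_iff, pencilHull, hX.interNumber_le_iff]
  constructor
  · rintro H _ ⟨h, rfl⟩ hx hy hw
    by_contra hf
    exact H h ⟨⟨hx, hy⟩, hf⟩ hw
  · rintro H h ⟨⟨hx, hy⟩, hf⟩ hw
    exact hf (H h.carrier ⟨h, rfl⟩ hx hy hw)

/-! ### Automorphisms -/

/-- The automorphism of the 1-skeleton induced by an automorphism of a cube complex. -/
def Aut.skeletonIso (g : X.Aut) : X.skeleton ≃g X.skeleton where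
  toEquiv := g.1
  map_rel_iff' {a b} := by
    have h : ({g.1 a, g.1 b} : Set V) = g.1 '' {a, b} := (Set.image_pair _ _ _).symm
    change (g.1 a ≠ g.1 b ∧ {g.1 a, g.1 b} ∈ X.cubes) ↔ (a ≠ b ∧ {a, b} ∈ X.cubes)
    rw [h, g.2, g.1.injective.ne_iff]

end Interval

end CubeComplex

theorem SimpleGraph.Connected.dist_map_le {V W : Type*} {G : SimpleGraph V} {G' : SimpleGraph W}
    (hG : G.Connected) (φ : G ≃g G') (x y : V) : G'.dist (φ x) (φ y) ≤ G.dist x y := by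
  obtain ⟨p, hp⟩ := hG.exists_walk_length_eq_dist x y
  have := SimpleGraph.dist_le (p.map φ.toHom)
  rw [SimpleGraph.Walk.length_map, hp] at this
  exact this

theorem SimpleGraph.Iso.dist_map {V W : Type*} {G : SimpleGraph V} {G' : SimpleGraph W}
    (hG : G.Connected) (φ : G ≃g G') (x y : V) : G'.dist (φ x) (φ y) = G.dist x y := by
  refine (hG.dist_map_le φ x y).antisymm ?_
  have := (φ.connected_iff.1 hG).dist_map_le φ.symm (φ x) (φ y)
  simpa using this

/-- A bijection that preserves the family of halfspaces maps hulls to hulls. -/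
theorem pencilHull_map {V : Type*} {𝓗 : Set (Set V)} (g : Equiv.Perm V)
    (hg : ∀ h ∈ 𝓗, g '' h ∈ 𝓗) (hg' : ∀ h ∈ 𝓗, g.symm '' h ∈ 𝓗) (D : ℕ) (x y : V) :
    pencilHull 𝓗 D (g x) (g y) = g '' pencilHull 𝓗 D x y := by
  have aux : ∀ g : Equiv.Perm V, (∀ h ∈ 𝓗, g '' h ∈ 𝓗) → (∀ h ∈ 𝓗, g.symm '' h ∈ 𝓗) →
      ∀ x y w, w ∈ pencilHull 𝓗 D x y → g w ∈ pencilHull 𝓗 D (g x) (g y) := by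
    intro g hg hg' x y w hw h hh hx hy hwh
    have hmem : ∀ v, v ∈ g.symm '' h ↔ g v ∈ h := by
      intro v
      rw [Equiv.image_symm_eq_preimage, Set.mem_preimage]
    obtain ⟨f, hf, hfc⟩ := hw (g.symm '' h) (hg' h hh) (by rwa [hmem]) (by rwa [hmem])
      (by rwa [hmem])
    refine ⟨fun i => g '' f i, fun i j hij => g.injective.image_strictMono (hf hij),
      fun i => ?_⟩
    obtain ⟨⟨h₁, h₂, h₃⟩, ⟨a, ha, ha'⟩, ⟨b, hb, hb'⟩, ⟨c, hc, hc'⟩, e, he, he'⟩ := hfc i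
    rw [hmem] at ha hb hc he
    refine ⟨⟨hg _ h₁, ?_, ?_⟩, ⟨g a, ha, ?_⟩, ⟨g b, hb, ?_⟩, ⟨g c, hc, ?_⟩, g e, he, ?_⟩ <;>
      rwa [g.injective.mem_set_image]
  ext w
  constructor
  · intro hw
    refine ⟨g.symm w, ?_, by simp⟩
    have := aux g.symm hg' (by simpa using hg) _ _ w hw
    simpa using this
  · rintro ⟨v, hv, rfl⟩
    exact aux g hg hg' x y v hv

namespace CubeComplex

section Main

variable {V : Type*} {X : CubeComplex V}

theorem IsCAT0.image_mem_halfspaceSets (hX : X.IsCAT0) (g : X.Aut) {h : Set V}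
    (hh : h ∈ X.halfspaceSets) : g.1 '' h ∈ X.halfspaceSets := by
  obtain ⟨a, b, hab, rfl⟩ := hX.mem_halfspaceSets.1 hh
  refine hX.mem_halfspaceSets.2 ⟨g.1 a, g.1 b, (Aut.skeletonIso g).map_adj_iff.2 hab, ?_⟩
  ext v
  obtain ⟨w, rfl⟩ := g.1.surjective v
  have hd : ∀ c, X.skeleton.dist (g.1 w) (g.1 c) = X.skeleton.dist w c :=
    (Aut.skeletonIso g).dist_map hX.1.1 w
  rw [g.1.injective.mem_set_image]
  simp only [nearSet, Set.mem_ofPred_eq, hd]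

theorem IsCAT0.intervalD_map (hX : X.IsCAT0) (D : ℕ) (g : X.Aut) (x y : V) :
    X.intervalD D (g.1 x) (g.1 y) = g.1 '' X.intervalD D x y := by
  rw [hX.intervalD_eq]
  exact pencilHull_map g.1 (fun h hh => hX.image_mem_halfspaceSets g hh)
    (fun h hh => hX.image_mem_halfspaceSets g⁻¹ hh) D x y

/-- The hulls of a slim CAT(0) cube complex are globally stable cylinders; the constants depend on
`n = ⌊δ⌋₊` only. -/
theorem IsCAT0.exists_isGreatest_and_isGloballyStable (hX : X.IsCAT0) {δ : ℝ}
    (hδ : X.skeleton.IsSlim δ) {n B : ℕ} (hn : n = ⌊δ⌋₊) (hB : B = (2 * n + 1) * n) :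
    ∃ D : ℕ, IsGreatest {m | X.HasGrid m} D ∧ X.skeleton.IsGloballyStable (B + 2 * n : ℕ)
      (2 * (B + 1)) (2 * B * (n + 1) + 10 * B : ℕ) (X.intervalD D) := by
  have S := hX.isMedianSystem
  have hthin : HasThinRectangles X.halfspaceSets n := hn ▸ hδ.hasThinRectangles S
  have hle : ∀ m, X.HasGrid m → m ≤ n := fun m hm =>
    hthin.grid_le S.toIsHalfspaceSystem ((hX.hasGrid_iff m).1 hm)
  have h0 : X.HasGrid 0 :=
    ⟨Fin.elim0, Fin.elim0, fun i => i.elim0, fun i => i.elim0, fun i => i.elim0⟩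
  obtain ⟨D, hD, hmax⟩ : ∃ D, X.HasGrid D ∧ ∀ m, X.HasGrid m → m ≤ D := by
    classical
    refine ⟨Nat.findGreatest X.HasGrid n, Nat.findGreatest_spec (Nat.zero_le n) h0, fun m hm => ?_⟩
    exact Nat.le_findGreatest (hle m hm) hm
  have hDn := hle D hD
  have T : IsThin X.halfspaceSets D B := hthin.isThin S (fun h => by
    have := hmax _ ((hX.hasGrid_iff _).2 h)
    omega) (hB ▸ Nat.mul_le_mul_left _ hDn)
  refine ⟨D, ⟨hD, fun m hm => hmax m hm⟩, ?_⟩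
  rw [hX.intervalD_eq]
  refine ⟨T.isCylinders S hthin, pencilHull_comm S.toIsHalfspaceSystem D, T.isStable S ?_⟩
  have := Nat.mul_le_mul_left (2 * B) (Nat.add_le_add_right hDn 1)
  omega

end Main

end CubeComplex
/-! ### Rectangles in graphs that embed quasi-isometrically into a hyperbolic graph -/

section Rectangles

variable {V : Type*} {G : SimpleGraph V} {𝓗 : Set (Set V)}

/-- A path of length `2 ^ k` in a slim graph passes close to every point of a geodesic between its
endpoints, where closeness is measured on the scale of `k`: bisect the path. -/
theorem SimpleGraph.IsSlim.exists_dist_le {W : Type*} {Y : SimpleGraph W} (hY : Y.Connected)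
    {Δ : ℕ} (hΔ : Y.IsSlim (Δ : ℝ)) {u : ℕ → W} {l : ℕ} (hu : ∀ i, Y.dist (u i) (u (i + 1)) ≤ l)
    (k a b : ℕ) (hb : b = a + 2 ^ k) {x y : W} (hx : u a = x) (hy : u b = y) (p : Y.Walk x y)
    (hp : Y.IsGeodesicWalk p) {v : W} (hv : v ∈ p.support) :
    ∃ i, Y.dist v (u i) ≤ k * Δ + l := by
  induction k generalizing a b x y v with
  | zero =>
    refine ⟨a, ?_⟩
    have h₁ := hp.dist_add_dist hY hv
    have h₂ := hu a
    rw [pow_zero] at hb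
    subst hb hx hy
    rw [SimpleGraph.dist_comm]
    omega
  | succ k ih =>
    obtain ⟨r, hr⟩ := hY.exists_isGeodesicWalk x (u (a + 2 ^ k))
    obtain ⟨q, hq⟩ := hY.exists_isGeodesicWalk (u (a + 2 ^ k)) y
    have hq' : Y.IsGeodesicWalk q.reverse := by
      rw [IsGeodesicWalk, Walk.length_reverse, hq, SimpleGraph.dist_comm]
    obtain ⟨w, hw, hd⟩ := hΔ x y (u (a + 2 ^ k)) p q.reverse r hp hq' hr v hv
    have hd' : Y.dist v w ≤ Δ := by exact_mod_cast hd
    have hi : ∃ i, Y.dist w (u i) ≤ k * Δ + l := by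
      rcases hw with hw | hw
      · refine ih (a + 2 ^ k) b (by rw [hb, pow_succ]; omega) rfl hy q hq ?_
        rwa [Walk.support_reverse, List.mem_reverse] at hw
      · exact ih a _ rfl hx rfl r hr hw
    obtain ⟨i, hi⟩ := hi
    have := hY.dist_triangle (u := v) (v := w) (w := u i)
    exact ⟨i, by rw [Nat.succ_mul]; omega⟩

/-- `p, s, q, t` are the corners, in cyclic order, of an isometrically embedded square with sides of
length `n`; no halfspace separates `p` from both `s` and `t`. -/
structure IsRectangle (G : SimpleGraph V) (𝓗 : Set (Set V)) (n : ℕ) (p s q t : V) : Prop where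
  disj : ∀ h ∈ 𝓗, p ∉ h → s ∈ h → t ∉ h
  ps : G.dist p s = n
  pt : G.dist p t = n
  sq : G.dist s q = n
  tq : G.dist t q = n
  pq : G.dist p q = n + n

namespace IsRectangle

variable {n : ℕ} {p s q t : V}

theorem symm (R : IsRectangle G 𝓗 n p s q t) : IsRectangle G 𝓗 n p t q s :=
  ⟨fun h hh hp ht hs => R.disj h hh hp hs ht, R.pt, R.ps, R.tq, R.sq, R.pq⟩

/-- Opposite sides of a square are crossed by the same hyperplanes. -/
theorem sepSets_eq (S : IsMedianSystem G 𝓗) (R : IsRectangle G 𝓗 n p s q t) :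
    sepSets 𝓗 p s = sepSets 𝓗 t q := by
  refine Set.eq_of_subset_of_ncard_le ?_ ?_ (S.finite_sepSets _ _)
  · rintro h ⟨hh, h₁, h₂⟩
    refine ⟨hh, R.disj h hh h₁ h₂, by_contra fun h₃ => ?_⟩
    refine S.notMem_of_dist_add (x := p) (y := q) (m := s) ?_ hh h₁ h₃ h₂
    rw [R.ps, R.sq, R.pq]
  · rw [← S.dist_eq, ← S.dist_eq, R.ps, R.tq]

/-- The two paths along the boundary of a square from `p` to `q` are close only near `p`
and `q`. -/
theorem dist_le_or (S : IsMedianSystem G 𝓗) (R : IsRectangle G 𝓗 n p s q t) {v w : V} {E : ℕ}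
    (hE : E < n)
    (hv : G.dist p v + G.dist v s = G.dist p s ∨ G.dist s v + G.dist v q = G.dist s q)
    (hw : G.dist p w + G.dist w t = G.dist p t ∨ G.dist t w + G.dist w q = G.dist t q)
    (hvw : G.dist v w ≤ E) : G.dist p v ≤ E ∨ G.dist v q ≤ E := by
  have hwv : G.dist w v = G.dist v w := SimpleGraph.dist_comm
  have e₁ := R.sepSets_eq S
  have e₂ := R.symm.sepSets_eq S
  have mem₁ : ∀ h, h ∈ sepSets 𝓗 p s → h ∈ sepSets 𝓗 t q := fun h hh => e₁ ▸ hh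
  have mem₂ : ∀ h, h ∈ sepSets 𝓗 s q → h ∈ sepSets 𝓗 p t := fun h hh => by rwa [e₂]
  have mem₃ : ∀ h, h ∈ sepSets 𝓗 p t → h ∈ sepSets 𝓗 s q := fun h hh => e₂ ▸ hh
  rcases hv with hv | hv <;> rcases hw with hw | hw
  · left
    refine le_trans ?_ (hwv.trans_le hvw)
    rw [S.dist_eq, S.dist_eq w v]
    refine Set.ncard_le_ncard ?_ (S.finite_sepSets _ _)
    rintro h ⟨hh, h₁, h₂⟩
    have hs : s ∈ h := by_contra fun h₃ => S.notMem_of_dist_add hv hh h₁ h₃ h₂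
    exact ⟨hh, S.notMem_of_dist_add hw hh h₁ (R.disj h hh h₁ hs), h₂⟩
  · exfalso
    have : n ≤ E := by
      refine le_trans ?_ hvw
      rw [← R.pt, S.dist_eq, S.dist_eq v w]
      refine Set.ncard_le_ncard ?_ (S.finite_sepSets _ _)
      intro h hh
      have h₃ := mem₃ h hh
      exact ⟨hh.1, S.notMem_of_dist_add hv hh.1 hh.2.1 h₃.2.1,
        S.mem_of_dist_add hw hh.1 hh.2.2 h₃.2.2⟩
    omega
  · exfalso
    have : n ≤ E := by
      refine le_trans ?_ (hwv.trans_le hvw)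
      rw [← R.ps, S.dist_eq, S.dist_eq w v]
      refine Set.ncard_le_ncard ?_ (S.finite_sepSets _ _)
      intro h hh
      have h₃ := mem₁ h hh
      exact ⟨hh.1, S.notMem_of_dist_add hw hh.1 hh.2.1 h₃.2.1,
        S.mem_of_dist_add hv hh.1 hh.2.2 h₃.2.2⟩
    omega
  · right
    refine le_trans ?_ hvw
    rw [S.dist_eq, S.dist_eq v w]
    refine Set.ncard_le_ncard ?_ (S.finite_sepSets _ _)
    rintro h ⟨hh, h₁, h₂⟩
    have hs : s ∉ h := fun h₃ => h₁ (S.mem_of_dist_add hv hh h₃ h₂)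
    have ht := mem₂ h ⟨hh, hs, h₂⟩
    exact ⟨hh, h₁, S.mem_of_dist_add hw hh ht.2.2 h₂⟩

end IsRectangle

/-- A thick rectangle contains a large isometrically embedded square: pass to medians, then
shorten the sides. -/
theorem exists_isRectangle (S : IsMedianSystem G 𝓗) {n : ℕ} (hn : ¬ HasThinRectangles 𝓗 n) :
    ∃ p s q t, IsRectangle G 𝓗 n p s q t := by
  have hS := S.toIsHalfspaceSystem
  simp only [HasThinRectangles, not_forall, not_or, not_le] at hn
  obtain ⟨p, q, s₀, t₀, hA, hB⟩ := hn
  obtain ⟨s, hs⟩ := S.exists_isMedian p q s₀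
  obtain ⟨t, ht⟩ := S.exists_isMedian p q t₀
  obtain ⟨p', hp'⟩ := S.exists_isMedian p s t
  have hps : n ≤ G.dist p' s := by
    refine hA.le.trans ?_
    rw [S.dist_eq]
    refine Set.ncard_le_ncard ?_ (S.finite_sepSets _ _)
    rintro h ⟨⟨hh, h₁, h₂⟩, -, h₃, h₄⟩
    exact ⟨hh, (hp'.notMem hS hh).2.1 h₁ ((ht.notMem hS hh).2.1 h₁ h₃), (hs h hh).2.2 h₄ h₂⟩
  have hpt : n ≤ G.dist p' t := by
    refine hB.le.trans ?_
    rw [S.dist_eq]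
    refine Set.ncard_le_ncard ?_ (S.finite_sepSets _ _)
    rintro h ⟨⟨hh, h₁, h₂⟩, -, h₃, h₄⟩
    exact ⟨hh, (hp'.notMem hS hh).1 h₁ ((hs.notMem hS hh).2.1 h₁ h₃), (ht h hh).2.2 h₄ h₂⟩
  obtain ⟨g₁, hg₁⟩ := S.connected.exists_isGeodesicWalk p' s
  obtain ⟨g₂, hg₂⟩ := S.connected.exists_isGeodesicWalk p' t
  obtain ⟨s', hs', hds⟩ := hg₁.exists_dist_eq S.connected hps
  obtain ⟨t', ht', hdt⟩ := hg₂.exists_dist_eq S.connected hpt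
  have ds := hg₁.dist_add_dist S.connected hs'
  have dt := hg₂.dist_add_dist S.connected ht'
  obtain ⟨q', hq'⟩ := S.exists_isMedian s' t' q
  have disj : ∀ h ∈ 𝓗, p' ∉ h → s' ∈ h → t' ∉ h := by
    intro h hh h₁ h₂ h₃
    have hs : s ∈ h := by_contra fun h₄ => S.notMem_of_dist_add ds hh h₁ h₄ h₂
    have ht : t ∈ h := by_contra fun h₄ => S.notMem_of_dist_add dt hh h₁ h₄ h₃
    exact h₁ ((hp' h hh).2.2 hs ht)
  have hqs : ∀ h ∈ 𝓗, p' ∉ h → s' ∈ h → q' ∈ h := by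
    intro h hh h₁ h₂
    have hsh : s ∈ h := by_contra fun h₄ => S.notMem_of_dist_add ds hh h₁ h₄ h₂
    have hp : p ∉ h := fun h₃ => h₁ ((hp' h hh).1 h₃ hsh)
    have hq : q ∈ h := by_contra fun h₃ => (hs.notMem hS hh).1 hp h₃ hsh
    exact (hq' h hh).2.1 h₂ hq
  have hqt : ∀ h ∈ 𝓗, p' ∉ h → t' ∈ h → q' ∈ h := by
    intro h hh h₁ h₂
    have hth : t ∈ h := by_contra fun h₄ => S.notMem_of_dist_add dt hh h₁ h₄ h₂
    have hp : p ∉ h := fun h₃ => h₁ ((hp' h hh).2.1 h₃ hth)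
    have hq : q ∈ h := by_contra fun h₃ => (ht.notMem hS hh).1 hp h₃ hth
    exact (hq' h hh).2.2 h₂ hq
  have hpq : G.dist p' q' = n + n := by
    have e : sepSets 𝓗 p' q' = sepSets 𝓗 p' s' ∪ sepSets 𝓗 p' t' := by
      ext h
      constructor
      · rintro ⟨hh, h₁, h₂⟩
        by_cases h₃ : s' ∈ h
        · exact Or.inl ⟨hh, h₁, h₃⟩
        · exact Or.inr ⟨hh, h₁, by_contra fun h₄ => (hq'.notMem hS hh).1 h₃ h₄ h₂⟩
      · rintro (⟨hh, h₁, h₂⟩ | ⟨hh, h₁, h₂⟩)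
        · exact ⟨hh, h₁, hqs h hh h₁ h₂⟩
        · exact ⟨hh, h₁, hqt h hh h₁ h₂⟩
    rw [S.dist_eq, e, Set.ncard_union_eq ?_ (S.finite_sepSets _ _) (S.finite_sepSets _ _),
      ← S.dist_eq, ← S.dist_eq, hds, hdt]
    exact Set.disjoint_left.2 fun h h₁ h₂ => disj h h₁.1 h₁.2.1 h₁.2.2 h₂.2.2
  have d₁ := hS.dist_add_of_forall_mem (x := p') (y := q') (m := s') fun h hh h₁ h₂ =>
    by_contra fun h₃ => hqs hᶜ (S.compl_mem h hh) (by simpa) h₃ h₂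
  have d₂ := hS.dist_add_of_forall_mem (x := p') (y := q') (m := t') fun h hh h₁ h₂ =>
    by_contra fun h₃ => hqt hᶜ (S.compl_mem h hh) (by simpa) h₃ h₂
  exact ⟨p', s', q', t', disj, hds, hdt, by omega, by omega, hpq⟩

theorem exists_mul_add_one_lt_two_pow (M : ℕ) : ∃ k, M * (k + 1) < 2 ^ k := by
  refine ⟨2 * (M + 2), ?_⟩
  have h : M + 1 ≤ 2 ^ M := Nat.lt_two_pow_self
  have e : 2 ^ (2 * (M + 2)) = 16 * (2 ^ M * 2 ^ M) := by
    rw [← pow_add, show 2 * (M + 2) = 4 + (M + M) by ring, pow_add]; norm_num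
  rw [e]
  nlinarith [Nat.mul_le_mul h h]

/-- If a median graph maps to a hyperbolic graph by a Lipschitz map which does not contract large
distances too much, then its rectangles are thin: the image of a large square would have two
boundary paths, both close to a geodesic between opposite corners, hence close to each other. -/
theorem exists_hasThinRectangles (S : IsMedianSystem G 𝓗) {W : Type*} {Y : SimpleGraph W}
    (hY : Y.Connected) {δ : ℝ} (hδ : Y.IsSlim δ) (f : V → W) (l c : ℕ)
    (hl : ∀ x y, G.Adj x y → Y.dist (f x) (f y) ≤ l)
    (hc : ∀ x y, G.dist x y ≤ c * (Y.dist (f x) (f y) + 1)) : ∃ n, HasThinRectangles 𝓗 n := by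
  -- `k` is such that the side length `2 ^ k` exceeds the errors, which are linear in `k`
  set Δ := ⌈δ⌉₊ with hΔ
  have hΔ' : Y.IsSlim (Δ : ℝ) := fun x y z p q r hp hq hr v hv => by
    obtain ⟨w, hw, hd⟩ := hδ x y z p q r hp hq hr v hv
    exact ⟨w, hw, hd.trans (Nat.le_ceil δ)⟩
  obtain ⟨k, hk⟩ := exists_mul_add_one_lt_two_pow (3 * (c * (2 * (Δ + l) + 2)))
  refine ⟨2 ^ k, by_contra fun hn => ?_⟩
  obtain ⟨p, s, q, t, R⟩ := exists_isRectangle S hn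
  set F := (k + 1) * Δ + l with hF
  set E := c * (2 * F + 2) with hE
  have hEn : 3 * E < 2 ^ k := by
    refine lt_of_le_of_lt ?_ hk
    have : 2 * F + 2 ≤ (2 * (Δ + l) + 2) * (k + 1) := by
      rw [hF]; nlinarith [Nat.zero_le (k * l), Nat.zero_le k]
    have := Nat.mul_le_mul_left (3 * c) this
    calc 3 * E = 3 * c * (2 * F + 2) := by rw [hE]; ring
      _ ≤ _ := this
      _ = _ := by ring
  have hE₁ : ∀ x y, Y.dist (f x) (f y) + 1 ≤ 2 * F + 2 → G.dist x y ≤ E := fun x y h =>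
    (hc x y).trans (Nat.mul_le_mul_left c h)
  -- a path of length `2 ^ (k + 1)` in the median graph is mapped close to the geodesic
  have close : ∀ (g : G.Walk p q), g.length = 2 ^ (k + 1) → ∀ (γ : Y.Walk (f p) (f q)),
      Y.IsGeodesicWalk γ → ∀ v ∈ γ.support, ∃ x ∈ g.support, Y.dist v (f x) ≤ F := by
    intro g hg γ hγ v hv
    obtain ⟨i, hi⟩ := hΔ'.exists_dist_le hY (u := fun i => f (g.getVert i)) (l := l) (by
      intro i
      by_cases hi : i < g.length
      · exact hl _ _ (g.adj_getVert_succ hi)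
      · rw [g.getVert_of_length_le (by omega), g.getVert_of_length_le (by omega)]
        simp) (k + 1) 0 g.length (by rw [hg, Nat.zero_add]) (by rw [g.getVert_zero])
      (by rw [g.getVert_length]) γ hγ hv
    exact ⟨_, g.getVert_mem_support i, hi⟩
  have geod := fun x y => S.connected.exists_isGeodesicWalk x y
  obtain ⟨g₁, hg₁⟩ := geod p s
  obtain ⟨g₂, hg₂⟩ := geod s q
  obtain ⟨g₃, hg₃⟩ := geod p t
  obtain ⟨g₄, hg₄⟩ := geod t q
  obtain ⟨γ, hγ⟩ := hY.exists_isGeodesicWalk (f p) (f q)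
  have two : 2 ^ (k + 1) = 2 ^ k + 2 ^ k := by rw [pow_succ]; omega
  have near : ∀ v ∈ γ.support, ∃ x, Y.dist v (f x) ≤ F ∧ (G.dist p x ≤ E ∨ G.dist x q ≤ E) := by
    intro v hv
    obtain ⟨x, hx, hvx⟩ := close (g₁.append g₂) (by
      rw [SimpleGraph.Walk.length_append, hg₁, hg₂, R.ps, R.sq, two]) γ hγ v hv
    obtain ⟨y, hy, hvy⟩ := close (g₃.append g₄) (by
      rw [SimpleGraph.Walk.length_append, hg₃, hg₄, R.pt, R.tq, two]) γ hγ v hv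
    rw [SimpleGraph.Walk.mem_support_append_iff] at hx hy
    have hxy := hY.dist_triangle (u := f x) (v := v) (w := f y)
    rw [SimpleGraph.dist_comm (u := f x) (v := v)] at hxy
    refine ⟨x, hvx, R.dist_le_or S (E := E) (w := y) (by omega) ?_ ?_ (hE₁ x y (by omega))⟩
    · exact hx.imp (hg₁.dist_add_dist S.connected) (hg₂.dist_add_dist S.connected)
    · exact hy.imp (hg₃.dist_add_dist S.connected) (hg₄.dist_add_dist S.connected)
  -- all points of the geodesic are close to images of points near `p`
  have walk : ∀ i, ∃ x, Y.dist (γ.getVert i) (f x) ≤ F ∧ G.dist p x ≤ E := by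
    intro i
    induction i with
    | zero => exact ⟨p, by simp, by simp⟩
    | succ i ih =>
      obtain ⟨x, hx, hpx⟩ := ih
      obtain ⟨y, hy, hpy | hyq⟩ := near _ (γ.getVert_mem_support (i + 1))
      · exact ⟨y, hy, hpy⟩
      · exfalso
        have h₁ : Y.dist (γ.getVert i) (γ.getVert (i + 1)) ≤ 1 := by
          by_cases hi : i < γ.length
          · exact (SimpleGraph.dist_eq_one_iff_adj.2 (γ.adj_getVert_succ hi)).le
          · rw [γ.getVert_of_length_le (by omega), γ.getVert_of_length_le (by omega)]
            simp
        have h₂ := hY.dist_triangle (u := f x) (v := γ.getVert i) (w := f y)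
        have h₃ := hY.dist_triangle (u := γ.getVert i) (v := γ.getVert (i + 1)) (w := f y)
        rw [SimpleGraph.dist_comm (u := f x) (v := γ.getVert i)] at h₂
        have h₄ := hE₁ x y (by omega)
        have h₅ := S.connected.dist_triangle (u := p) (v := x) (w := q)
        have h₆ := S.connected.dist_triangle (u := x) (v := y) (w := q)
        rw [R.pq] at h₅
        omega
  obtain ⟨x, hx, hpx⟩ := walk γ.length
  rw [γ.getVert_length] at hx
  have h₁ := hE₁ q x (by omega)
  have h₂ := S.connected.dist_triangle (u := p) (v := x) (w := q)
  rw [SimpleGraph.dist_comm (u := x) (v := q), R.pq] at h₂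
  omega

end Rectangles

/-! ### Cubulated hyperbolic groups -/

/-- Left translation as an automorphism of the Cayley graph. -/
def SimpleGraph.mulCayleyIso {G : Type*} [Group G] (S : Set G) (g : G) :
    SimpleGraph.mulCayley S ≃g SimpleGraph.mulCayley S where
  toEquiv := Equiv.mulLeft g
  map_rel_iff' := SimpleGraph.mulCayley_adj_mul_iff_right

theorem Set.Finite.exists_forall_le {α : Type*} {s : Set α} (hs : s.Finite) (f : α → ℕ) :
    ∃ n, ∀ a ∈ s, f a ≤ n := by
  obtain ⟨n, hn⟩ := (hs.image f).bddAbove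
  exact ⟨n, fun a ha => hn ⟨a, ha, rfl⟩⟩

section Groups

variable {G : Type*} [Group G] {V : Type*} {X : CubeComplex V}

theorem finite_setOf_singleton_mem {K : Set (Set V)} (hK : K.Finite) :
    {y : V | ({y} : Set V) ∈ K}.Finite :=
  hK.preimage Set.singleton_injective.injOn

/-- If the translates of `K` are all the cubes, then each vertex is a translate of a vertex
in `K`. -/
theorem CubeComplex.exists_apply_eq (ρ : G →* X.Aut) {K : Set (Set V)}
    (hcov : ∀ Q ∈ X.cubes, ∃ P ∈ K, ∃ g : G, Q = (ρ g : Equiv.Perm V) '' P) (x : V) :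
    ∃ y : V, ({y} : Set V) ∈ K ∧ ∃ g : G, (ρ g : Equiv.Perm V) y = x := by
  obtain ⟨P, hP, g, hg⟩ := hcov {x} (X.singleton_mem x)
  obtain ⟨y, hy, hyx⟩ : x ∈ (ρ g : Equiv.Perm V) '' P := by rw [← hg]; rfl
  have hPy : P = {y} := by
    refine Set.Subset.antisymm (fun z hz => ?_) (by simpa using hy)
    have hz' : (ρ g : Equiv.Perm V) z ∈ ({x} : Set V) := by rw [hg]; exact ⟨z, hz, rfl⟩
    exact (ρ g : Equiv.Perm V).injective (hz'.trans hyx.symm)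
  exact ⟨y, hPy ▸ hP, g, hyx⟩

/-- A hyperbolic group acts properly and cocompactly only on CAT(0) cube complexes with thin
rectangles, since the vertices of the complex are close to an orbit. -/
theorem CubeComplex.IsCAT0.exists_hasThinRectangles (hX : X.IsCAT0) (hG : IsHyperbolicGroup G)
    (ρ : G →* X.Aut)
    (hprop : ∀ (x : V) (r : ℕ), {g : G | X.skeleton.dist x ((ρ g : Equiv.Perm V) x) ≤ r}.Finite)
    {K : Set (Set V)} (hK : K.Finite)
    (hcov : ∀ Q ∈ X.cubes, ∃ P ∈ K, ∃ g : G, Q = (ρ g : Equiv.Perm V) '' P) :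
    ∃ n, HasThinRectangles X.halfspaceSets n := by
  obtain ⟨T, hT, -, hY, δ, hδ⟩ := hG
  obtain ⟨x₀⟩ := hX.1.1.nonempty
  have hiso : ∀ (g : G) (x y : V), X.skeleton.dist ((ρ g : Equiv.Perm V) x)
      ((ρ g : Equiv.Perm V) y) = X.skeleton.dist x y := fun g x y =>
    (CubeComplex.Aut.skeletonIso (ρ g)).dist_map hX.1.1 x y
  have hmul : ∀ (g h : G) (x : V), (ρ (g * h) : Equiv.Perm V) x =
      (ρ g : Equiv.Perm V) ((ρ h : Equiv.Perm V) x) := by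
    intro g h x
    rw [map_mul]
    rfl
  obtain ⟨c₀, hc₀⟩ := (finite_setOf_singleton_mem hK).exists_forall_le (X.skeleton.dist x₀)
  have hf : ∀ x : V, ∃ g : G, X.skeleton.dist ((ρ g : Equiv.Perm V) x₀) x ≤ c₀ := by
    intro x
    obtain ⟨y, hy, g, rfl⟩ := CubeComplex.exists_apply_eq ρ hcov x
    exact ⟨g, by rw [hiso]; exact hc₀ y hy⟩
  choose f hf using hf
  -- translating to the identity, distances in the group and along the orbit control each other
  obtain ⟨l, hl⟩ := (hprop x₀ (2 * c₀ + 1)).exists_forall_le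
    fun g => (SimpleGraph.mulCayley T).dist 1 g
  obtain ⟨c₁, hc₁⟩ := hT.exists_forall_le
    fun g => X.skeleton.dist x₀ ((ρ g : Equiv.Perm V) x₀)
  have htrans : ∀ g h : G, X.skeleton.dist ((ρ g : Equiv.Perm V) x₀) ((ρ h : Equiv.Perm V) x₀) =
      X.skeleton.dist x₀ ((ρ (g⁻¹ * h) : Equiv.Perm V) x₀) := by
    intro g h
    rw [← hiso g x₀ ((ρ (g⁻¹ * h) : Equiv.Perm V) x₀), ← hmul g (g⁻¹ * h), mul_inv_cancel_left]
  have hwalk : ∀ {g h : G} (p : (SimpleGraph.mulCayley T).Walk g h),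
      X.skeleton.dist ((ρ g : Equiv.Perm V) x₀) ((ρ h : Equiv.Perm V) x₀) ≤ c₁ * p.length := by
    intro g h p
    induction p with
    | nil => simp
    | @cons g g' h hadj p ih =>
      have h₁ : X.skeleton.dist ((ρ g : Equiv.Perm V) x₀) ((ρ g' : Equiv.Perm V) x₀) ≤ c₁ := by
        rw [SimpleGraph.mulCayley_adj] at hadj
        rcases hadj.2 with h₂ | h₂
        · rw [htrans]; exact hc₁ _ h₂
        · rw [SimpleGraph.dist_comm, htrans]; exact hc₁ _ h₂
      have h₂ := hX.1.1.dist_triangle (u := (ρ g : Equiv.Perm V) x₀)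
        (v := (ρ g' : Equiv.Perm V) x₀) (w := (ρ h : Equiv.Perm V) x₀)
      rw [SimpleGraph.Walk.length_cons, Nat.mul_succ]
      omega
  have hfx : ∀ x y, X.skeleton.dist ((ρ (f x) : Equiv.Perm V) x₀) ((ρ (f y) : Equiv.Perm V) x₀) ≤
      2 * c₀ + X.skeleton.dist x y ∧ X.skeleton.dist x y ≤ 2 * c₀ +
        X.skeleton.dist ((ρ (f x) : Equiv.Perm V) x₀) ((ρ (f y) : Equiv.Perm V) x₀) := by
    intro x y
    have h₁ := hf x
    have h₂ := hf y
    set a := (ρ (f x) : Equiv.Perm V) x₀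
    set b := (ρ (f y) : Equiv.Perm V) x₀
    have t₁ := hX.1.1.dist_triangle (u := a) (v := x) (w := b)
    have t₂ := hX.1.1.dist_triangle (u := x) (v := y) (w := b)
    have t₃ := hX.1.1.dist_triangle (u := x) (v := a) (w := y)
    have t₄ := hX.1.1.dist_triangle (u := a) (v := b) (w := y)
    have e₁ : X.skeleton.dist y b = X.skeleton.dist b y := SimpleGraph.dist_comm
    have e₂ : X.skeleton.dist x a = X.skeleton.dist a x := SimpleGraph.dist_comm
    omega
  refine _root_.exists_hasThinRectangles hX.isMedianSystem hY hδ f l (2 * c₀ + c₁) ?_ ?_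
  · intro x y hxy
    have h₁ := (hfx x y).1
    rw [SimpleGraph.dist_eq_one_iff_adj.2 hxy, htrans] at h₁
    have h₂ := hl ((f x)⁻¹ * f y) h₁
    have h₃ := (SimpleGraph.mulCayleyIso T (f x)).dist_map hY 1 ((f x)⁻¹ * f y)
    change (SimpleGraph.mulCayley T).dist (f x * 1) (f x * ((f x)⁻¹ * f y)) = _ at h₃
    rw [mul_one, mul_inv_cancel_left] at h₃
    rw [h₃]
    exact h₂
  · intro x y
    obtain ⟨p, hp⟩ := hY.exists_walk_length_eq_dist (f x) (f y)
    have h₁ := hwalk p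
    have h₂ := (hfx x y).2
    rw [hp] at h₁
    nlinarith [Nat.zero_le ((SimpleGraph.mulCayley T).dist (f x) (f y) * c₀)]

end Groups

theorem mainTheorem1 :
    (∀ (δ : ℝ) (d : ℕ), ∃ (θ : ℝ) (k : ℕ) (R : ℝ), 0 ≤ θ ∧ 0 ≤ R ∧
      ∀ (V : Type v) (X : CubeComplex V), X.IsCAT0 → X.DimLE d → X.skeleton.IsSlim δ →
        ∃ D : ℕ, IsGreatest {m | X.HasGrid m} D ∧
          X.skeleton.IsGloballyStable θ k R (X.intervalD D) ∧
          ∀ g ∈ X.Aut, ∀ x y : V,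
            X.intervalD D (g x) (g y) = g '' X.intervalD D x y) ∧
    (∀ (G : Type u) [Group G], IsHyperbolicGroup G → IsCubulated.{u, v} G →
      AdmitsGloballyStableCylinders.{u, v} G) := by
  constructor
  · intro δ _
    let n := ⌊δ⌋₊
    let B := (2 * n + 1) * n
    refine ⟨(B + 2 * n : ℕ), 2 * (B + 1), (2 * B * (n + 1) + 10 * B : ℕ), Nat.cast_nonneg _,
      Nat.cast_nonneg _, fun V X hX _ hδ => ?_⟩
    obtain ⟨D, hD, hC⟩ := hX.exists_isGreatest_and_isGloballyStable hδ rfl rfl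
    exact ⟨D, hD, hC, fun g hg => hX.intervalD_map D ⟨g, hg⟩⟩
  · rintro G _ hG ⟨V, X, ρ, hX, hprop, K, hK, hcov⟩
    obtain ⟨n, hn⟩ := hX.exists_hasThinRectangles hG ρ hprop hK hcov
    have hδ := hn.isSlim hX.isMedianSystem
    obtain ⟨D, -, hC⟩ := hX.exists_isGreatest_and_isGloballyStable hδ rfl rfl
    refine ⟨V, X.skeleton, ⟨⟨fun g => CubeComplex.Aut.skeletonIso (ρ g), ?_⟩, ?_⟩,
      ⟨hX.1.1, _, hδ⟩, hprop, ?_, ?_, _, _, _, X.intervalD D, Nat.cast_nonneg _,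
      Nat.cast_nonneg _, hC, fun g x y => hX.intervalD_map D (ρ g) x y⟩
    · ext x
      change (ρ 1 : Equiv.Perm V) x = x
      rw [map_one]; rfl
    · intro g h
      ext x
      change (ρ (g * h) : Equiv.Perm V) x = (ρ g : Equiv.Perm V) ((ρ h : Equiv.Perm V) x)
      rw [map_mul]; rfl
    · refine ⟨_, finite_setOf_singleton_mem hK, fun x => ?_⟩
      obtain ⟨y, hy, g, rfl⟩ := CubeComplex.exists_apply_eq ρ hcov x
      exact ⟨y, hy, g, rfl⟩
    · refine ⟨{e | {v | v ∈ e} ∈ K}, hK.preimage (f := fun e : Sym2 V => {v | v ∈ e}) ?_, ?_⟩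
      · intro e _ e' _ h
        exact Sym2.ext fun v => by
          have := Set.ext_iff.1 h v
          exact this
      · intro e he
        induction e using Sym2.ind with
        | _ a b =>
        obtain ⟨P, hP, g, hg⟩ := hcov {a, b} he.2
        refine ⟨s((ρ g : Equiv.Perm V).symm a, (ρ g : Equiv.Perm V).symm b), ?_, g, ?_⟩
        · have : P = {v | v ∈ s((ρ g : Equiv.Perm V).symm a, (ρ g : Equiv.Perm V).symm b)} := by
            have hs : ∀ p q : V, {v | v ∈ s(p, q)} = {p, q} := fun p q => by ext; simp
            apply (ρ g : Equiv.Perm V).injective.image_injective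
            rw [← hg, hs, Set.image_pair, Equiv.apply_symm_apply, Equiv.apply_symm_apply]
          rw [this] at hP
          exact hP
        · change s(a, b) = s((ρ g : Equiv.Perm V) _, (ρ g : Equiv.Perm V) _)
          rw [Equiv.apply_symm_apply, Equiv.apply_symm_apply]
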